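/- **Notation.** For a domain $\Omega\subset\mathbb R^2$, $d(z)$ denotes the distance from $z\in\Omega$ to $\partial\Omega$. For continuous $\rho:\Omega\to(0,\infty)$ let $d_\rho(x,y)=\inf_\gamma\int_\gamma\rho\,|dz|$, the infimum over rectifiable curves in $\Omega$ joining $x$ and $y$; $d$ denotes the internal metric $d_\rho$ for $\rho\equiv1$. Let $\overline\Omega^{\rho}$ and $\overline\Omega^{d}$ be the metric completions of $\Omega$ in $d_\rho$ and $d$, and put $\partial_\rho\Omega=\overline\Omega^{\rho}\setminus\Omega$, $\partial_d\Omega=\overline\Omega^{d}\setminus\Omega$. A *density* is a continuous $\rho:\Omega\to(0,\infty)$ with $\partial_\rho\Omega\ne\emptyset$ such that every sequence in $\Omega$ that converges in $\overline\Omega^{\rho}$ converges in $\overline\Omega^{d}$, and every sequence in $\Omega$ that converges in $\overline\Omega^{d}$ has at most one accumulation point in $\partial_\rho\Omega$. Then $\partial_\rho\Omega$ is identified with a subset of $\partial_d\Omega$. Write $\dim_\rho,\operatorname{Dim}_\rho$ (resp. $\dim_d,\operatorname{Dim}_d$) for Hausdorff and packing dimension with respect to $d_\rho$ (resp. $d$),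 and $$i^-(x)=\liminf_{y\to x,\ y\in\Omega}\frac{\log\rho(y)}{\log d(y)},\qquad i^+(x)=\limsup_{y\to x,\ y\in\Omega}\frac{\log\rho(y)}{\log d(y)}\qquad(x\in\partial_d\Omega),$$ with $y\to x$ in the internal metric. $\Omega$ is a *John domain* if for some $0<\alpha\le1$ and $x_0\in\Omega$ every $x\in\Omega$ can be joined to $x_0$ by a curve $\gamma$ in $\Omega$, parametrized by arc length from $x$, with $d(\gamma(t))\ge\alpha t$ for all $t$. **Construction.** Let $0<s<1/2$ and $0<\alpha_1<1/2$. Put $l_0=1$ and define $l_k,\alpha_k$ by $$l_{k+1}=l_k\frac{1-\alpha_{k+1}}2\quad(k\ge0),\qquad \alpha_{k+1}=l_k^{1-2s}\frac{1-\alpha_{k+1}}2\quad(k\ge1).$$ Start with an open equilateral triangle $\Omega_0$ with sides of length $l_0$. At step $k$ there are $3\cdot4^k$ boundary segments of length $l_k$; replace the middle $\alpha_{k+1}$-th portion of each of them by two segments of length $l_{k+1}$ outside the current domain, forming an isosceles triangle (spike) over that portion, and let $\Omega_{k+1}$ be the domain bounded by the new segments. Let $\Omega=\bigcup_k\Omega_k$.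 The four segments that replace a segment are numbered $1,2,3,4$ in their order along the curve, so that $2,3$ are the sides of the spike. Fix one side of the triangle. The boundary point with address $(a_1,a_2,\dots)\in\{1,2,3,4\}^{\mathbb N}$ over this side is the limit of the midpoints of the nested segments with addresses $a_1\dots a_k$. Let $\rho(z)=d(z)^{-1/2}$, and let $A$ be the set of the points of $\overline\Omega^{\rho}$ with an address in $\{2,3\}^{\mathbb N}$ over this side (limits taken in $d_\rho$). **Claim.** For all such $s$ and $\alpha_1$: $\Omega$ is a domain which is not a John domain; $\rho$ is a density on $\Omega$; $i^-(x)=i^+(x)=-1/2$ for all $x\in\partial_d\Omega$; $A\subset\partial_\rho\Omega$; and, with $D_1=1$ and $D_2=2$, $$\dim_d(A)=\operatorname{Dim}_d(A)=D_1,\qquad \dim_d(\partial_d\Omega)=\operatorname{Dim}_d(\partial_d\Omega)=D_2,\qquad \dim_\rho(A)=\operatorname{Dim}_\rho(A)=\frac{D_1}{s}>2D_1.$$ Consequently, for this $\Omega$, this $\rho$ and $\beta=-1/2$, both of the following statements are false: * $(1+\beta)\dim_\rho(B)\le\dim_d(B)$ for all $B\subset\{x\in\partial_\rho\Omega: i^-(x)\ge\beta\}$;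 * $(1+\beta)\operatorname{Dim}_\rho(B)\le\operatorname{Dim}_d(B)$ for all $B\subset\{x\in\partial_\rho\Omega: i^-(x)\ge\beta\}$. -/

import Mathlib

open Set Filter Topology MeasureTheory
open scoped ENNReal NNReal

noncomputable section

/-! ### Curves, the `ρ`-length and the metric `d_ρ` -/

section Curves

variable {E : Type*}

/-- `γ` restricted to `[0, L]` is a rectifiable curve in `Ω`, parametrized by arc length,
from `x` to `y` (so its Euclidean length is `L`). -/
structure IsCurveIn [PseudoEMetricSpace E] (Ω : Set E) (γ : ℝ → E) (L : ℝ) (x y : E) : Prop where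
  nonneg : 0 ≤ L
  unitSpeed : HasUnitSpeedOn γ (Icc 0 L)
  mem : ∀ t ∈ Icc 0 L, γ t ∈ Ω
  start : γ 0 = x
  finish : γ L = y

/-- The `ρ`-length `∫_γ ρ |dz|` of a curve parametrized by arc length on `[0, L]`. -/
def rhoLength (ρ : E → ℝ) (γ : ℝ → E) (L : ℝ) : ℝ≥0∞ :=
  ∫⁻ t in Icc 0 L, ENNReal.ofReal (ρ (γ t))

/-- The `ρ`-distance: infimum of the `ρ`-lengths of the curves in `Ω` that join `x` and `y`.
For `ρ = 1` this is the internal distance, the infimum of the lengths. -/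
def rhoEDist [PseudoEMetricSpace E] (Ω : Set E) (ρ : E → ℝ) (x y : E) : ℝ≥0∞ :=
  ⨅ (γ : ℝ → E) (L : ℝ) (_ : IsCurveIn Ω γ L x y), rhoLength ρ γ L

/-- Distance to the boundary, `d(x)` for `x ∈ Ω`. -/
def bdryDist [PseudoMetricSpace E] (Ω : Set E) (x : E) : ℝ := Metric.infDist x (frontier Ω)

theorem rhoLength_reverse {ρ : E → ℝ} (γ : ℝ → E) (L : ℝ) :
    rhoLength ρ (fun t => γ (L - t)) L = rhoLength ρ γ L := by
  have := (Measure.measurePreserving_sub_left (volume : Measure ℝ) L).setLIntegral_comp_preimage_emb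
    (measurableEmbedding_subLeft L) (fun t => ENNReal.ofReal (ρ (γ t))) (Icc 0 L)
  have hp : (fun t => L - t) ⁻¹' Icc 0 L = Icc 0 L := by
    ext t; simp [and_comm]
  rw [hp] at this
  exact this

theorem rhoLength_append_le {ρ : E → ℝ} {γ γ' : ℝ → E} {L L' : ℝ} (hL : 0 ≤ L) (hL' : 0 ≤ L')
    (hglue : γ L = γ' 0) :
    rhoLength ρ (fun t => if t ≤ L then γ t else γ' (t - L)) (L + L')
      ≤ rhoLength ρ γ L + rhoLength ρ γ' L' := by
  unfold rhoLength
  rw [← Icc_union_Icc_eq_Icc hL (by linarith : L ≤ L + L')]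
  refine (lintegral_union_le _ _ _).trans (add_le_add (le_of_eq ?_) (le_of_eq ?_))
  · refine setLIntegral_congr_fun measurableSet_Icc fun t ht => ?_
    simp [ht.2]
  · have := (measurePreserving_sub_right (volume : Measure ℝ) L).setLIntegral_comp_preimage_emb
      (measurableEmbedding_subRight L) (fun t => ENNReal.ofReal (ρ (γ' t))) (Icc 0 L')
    have hp : (fun t => t - L) ⁻¹' Icc 0 L' = Icc L (L + L') := by
      ext t; simp [add_comm]
    rw [hp] at this
    rw [← this]
    refine setLIntegral_congr_fun measurableSet_Icc fun t ht => ?_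
    rcases eq_or_lt_of_le ht.1 with rfl | hlt
    · simp [hglue]
    · simp [not_le.2 hlt]

section EMetric

variable [PseudoEMetricSpace E] {Ω : Set E} {ρ : E → ℝ}

theorem rhoEDist_le {γ : ℝ → E} {L : ℝ} {x y : E} (h : IsCurveIn Ω γ L x y) :
    rhoEDist Ω ρ x y ≤ rhoLength ρ γ L :=
  (iInf₂_le γ L).trans (iInf_le _ h)

theorem rhoEDist_self {x : E} (hx : x ∈ Ω) : rhoEDist Ω ρ x x = 0 := by
  refine le_antisymm ?_ (zero_le)
  refine (iInf₂_le (fun _ => x) 0).trans ((iInf_le _ ?_).trans ?_)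
  · refine ⟨le_rfl, ?_, fun _ _ => hx, rfl, rfl⟩
    exact hasConstantSpeedOnWith_of_subsingleton _ (by simp) _
  · simp [rhoLength]

theorem IsCurveIn.reverse {γ : ℝ → E} {L : ℝ} {x y : E} (h : IsCurveIn Ω γ L x y) :
    IsCurveIn Ω (fun t => γ (L - t)) L y x := by
  refine ⟨h.nonneg, ?_, fun t ht => h.mem _ ⟨by linarith [ht.2], by linarith [ht.1]⟩,
    by simpa using h.finish, by simpa using h.start⟩
  intro a ha b hb
  have key := eVariationOn.comp_eq_of_antitoneOn γ (t := Icc 0 L ∩ Icc a b) (fun t => L - t)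
    (fun u _ v _ huv => sub_le_sub_left huv L)
  have him : (fun t => L - t) '' (Icc 0 L ∩ Icc a b) = Icc 0 L ∩ Icc (L - b) (L - a) := by
    ext z
    simp only [mem_image, mem_inter_iff, mem_Icc]
    constructor
    · rintro ⟨t, ⟨⟨h1, h2⟩, h3, h4⟩, rfl⟩
      refine ⟨⟨?_, ?_⟩, ?_, ?_⟩ <;> linarith
    · rintro ⟨⟨h1, h2⟩, h3, h4⟩
      refine ⟨L - z, ⟨⟨?_, ?_⟩, ?_, ?_⟩, ?_⟩ <;> linarith
  rw [him] at key
  refine key.trans ((h.unitSpeed (show L - b ∈ Icc 0 L from ⟨by linarith [hb.2],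
    by linarith [hb.1]⟩) (show L - a ∈ Icc 0 L from
    ⟨by linarith [ha.2], by linarith [ha.1]⟩)).trans ?_)
  congr 2; ring

theorem rhoEDist_comm_le (x y : E) : rhoEDist Ω ρ x y ≤ rhoEDist Ω ρ y x := by
  refine le_iInf₂ fun γ L => le_iInf fun h => ?_
  rw [← rhoLength_reverse]
  exact (iInf₂_le _ L).trans (iInf_le _ h.reverse)

theorem IsCurveIn.append {γ γ' : ℝ → E} {L L' : ℝ} {x y z : E} (h : IsCurveIn Ω γ L x y)
    (h' : IsCurveIn Ω γ' L' y z) :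
    IsCurveIn Ω (fun t => if t ≤ L then γ t else γ' (t - L)) (L + L') x z := by
  have e1 : EqOn (fun t => if t ≤ L then γ t else γ' (t - L)) γ (Icc 0 L) := by
    intro t ht
    simp [ht.2]
  have e2 : EqOn (fun t => if t ≤ L then γ t else γ' (t - L)) (fun t => γ' (t - L))
      (Icc L (L + L')) := by
    intro t ht
    rcases eq_or_lt_of_le ht.1 with rfl | hlt
    · simp [h.finish, h'.start]
    · simp [not_le.2 hlt]
  have hL := h.nonneg
  have hL' := h'.nonneg
  refine ⟨by linarith, ?_, ?_, ?_, ?_⟩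
  · refine HasUnitSpeedOn.Icc_Icc (y := L) ?_ ?_
    · intro a ha b hb
      rw [eVariationOn.congr (e1.mono inter_subset_left)]
      exact h.unitSpeed ha hb
    · intro a ha b hb
      rw [eVariationOn.congr (e2.mono inter_subset_left)]
      have key := eVariationOn.comp_eq_of_monotoneOn γ' (t := Icc L (L + L') ∩ Icc a b)
        (fun t => t - L) (fun u _ v _ huv => by simpa using huv)
      have him : (fun t => t - L) '' (Icc L (L + L') ∩ Icc a b)
          = Icc 0 L' ∩ Icc (a - L) (b - L) := by
        ext z
        simp only [mem_image, mem_inter_iff, mem_Icc]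
        constructor
        · rintro ⟨t, ⟨⟨h1, h2⟩, h3, h4⟩, rfl⟩
          refine ⟨⟨?_, ?_⟩, ?_, ?_⟩ <;> linarith
        · rintro ⟨⟨h1, h2⟩, h3, h4⟩
          refine ⟨z + L, ⟨⟨?_, ?_⟩, ?_, ?_⟩, ?_⟩ <;> linarith
      rw [him] at key
      refine key.trans ((h'.unitSpeed (show a - L ∈ Icc 0 L' from ⟨by linarith [ha.1],
        by linarith [ha.2]⟩) (show b - L ∈ Icc 0 L' from
        ⟨by linarith [hb.1], by linarith [hb.2]⟩)).trans ?_)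
      congr 2; ring
  · intro t ht
    by_cases htL : t ≤ L
    · simpa [htL] using h.mem t ⟨ht.1, htL⟩
    · simpa [htL] using h'.mem (t - L) ⟨by linarith [not_le.1 htL], by linarith [ht.2]⟩
  · simp [hL, h.start]
  · exact (e2 (x := L + L') ⟨by linarith, le_rfl⟩).trans (by simpa using h'.finish)

theorem rhoEDist_triangle (x y z : E) :
    rhoEDist Ω ρ x z ≤ rhoEDist Ω ρ x y + rhoEDist Ω ρ y z := by
  conv_rhs => simp only [rhoEDist, ENNReal.iInf_add, ENNReal.add_iInf]
  refine le_iInf fun γ' => le_iInf fun L' => le_iInf fun h' =>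
    le_iInf fun γ => le_iInf fun L => le_iInf fun h => ?_
  refine (rhoEDist_le (h.append h')).trans ?_
  exact rhoLength_append_le h.nonneg h'.nonneg (h.finish.trans h'.start.symm)

end EMetric

section Finite

variable [NormedAddCommGroup E] [NormedSpace ℝ E] {Ω : Set E} {ρ : E → ℝ}

theorem isCurveIn_segment {x y : E} (h : segment ℝ x y ⊆ Ω) (hxy : x ≠ y) :
    IsCurveIn Ω (fun t : ℝ => x + (t / ‖y - x‖) • (y - x)) ‖y - x‖ x y := by
  have hn : 0 < ‖y - x‖ := norm_pos_iff.2 (sub_ne_zero.2 hxy.symm)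
  have hiso : ∀ a b : ℝ, edist (x + (a / ‖y - x‖) • (y - x)) (x + (b / ‖y - x‖) • (y - x))
      = edist a b := by
    intro a b
    rw [edist_dist, edist_dist, dist_add_left, dist_eq_norm, ← sub_smul, norm_smul, ← sub_div,
      norm_div, norm_norm, div_mul_cancel₀ _ hn.ne', dist_eq_norm]
  refine ⟨hn.le, ?_, ?_, by simp, by simp [div_self hn.ne']⟩
  · refine hasConstantSpeedOnWith_iff_ordered.2 fun a ha b hb hab => le_antisymm ?_ ?_
    · have h1 : eVariationOn (fun t : ℝ => x + (t / ‖y - x‖) • (y - x)) (Icc 0 ‖y - x‖ ∩ Icc a b)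
          = eVariationOn (fun t : ℝ => t) (Icc 0 ‖y - x‖ ∩ Icc a b) := by
        simp only [eVariationOn, hiso]
      rw [h1]
      simpa using (MonotoneOn.eVariationOn_eq (f := fun t : ℝ => t)
        (monotone_id.monotoneOn _) ha hb).le
    · have := eVariationOn.edist_le (fun t : ℝ => x + (t / ‖y - x‖) • (y - x))
        (s := Icc 0 ‖y - x‖ ∩ Icc a b) ⟨hb, hab, le_rfl⟩ ⟨ha, le_rfl, hab⟩
      rw [hiso, edist_dist, Real.dist_eq, abs_of_nonneg (sub_nonneg.2 hab)] at this
      simpa using this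
  · intro t ht
    apply h
    rw [segment_eq_image']
    exact ⟨t / ‖y - x‖, ⟨by have := ht.1; positivity, (div_le_one hn).2 ht.2⟩, rfl⟩

/-- On a domain with a continuous weight all `ρ`-distances are finite. -/
theorem rhoEDist_ne_top (hΩ : IsOpen Ω) (hc : IsPreconnected Ω) (hρ : ContinuousOn ρ Ω)
    {x y : E} (hx : x ∈ Ω) (hy : y ∈ Ω) : rhoEDist Ω ρ x y ≠ ⊤ := by
  refine hc.induction₂ (fun a b => rhoEDist Ω ρ a b ≠ ⊤) ?_ ?_ ?_ hx hy
  · intro a ha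
    obtain ⟨r, hr, hball⟩ := Metric.isOpen_iff.1 hΩ a ha
    refine mem_nhdsWithin_of_mem_nhds (mem_of_superset (Metric.ball_mem_nhds a hr) fun b hb => ?_)
    show rhoEDist Ω ρ a b ≠ ⊤
    by_cases hab : a = b
    · subst hab; simp [rhoEDist_self ha]
    have hseg : segment ℝ a b ⊆ Ω :=
      ((convex_ball a r).segment_subset (Metric.mem_ball_self hr) hb).trans hball
    have hcurve := isCurveIn_segment hseg hab
    refine ne_top_of_le_ne_top ?_ ((iInf₂_le _ _).trans (iInf_le _ hcurve))
    have hcont : ContinuousOn (fun t : ℝ => ρ (a + (t / ‖b - a‖) • (b - a))) (Icc 0 ‖b - a‖) :=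
      hρ.comp (by fun_prop) hcurve.mem
    obtain ⟨C, hC⟩ := isCompact_Icc.exists_bound_of_continuousOn hcont
    refine ne_top_of_le_ne_top ?_ (setLIntegral_mono' (g := fun _ => ENNReal.ofReal C)
      measurableSet_Icc fun t ht => ENNReal.ofReal_le_ofReal ((le_abs_self _).trans (hC t ht)))
    simp [ENNReal.mul_eq_top]
  · intro a b c _ _ _ hab hbc
    exact ne_top_of_le_ne_top (ENNReal.add_ne_top.2 ⟨hab, hbc⟩) (rhoEDist_triangle a b c)
  · intro a b _ _ hab
    exact ne_top_of_le_ne_top hab (rhoEDist_comm_le b a)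

end Finite

end Curves

/-! ### The completions of `(Ω, d_ρ)` and of `(Ω, d)`, and their boundaries -/

section Boundary

variable {E : Type*}

/-- The set `Ω`, to be equipped with the metric `d_ρ`. -/
def RhoSpace (Ω : Set E) (_ρ : E → ℝ) : Type _ := Ω

/-- The `ρ`-distance on `Ω`, with values in `[0, ∞]`. -/
@[reducible] def rhoPseudoEMetric [PseudoEMetricSpace E] (Ω : Set E) (ρ : E → ℝ) :
    PseudoEMetricSpace (RhoSpace Ω ρ) where
  edist x y := rhoEDist Ω ρ x.1 y.1
  edist_self x := rhoEDist_self x.2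
  edist_comm x y := le_antisymm (rhoEDist_comm_le x.1 y.1) (rhoEDist_comm_le y.1 x.1)
  edist_triangle x y z := rhoEDist_triangle x.1 y.1 z.1

open scoped Classical in
/-- The metric `d_ρ` on `Ω`. All `ρ`-distances are finite when `Ω` is a domain and `ρ` is
continuous (`rhoEDist_ne_top`); the `else` branch, the zero distance, is never taken then. -/
instance RhoSpace.instPseudoMetricSpace [PseudoEMetricSpace E] (Ω : Set E) (ρ : E → ℝ) :
    PseudoMetricSpace (RhoSpace Ω ρ) :=
  if h : ∀ x ∈ Ω, ∀ y ∈ Ω, rhoEDist Ω ρ x y ≠ ⊤ then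
    @PseudoEMetricSpace.toPseudoMetricSpace _ (rhoPseudoEMetric Ω ρ)
      (fun x y => h x.1 x.2 y.1 y.2)
  else
    { dist := fun _ _ => 0
      dist_self := fun _ => rfl
      dist_comm := fun _ _ => rfl
      dist_triangle := fun _ _ _ => by simp }

/-- The distance of `RhoSpace Ω ρ` is the `ρ`-distance, for a continuous `ρ` on a domain `Ω`. -/
theorem RhoSpace.dist_eq [NormedAddCommGroup E] [NormedSpace ℝ E] {Ω : Set E} {ρ : E → ℝ}
    (hΩ : IsOpen Ω) (hc : IsPreconnected Ω) (hρ : ContinuousOn ρ Ω) (x y : RhoSpace Ω ρ) :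
    dist x y = (rhoEDist Ω ρ x.1 y.1).toReal := by
  have h : ∀ x ∈ Ω, ∀ y ∈ Ω, rhoEDist Ω ρ x y ≠ ⊤ :=
    fun x hx y hy => rhoEDist_ne_top hΩ hc hρ hx hy
  have hinst : RhoSpace.instPseudoMetricSpace Ω ρ = @PseudoEMetricSpace.toPseudoMetricSpace _
      (rhoPseudoEMetric Ω ρ) (fun x y => h x.1 x.2 y.1 y.2) := dif_pos h
  rw [hinst]
  rfl

variable [PseudoEMetricSpace E]

/-- The metric completion of `(Ω, d_ρ)`. -/
abbrev RhoClosure (Ω : Set E) (ρ : E → ℝ) : Type _ := UniformSpace.Completion (RhoSpace Ω ρ)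

/-- The canonical map from `Ω` to the completion of `(Ω, d_ρ)`. -/
def toRhoClosure (Ω : Set E) (ρ : E → ℝ) (x : Ω) : RhoClosure Ω ρ :=
  ((show RhoSpace Ω ρ from x : RhoSpace Ω ρ) : UniformSpace.Completion (RhoSpace Ω ρ))

/-- The `ρ`-boundary `∂_ρ Ω`: the completion of `(Ω, d_ρ)` minus `Ω`. -/
def rhoBoundary (Ω : Set E) (ρ : E → ℝ) : Set (RhoClosure Ω ρ) := (range (toRhoClosure Ω ρ))ᶜ

/-- The completion of `Ω` in the internal metric `d`, that is in `d_ρ` for `ρ = 1`. -/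
abbrev InternalClosure (Ω : Set E) : Type _ := RhoClosure Ω (fun _ => 1)

/-- The internal boundary `∂Ω`: the completion of `(Ω, d)` minus `Ω`. -/
def internalBoundary (Ω : Set E) : Set (InternalClosure Ω) := rhoBoundary Ω (fun _ => 1)

/-- A density on `Ω`: a continuous function `ρ > 0` on `Ω` such that a sequence of `Ω` that
converges in the `ρ`-completion converges in the internal completion, a sequence of `Ω` that
converges in the internal completion has at most one accumulation point in `∂_ρ Ω`, and
`∂_ρ Ω` is not empty. -/
structure IsDensity (Ω : Set E) (ρ : E → ℝ) : Prop where
  continuousOn : ContinuousOn ρ Ω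
  pos : ∀ x ∈ Ω, 0 < ρ x
  converges : ∀ x : ℕ → Ω, (∃ p, Tendsto (fun n => toRhoClosure Ω ρ (x n)) atTop (𝓝 p)) →
    ∃ q, Tendsto (fun n => toRhoClosure Ω (fun _ => 1) (x n)) atTop (𝓝 q)
  unique : ∀ x : ℕ → Ω,
    (∃ q, Tendsto (fun n => toRhoClosure Ω (fun _ => 1) (x n)) atTop (𝓝 q)) →
    ∀ p ∈ rhoBoundary Ω ρ, ∀ p' ∈ rhoBoundary Ω ρ,
      MapClusterPt p atTop (fun n => toRhoClosure Ω ρ (x n)) →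
      MapClusterPt p' atTop (fun n => toRhoClosure Ω ρ (x n)) → p = p'
  nonempty : (rhoBoundary Ω ρ).Nonempty

/-- The natural identification of points of the two completions: `q = f p` for the continuous
extension `f` of the identity map `(Ω, d_ρ) → (Ω, d)`. -/
def IsSamePoint (Ω : Set E) (ρ : E → ℝ) (p : RhoClosure Ω ρ) (q : InternalClosure Ω) : Prop :=
  ∃ x : ℕ → Ω, Tendsto (fun n => toRhoClosure Ω ρ (x n)) atTop (𝓝 p) ∧
    Tendsto (fun n => toRhoClosure Ω (fun _ => 1) (x n)) atTop (𝓝 q)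

/-- A subset `A` of the `ρ`-completion, seen as a subset of the internal completion. -/
def internalImage {Ω : Set E} {ρ : E → ℝ} (A : Set (RhoClosure Ω ρ)) :
    Set (InternalClosure Ω) :=
  {q | ∃ p ∈ A, IsSamePoint Ω ρ p q}

end Boundary

section Exponents

variable {E : Type*} [PseudoMetricSpace E]

/-- The exponent `i⁻(q)`: the lower limit of `log ρ(y) / log d(y)` as `y ∈ Ω` tends to `q` in
the internal metric. -/
def lowerExponent (Ω : Set E) (ρ : E → ℝ) (q : InternalClosure Ω) : EReal :=
  liminf (fun y : Ω => ((Real.log (ρ y) / Real.log (bdryDist Ω (y : E)) : ℝ) : EReal))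
    (comap (toRhoClosure Ω (fun _ => 1)) (𝓝 q))

/-- The exponent `i⁺(q)`: the upper limit of `log ρ(y) / log d(y)` as `y ∈ Ω` tends to `q` in
the internal metric. -/
def upperExponent (Ω : Set E) (ρ : E → ℝ) (q : InternalClosure Ω) : EReal :=
  limsup (fun y : Ω => ((Real.log (ρ y) / Real.log (bdryDist Ω (y : E)) : ℝ) : EReal))
    (comap (toRhoClosure Ω (fun _ => 1)) (𝓝 q))

/-- `Ω` is an `α`-John domain: some `x₀ ∈ Ω` can be joined to every `x ∈ Ω` by an `α`-cone, a
curve `γ` in `Ω` from `x` to `x₀` with `d(γ(t)) ≥ α t` for all `t`. -/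
def IsAlphaJohn (Ω : Set E) (α : ℝ) : Prop :=
  ∃ x₀ ∈ Ω, ∀ x ∈ Ω, ∃ (γ : ℝ → E) (L : ℝ), IsCurveIn Ω γ L x x₀ ∧
    ∀ t ∈ Icc 0 L, α * t ≤ bdryDist Ω (γ t)

/-- `Ω` satisfies the John condition for some constant. -/
def IsJohn (Ω : Set E) : Prop := ∃ α : ℝ, 0 < α ∧ α ≤ 1 ∧ IsAlphaJohn Ω α

end Exponents

/-! ### Packing dimension

The Hausdorff dimension is Mathlib's `dimH`. -/

section Packing

variable {X : Type*} [MetricSpace X]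

/-- `P` is a packing of `A` with radii at most `ε`: a collection of pairwise disjoint balls of
`X`, given by (centre, radius), with centres in `A`. -/
def IsPackingOf (A : Set X) (ε : ℝ) (P : Set (X × ℝ)) : Prop :=
  (∀ b ∈ P, b.1 ∈ A ∧ 0 < b.2 ∧ b.2 ≤ ε) ∧ P.PairwiseDisjoint fun b => Metric.ball b.1 b.2

/-- The packing premeasure `P^s(A) = lim_{ε ↓ 0} P^{s,ε}(A)`; the limit is an infimum because
`P^{s,ε}(A)` decreases with `ε`. -/
def packingPremeasure (s : ℝ≥0) (A : Set X) : ℝ≥0∞ :=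
  ⨅ (ε : ℝ) (_ : 0 < ε), ⨆ (P : Set (X × ℝ)) (_ : IsPackingOf A ε P),
    ∑' b : P, ENNReal.ofReal b.1.2 ^ (s : ℝ)

/-- The `s`-dimensional packing measure. -/
def packingMeasure (s : ℝ≥0) (A : Set X) : ℝ≥0∞ :=
  ⨅ (C : ℕ → Set X) (_ : A ⊆ ⋃ i, C i), ∑' i, packingPremeasure s (C i)

/-- The packing dimension. -/
def packingDim (A : Set X) : ℝ≥0∞ :=
  ⨆ (s : ℝ≥0) (_ : packingMeasure s A = ∞), (s : ℝ≥0∞)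

end Packing

/-! ### The two upper bounds -/

section UpperBounds

variable {E : Type*} [PseudoMetricSpace E]

/-- The Hausdorff dimension upper bound with exponent `β`: `(1 + β) dim_ρ B ≤ dim_d B` for all
`B ⊆ {x ∈ ∂_ρ Ω : i⁻(x) ≥ β}`. -/
def HausdorffUpperBound (Ω : Set E) (ρ : E → ℝ) (β : ℝ) : Prop :=
  ∀ B ⊆ {p ∈ rhoBoundary Ω ρ | ∃ q, IsSamePoint Ω ρ p q ∧ (β : EReal) ≤ lowerExponent Ω ρ q},
    ENNReal.ofReal (1 + β) * dimH B ≤ dimH (internalImage B)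

/-- The packing dimension upper bound with exponent `β`: `(1 + β) Dim_ρ B ≤ Dim_d B` for all
`B ⊆ {x ∈ ∂_ρ Ω : i⁻(x) ≥ β}`. -/
def PackingUpperBound (Ω : Set E) (ρ : E → ℝ) (β : ℝ) : Prop :=
  ∀ B ⊆ {p ∈ rhoBoundary Ω ρ | ∃ q, IsSamePoint Ω ρ p q ∧ (β : EReal) ≤ lowerExponent Ω ρ q},
    ENNReal.ofReal (1 + β) * packingDim B ≤ packingDim (internalImage B)

end UpperBounds

/-! ### The snowflake domain

The plane is `ℂ`. -/

section Snowflake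

/-- The lengths `l_k` of the segments of step `k`. They are determined by `l_0 = 1`,
`l_1 = (1 - α₁) / 2` and the two relations `kochLength_succ`, `kochRatio_succ_succ` below. -/
def kochLength (s α₁ : ℝ) : ℕ → ℝ
  | 0 => 1
  | 1 => (1 - α₁) / 2
  | k + 2 => kochLength s α₁ (k + 1) / (2 + kochLength s α₁ (k + 1) ^ (1 - 2 * s))

/-- The ratios `α_k` (`k ≥ 1`; the value at `0` is not used). -/
def kochRatio (s α₁ : ℝ) : ℕ → ℝ
  | 0 => 0
  | 1 => α₁
  | k + 2 => kochLength s α₁ (k + 1) ^ (1 - 2 * s) / (2 + kochLength s α₁ (k + 1) ^ (1 - 2 * s))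

theorem kochLength_pos (s : ℝ) {α₁ : ℝ} (h : α₁ < 1) : ∀ k, 0 < kochLength s α₁ k
  | 0 => one_pos
  | 1 => by simp only [kochLength]; linarith
  | k + 2 => by
    have := kochLength_pos s h (k + 1)
    simp only [kochLength]
    positivity

theorem kochLength_succ (s : ℝ) {α₁ : ℝ} (h : α₁ < 1) : ∀ k,
    kochLength s α₁ (k + 1) = kochLength s α₁ k * (1 - kochRatio s α₁ (k + 1)) / 2
  | 0 => by simp [kochLength, kochRatio]
  | k + 1 => by
    have h1 := kochLength_pos s h (k + 1)
    have h2 : 0 < 2 + kochLength s α₁ (k + 1) ^ (1 - 2 * s) := by positivity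
    simp only [kochLength, kochRatio]
    field_simp
    ring

theorem kochRatio_succ_succ (s : ℝ) {α₁ : ℝ} (h : α₁ < 1) (k : ℕ) :
    kochRatio s α₁ (k + 2)
      = kochLength s α₁ (k + 1) ^ (1 - 2 * s) * (1 - kochRatio s α₁ (k + 2)) / 2 := by
  have h1 := kochLength_pos s h (k + 1)
  have h2 : 0 < 2 + kochLength s α₁ (k + 1) ^ (1 - 2 * s) := by positivity
  simp only [kochRatio]
  field_simp
  ring

/-- Left end of the middle `α`-th portion of the segment from `σ.1` to `σ.2`. -/
def baseLeft (α : ℝ) (σ : ℂ × ℂ) : ℂ := σ.1 + ((1 - α) / 2 : ℝ) * (σ.2 - σ.1)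

/-- Right end of the middle `α`-th portion of the segment from `σ.1` to `σ.2`. -/
def baseRight (α : ℝ) (σ : ℂ × ℂ) : ℂ := σ.1 + ((1 + α) / 2 : ℝ) * (σ.2 - σ.1)

/-- The point to the right of the oriented segment from `σ.1` to `σ.2`, at distance
`(1 - α) / 2` times the length of the segment from both ends of its middle `α`-th portion. -/
def spikeTip (α : ℝ) (σ : ℂ × ℂ) : ℂ :=
  σ.1 + (1 / 2 - (√(1 - 2 * α) / 2 : ℝ) * Complex.I) * (σ.2 - σ.1)

/-- The four segments that replace the segment `σ`, in their order along the curve. -/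
def kochChild (α : ℝ) (σ : ℂ × ℂ) : Fin 4 → ℂ × ℂ :=
  ![(σ.1, baseLeft α σ), (baseLeft α σ, spikeTip α σ), (spikeTip α σ, baseRight α σ),
    (baseRight α σ, σ.2)]

/-- The open triangle that is added to the domain along the segment `σ`, together with the
relative interior of its base, through which it is connected to the previous domain. -/
def spike (α : ℝ) (σ : ℂ × ℂ) : Set ℂ :=
  interior (convexHull ℝ {baseLeft α σ, spikeTip α σ, baseRight α σ}) ∪
    openSegment ℝ (baseLeft α σ) (baseRight α σ)

/-- The third vertex of the equilateral triangle with vertices `0`, `1` and `apex`. -/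
def apex : ℂ := 1 / 2 + (√3 / 2 : ℝ) * Complex.I

/-- The sides of the triangle with vertices `0`, `1`, `apex`, in counterclockwise order, so that
the outside is on the right of each of them. -/
def triangleSide : Fin 3 → ℂ × ℂ := ![(0, 1), (1, apex), (apex, 0)]

/-- The segment of step `k` over the side `j` whose address is `a 0, …, a (k - 1)`. The digits
`0, 1, 2, 3` number the four new segments in the order of `kochChild`. -/
def kochSegment (s α₁ : ℝ) (j : Fin 3) (a : ℕ → Fin 4) : ℕ → ℂ × ℂ
  | 0 => triangleSide j
  | k + 1 => kochChild (kochRatio s α₁ (k + 1)) (kochSegment s α₁ j a k) (a k)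

/-- The domain `Ω_k` bounded by the segments of step `k`. -/
def kochStep (s α₁ : ℝ) : ℕ → Set ℂ
  | 0 => interior (convexHull ℝ {0, 1, apex})
  | k + 1 => kochStep s α₁ k ∪
      ⋃ (j : Fin 3) (a : ℕ → Fin 4), spike (kochRatio s α₁ (k + 1)) (kochSegment s α₁ j a k)

/-- The snowflake domain `Ω = ⋃ k, Ω_k`. -/
def snowflake (s α₁ : ℝ) : Set ℂ := ⋃ k, kochStep s α₁ k

/-- The density `ρ(z) = d(z)^(-1/2)` on the snowflake domain. -/
def snowflakeDensity (s α₁ : ℝ) (z : ℂ) : ℝ := bdryDist (snowflake s α₁) z ^ (-1 / 2 : ℝ)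

/-- The point `p` of the `ρ`-completion of the snowflake domain has the address `a` over the
side `j`: it is the limit, in `d_ρ`, of the midpoints of the nested segments with addresses
`a 0, …, a (k - 1)`. (These midpoints lie in the domain: they are in the bases of the spikes.) -/
def HasAddress (s α₁ : ℝ) (j : Fin 3) (a : ℕ → Fin 4)
    (p : RhoClosure (snowflake s α₁) (snowflakeDensity s α₁)) : Prop :=
  ∃ x : ℕ → snowflake s α₁,
    (∀ k, (x k : ℂ) = midpoint ℝ (kochSegment s α₁ j a k).1 (kochSegment s α₁ j a k).2) ∧
    Tendsto (fun k => toRhoClosure (snowflake s α₁) (snowflakeDensity s α₁) (x k)) atTop (𝓝 p)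

/-- The set `A` of the points over one side of the triangle that have an address with all
digits `1` or `2`, that is, always one of the two sides of the new spike. -/
def snowflakeCantor (s α₁ : ℝ) : Set (RhoClosure (snowflake s α₁) (snowflakeDensity s α₁)) :=
  {p | ∃ a : ℕ → Fin 4, (∀ k, a k = 1 ∨ a k = 2) ∧ HasAddress s α₁ 0 a p}

end Snowflake

end

/-! The spike over a segment of length `l = l_k` has sides of length about `l / 2`, but its base has
length `α_{k+1} l_k ≈ l ^ (2 - 2s)`, which is much smaller. A curve that leaves the part of the
domain behind such a base runs a distance of order `l` through points at distance at most `l ^ (2 -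
2s)` from the boundary. There `ρ = d ^ (-1/2)` is at least `l ^ (s - 1)`, so leaving costs at least
a multiple of `l ^ s`. Since `∑ α_k` converges, `l_k ≈ 2 ^ (-k)`. Two points of `A` whose addresses
first differ at digit `k` are therefore at internal distance about `2 ^ (-k)` and at `ρ`-distance
about `2 ^ (-sk)`, and a Cantor set with two branches at each step has dimension `1` in the first
metric and `1 / s` in the second. For `ρ = d ^ (-1/2)` the exponents are `-1/2` at every boundary
point, so either upper bound would give `1 / (2s) ≤ 1`, against `s < 1/2`.

Upper estimates of distances use that the domain is made of convex rooms, the initial triangle and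
the open spikes. In a room of size `l` and inner radius `w` the `ρ`-distance of points at Euclidean
distance `r` is at most `6 √(r l / w)` (`rhoEDist_le_of_convex`); with `w ≈ l ^ (2 - 2s)` this is at
most a constant times `r ^ s`. `IsRoomGauge` treats both metrics at once, with exponent `e = 1` or
`e = s`. Summing a geometric series along the tree gives `IsRoomGauge.exists_segMid_le`, and
following a path through the gates between rooms gives `IsRoomGauge.exists_joinedWithin_bound`, the
Hölder continuity of the identity from `d` to `d_ρ`. As `ρ` is bounded below, the identity is
Lipschitz in the other direction. Hence the completions are identified and `ρ` is a density.

Lower estimates rest on planar separation. The right isosceles triangles (tents) over the four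
children of a segment are nested in the tent of the segment and disjoint, so the domain inside a
tent is exactly one branch (`IsKochSegment.branch_of_mem_closedTent`), and a piece can be left only
through its base (`exists_crossing`). `exists_height_bound` and `KochBranch.le_density` then give
`exists_address_separation`. The narrow gates also exclude the John condition.

For the whole internal boundary, the `4 ^ n` disjoint tents of size about `2 ^ (-n)` leave a limit
set of positive area, which is covered by images of boundary points under a `1`-Lipschitz map. This
gives dimension at least `2`; a count of about `(n + 1) 4 ^ n` sets of diameter about `2 ^ (-n)`
gives packing dimension at most `2`. -/

noncomputable section

/-! ### Box counting, packing dimension and Hausdorff dimension -/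

section Dimensions

/-- `A` can be covered by at most `N` sets of diameter at most `δ`. -/
def Coverable {X : Type*} [PseudoMetricSpace X] (A : Set X) (N δ : ℝ) : Prop :=
  ∃ 𝓒 : Finset (Set X), (𝓒.card : ℝ) ≤ N ∧ A ⊆ ⋃₀ (𝓒 : Set (Set X)) ∧
    ∀ S ∈ 𝓒, ∀ x ∈ S, ∀ y ∈ S, dist x y ≤ δ

theorem Coverable.mono {X : Type*} [PseudoMetricSpace X] {A B : Set X} {N N' δ δ' : ℝ}
    (h : Coverable A N δ) (hB : B ⊆ A) (hN : N ≤ N') (hδ : δ ≤ δ') : Coverable B N' δ' := by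
  obtain ⟨𝓒, h1, h2, h3⟩ := h
  exact ⟨𝓒, h1.trans hN, hB.trans h2, fun S hS x hx y hy => (h3 S hS x hx y hy).trans hδ⟩

theorem Coverable.union {X : Type*} [PseudoMetricSpace X] {A B : Set X} {N N' δ : ℝ}
    (h : Coverable A N δ) (h' : Coverable B N' δ) : Coverable (A ∪ B) (N + N') δ := by
  classical
  obtain ⟨𝓒, h1, h2, h3⟩ := h
  obtain ⟨𝓒', h1', h2', h3'⟩ := h'
  refine ⟨𝓒 ∪ 𝓒', ?_, ?_, ?_⟩
  · have : ((𝓒 ∪ 𝓒').card : ℝ) ≤ 𝓒.card + 𝓒'.card := by exact_mod_cast Finset.card_union_le _ _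
    linarith
  · rw [Finset.coe_union, sUnion_union]
    exact union_subset_union h2 h2'
  · intro S hS
    rcases Finset.mem_union.1 hS with hS | hS
    exacts [h3 S hS, h3' S hS]

theorem Coverable.iUnion {X ι : Type*} [PseudoMetricSpace X] [Fintype ι] {A : ι → Set X}
    {N δ : ℝ} (h : ∀ i, Coverable (A i) N δ) :
    Coverable (⋃ i, A i) (Fintype.card ι * N) δ := by
  classical
  choose 𝓒 h1 h2 h3 using h
  refine ⟨Finset.univ.biUnion 𝓒, ?_, ?_, ?_⟩
  · have : ((Finset.univ.biUnion 𝓒).card : ℝ) ≤ ∑ i, ((𝓒 i).card : ℝ) := by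
      exact_mod_cast Finset.card_biUnion_le
    refine this.trans ((Finset.sum_le_sum fun i _ => h1 i).trans ?_)
    simp
  · refine iUnion_subset fun i x hx => ?_
    obtain ⟨S, hS, hxS⟩ := h2 i hx
    exact ⟨S, by simpa using ⟨i, hS⟩, hxS⟩
  · intro S hS
    obtain ⟨i, -, hi⟩ := Finset.mem_biUnion.1 hS
    exact h3 i S hi

/-- Closures of the images still cover, because a finite union commutes with closure, and closing a
set does not increase its diameter. This carries a count made in the domain over to its completion.
-/
theorem Coverable.of_denseRange {X Y : Type*} [PseudoMetricSpace X] [PseudoMetricSpace Y]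
    {f : X → Y} (hf : Isometry f) (hd : DenseRange f) {N δ : ℝ}
    (h : Coverable (univ : Set X) N δ) : Coverable (univ : Set Y) N δ := by
  classical
  obtain ⟨𝓒, h1, h2, h3⟩ := h
  refine ⟨𝓒.image fun S => closure (f '' S), ?_, ?_, ?_⟩
  · exact (Nat.cast_le.2 Finset.card_image_le).trans h1
  · have hcl : closure (⋃ S ∈ 𝓒, f '' S) = ⋃ S ∈ 𝓒, closure (f '' S) :=
      Finset.closure_biUnion _ _
    have hr : range f ⊆ ⋃ S ∈ 𝓒, f '' S := by
      rintro _ ⟨x, rfl⟩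
      obtain ⟨S, hS, hxS⟩ := h2 (mem_univ x)
      exact mem_biUnion hS (mem_image_of_mem f hxS)
    have := (hd.mono hr).closure_eq
    rw [hcl] at this
    intro y _
    have hy : y ∈ ⋃ S ∈ 𝓒, closure (f '' S) := this ▸ mem_univ y
    simp only [mem_iUnion] at hy
    obtain ⟨S, hS, hyS⟩ := hy
    exact ⟨_, by simpa using ⟨S, hS, rfl⟩, hyS⟩
  · intro T hT
    obtain ⟨S, hS, rfl⟩ := Finset.mem_image.1 hT
    intro x hx y hy
    have hclosed : IsClosed {p : Y × Y | dist p.1 p.2 ≤ δ} :=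
      isClosed_le (by fun_prop) continuous_const
    have hsub : (f '' S) ×ˢ (f '' S) ⊆ {p : Y × Y | dist p.1 p.2 ≤ δ} := by
      rintro ⟨_, _⟩ ⟨⟨u, hu, rfl⟩, ⟨v, hv, rfl⟩⟩
      show dist (f u) (f v) ≤ δ
      rw [hf.dist_eq]
      exact h3 S hS u hu v hv
    have := closure_minimal hsub hclosed
    rw [closure_prod_eq] at this
    exact this (mk_mem_prod hx hy)

variable {X : Type*} [MetricSpace X]

theorem packingPremeasure_empty (t : ℝ≥0) : packingPremeasure t (∅ : Set X) = 0 := by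
  refine le_antisymm ((iInf₂_le 1 one_pos).trans (iSup₂_le fun P hP => ?_)) zero_le
  have : P = ∅ := eq_empty_of_forall_notMem fun b hb => (hP.1 b hb).1
  subst this
  simp

theorem packingMeasure_le_premeasure (t : ℝ≥0) (A : Set X) :
    packingMeasure t A ≤ packingPremeasure t A := by
  refine (iInf₂_le (fun i : ℕ => if i = 0 then A else ∅) ?_).trans ?_
  · exact fun x hx => mem_iUnion.2 ⟨0, by simpa using hx⟩
  · rw [tsum_eq_single 0]
    · simp
    · intro i hi
      simp [hi, packingPremeasure_empty]

/-- Sort the balls of a packing by scale. Two balls of scale `n` with centres in the same covering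
set would meet, so there are at most `C (n + 1) K ^ n` of them. For `t > D` the sum is then
dominated by `∑ (n + 1) q ^ n` with `q = K θ ^ t < 1`; the factor `n + 1` does no harm. -/
theorem packingDim_le_of_coverable {A : Set X} {C K θ D : ℝ} (hC : 0 < C) (hK : 0 ≤ K)
    (hθ : 0 < θ) (hθ' : θ < 1) (hD : K * θ ^ D ≤ 1)
    (hcov : ∀ n : ℕ, Coverable A (C * (n + 1) * K ^ n) (C * θ ^ n)) :
    packingDim A ≤ ENNReal.ofReal D := by
  refine iSup₂_le fun t ht => ?_
  by_contra hlt
  have hDt : D < t := by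
    rw [not_le] at hlt
    by_contra h
    exact absurd hlt (not_lt.2 (by
      rw [← ENNReal.ofReal_coe_nnreal]; exact ENNReal.ofReal_le_ofReal (not_lt.1 h)))
  have hq : K * θ ^ (t : ℝ) < 1 := by
    rcases hK.eq_or_lt with rfl | hK
    · simp
    · exact (mul_lt_mul_of_pos_left (Real.rpow_lt_rpow_of_exponent_gt hθ hθ' hDt) hK).trans_le hD
  set q := K * θ ^ (t : ℝ) with hqdef
  have hq0 : 0 ≤ q := by positivity
  choose 𝓒 h1 h2 h3 using hcov
  have hsum : Summable fun n : ℕ => C * (n + 1) * K ^ n * (C * θ ^ n / θ) ^ (t : ℝ) := by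
    have e : (fun n : ℕ => C * (n + 1) * K ^ n * (C * θ ^ n / θ) ^ (t : ℝ)) =
        fun n : ℕ => (C * (C / θ) ^ (t : ℝ)) * ((n : ℝ) * q ^ n + q ^ n) := by
      funext n
      have : (C * θ ^ n / θ) ^ (t : ℝ) = (C / θ) ^ (t : ℝ) * (θ ^ (t : ℝ)) ^ n := by
        rw [← Real.rpow_natCast (θ ^ (t : ℝ)), ← Real.rpow_mul hθ.le, mul_comm (t : ℝ),
          Real.rpow_mul hθ.le, Real.rpow_natCast, ← Real.mul_rpow (by positivity) (by positivity)]
        congr 1; ring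
      rw [this, hqdef, mul_pow]; ring
    rw [e]
    refine Summable.mul_left _ (Summable.add ?_ (summable_geometric_of_lt_one hq0 hq))
    simpa using summable_pow_mul_geometric_of_norm_lt_one 1
      (show ‖q‖ < 1 by rwa [Real.norm_of_nonneg hq0])
  have key : packingPremeasure t A ≤
      ∑' n : ℕ, ENNReal.ofReal (C * (n + 1) * K ^ n * (C * θ ^ n / θ) ^ (t : ℝ)) := by
    -- With radii at most `C`, the first `n` with `C θ ^ n < r` is not `0`, so minimality bounds `r`
    -- by `C θ ^ (n - 1)`.
    refine (iInf₂_le C hC).trans (iSup₂_le fun P hP => ?_)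
    have hex : ∀ b : P, ∃ n : ℕ, C * θ ^ n < b.1.2 := by
      intro b
      have hb := (hP.1 b.1 b.2).2.1
      obtain ⟨n, hn⟩ := exists_pow_lt_of_lt_one (div_pos hb hC) hθ'
      exact ⟨n, by rw [lt_div_iff₀ hC] at hn; linarith⟩
    classical
    let N : P → ℕ := fun b => Nat.find (hex b)
    have hN : ∀ b : P, C * θ ^ N b < b.1.2 := fun b => Nat.find_spec (hex b)
    have hN' : ∀ b : P, b.1.2 ≤ C * θ ^ N b / θ := by
      intro b
      have hpos : N b ≠ 0 := by
        intro h0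
        have := hN b
        rw [h0, pow_zero, mul_one] at this
        exact absurd (hP.1 b.1 b.2).2.2 (not_le.2 this)
      obtain ⟨m, hm⟩ := Nat.exists_eq_succ_of_ne_zero hpos
      have := not_lt.1 (Nat.find_min (hex b) (show m < Nat.find (hex b) by
        change m < N b; omega))
      rw [hm, Nat.succ_eq_add_one, pow_succ, ← mul_assoc, mul_div_cancel_right₀ _ hθ.ne']
      exact this
    have hS : ∀ b : P, ∃ S ∈ 𝓒 (N b), b.1.1 ∈ S := fun b => h2 (N b) (hP.1 b.1 b.2).1
    choose S hS hbS using hS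
    let i : P → Σ n : ℕ, {S // S ∈ 𝓒 n} := fun b => ⟨N b, S b, hS b⟩
    have hi : Function.Injective i := by
      intro b b' hbb
      by_contra hne
      have hbb' := Sigma.mk.inj_iff.1 hbb
      have hNN : N b = N b' := hbb'.1
      have hSS : S b = S b' := by
        have hs := hbb'.2
        generalize_proofs p1 p2 at hs
        revert hs
        generalize S b = T at p1 ⊢
        revert p1
        rw [hNN]
        intro p1 hs
        exact congrArg Subtype.val (eq_of_heq hs)
      -- Injectivity: centres in a common set of the covering are closer than the radius, so the
      -- balls are not disjoint.
      have hd : dist b.1.1 b'.1.1 ≤ C * θ ^ N b := by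
        refine h3 (N b) (S b) (hS b) _ (hbS b) _ ?_
        rw [hSS]; exact hbS b'
      have hdis := hP.2 b.2 b'.2 (fun h => hne (Subtype.ext h))
      have h1' : b'.1.1 ∈ Metric.ball b.1.1 b.1.2 := by
        rw [Metric.mem_ball, dist_comm]
        exact hd.trans_lt (hN b)
      exact (Set.disjoint_left.1 hdis) h1' (Metric.mem_ball_self (hP.1 _ b'.2).2.1)
    let g : (Σ n : ℕ, {S // S ∈ 𝓒 n}) → ℝ≥0∞ :=
      fun x => ENNReal.ofReal (C * θ ^ x.1 / θ) ^ (t : ℝ)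
    calc ∑' b : P, ENNReal.ofReal b.1.2 ^ (t : ℝ) ≤ ∑' b : P, g (i b) :=
          ENNReal.tsum_le_tsum fun b => ENNReal.rpow_le_rpow
            (ENNReal.ofReal_le_ofReal (hN' b)) t.2
      _ ≤ ∑' x, g x := ENNReal.tsum_comp_le_tsum_of_injective hi g
      _ = ∑' n : ℕ, ∑' T : {S // S ∈ 𝓒 n}, g ⟨n, T⟩ := ENNReal.tsum_sigma' _
      _ ≤ _ := by
        refine ENNReal.tsum_le_tsum fun n => ?_
        simp only [g]
        rw [tsum_fintype, Finset.sum_const, nsmul_eq_mul, Finset.card_univ, Fintype.card_coe,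
          ENNReal.ofReal_rpow_of_nonneg (by positivity) t.coe_nonneg,
          ← ENNReal.ofReal_natCast, ← ENNReal.ofReal_mul (by positivity)]
        refine ENNReal.ofReal_le_ofReal (mul_le_mul_of_nonneg_right (h1 n) (by positivity))
  have hfin : packingMeasure t A < ∞ :=
    ((packingMeasure_le_premeasure t A).trans key).trans_lt
      (lt_top_iff_ne_top.2 hsum.tsum_ofReal_ne_top)
  exact hfin.ne ht

/-- A maximal disjoint family of balls of radius `r` centred in `A` is a packing, and the doubled
balls cover `A`. So the Hausdorff sums are bounded by `4 ^ t` times the packing sums. -/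
theorem hausdorffMeasure_ne_top_of_packingPremeasure [MeasurableSpace X] [BorelSpace X] {t : ℝ≥0}
    {A : Set X} (h : packingPremeasure t A ≠ ∞) : μH[(t : ℝ)] A ≠ ∞ := by
  obtain ⟨ε, hε⟩ := iInf_lt_iff.1 (lt_top_iff_ne_top.2 h)
  obtain ⟨hε0, hM⟩ := iInf_lt_iff.1 hε
  set M := ⨆ (P : Set (X × ℝ)) (_ : IsPackingOf A ε P), ∑' b : P, ENNReal.ofReal b.1.2 ^ (t : ℝ)
    with hMdef
  let e : ℕ → ℝ := fun n => ε / (n + 1)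
  have he : ∀ n, 0 < e n := fun n => by positivity
  have heε : ∀ n, e n ≤ ε := fun n => div_le_self hε0.le (by simp)
  have hu : ∀ n, ∃ u ⊆ A, u.PairwiseDisjoint (fun x => Metric.ball x (e n)) ∧
      ∀ a ∈ A, ∃ b ∈ u, (Metric.ball a (e n) ∩ Metric.ball b (e n)).Nonempty := by
    intro n
    -- All sizes are set to `1`: only maximality is needed, that every ball meets a selected one.
    obtain ⟨u, h1, h2, h3⟩ := Vitali.exists_disjoint_subfamily_covering_enlargement
      (fun x : X => Metric.ball x (e n)) A (fun _ => 1) 2 one_lt_two (fun _ _ => zero_le_one) 1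
      (fun _ _ => le_rfl) (fun a _ => ⟨a, Metric.mem_ball_self (he n)⟩)
    exact ⟨u, h1, h2, fun a ha => by
      obtain ⟨b, hb, hb', -⟩ := h3 a ha
      exact ⟨b, hb, hb'⟩⟩
  choose u huA hdis hcov using hu
  have hsum : ∀ n, ∑' _ : u n, ENNReal.ofReal (e n) ^ (t : ℝ) ≤ M := by
    intro n
    have hP : IsPackingOf A ε ((fun x => (x, e n)) '' u n) := by
      refine ⟨?_, ?_⟩
      · rintro _ ⟨x, hx, rfl⟩
        exact ⟨huA n hx, he n, heε n⟩
      · rintro _ ⟨x, hx, rfl⟩ _ ⟨y, hy, rfl⟩ hxy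
        exact hdis n hx hy (fun h => hxy (by rw [h]))
    refine le_trans (le_of_eq ?_)
      (le_iSup₂ (f := fun (P : Set (X × ℝ)) (_ : IsPackingOf A ε P) =>
        ∑' b : P, ENNReal.ofReal b.1.2 ^ (t : ℝ)) _ hP)
    have hinj : Set.InjOn (fun x => (x, e n)) (u n) := fun x _ y _ h => (Prod.mk.inj h).1
    exact (tsum_image (fun b : X × ℝ => ENNReal.ofReal b.2 ^ (t : ℝ)) hinj).symm
  have hpos : ∀ n, ENNReal.ofReal (e n) ^ (t : ℝ) ≠ 0 := fun n => by
    simp [ENNReal.rpow_eq_zero_iff, he n]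
  -- A family with a finite sum has countable support, and here every term is nonzero.
  have hcount : ∀ n, Countable (u n) := by
    intro n
    have := Summable.countable_support_ennreal ((hsum n).trans_lt hM).ne
    have hs : Function.support (fun _ : u n => ENNReal.ofReal (e n) ^ (t : ℝ)) = univ := by
      ext x; simp only [Function.mem_support, mem_univ, iff_true]; exact hpos n
    rw [hs] at this
    exact countable_univ_iff.1 this
  have hlim : Tendsto (fun n => ENNReal.ofReal (4 * e n)) atTop (𝓝 0) := by
    rw [← ENNReal.ofReal_zero]
    refine ENNReal.tendsto_ofReal ?_
    have := (tendsto_one_div_add_atTop_nhds_zero_nat (𝕜 := ℝ)).const_mul (4 * ε)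
    rw [mul_zero] at this
    refine this.congr fun n => ?_
    simp only [e]; ring
  have hdiam : ∀ n (x : u n), Metric.ediam (Metric.ball x.1 (2 * e n)) ≤ ENNReal.ofReal (4 * e n) := by
    intro n x
    have := Metric.ediam_eball_le (x := x.1) (r := ENNReal.ofReal (2 * e n))
    rw [Metric.eball_ofReal] at this
    refine this.trans (le_of_eq ?_)
    rw [← ENNReal.ofReal_ofNat 2, ← ENNReal.ofReal_mul (by norm_num)]
    congr 1; ring
  have key := Measure.hausdorffMeasure_le_liminf_tsum (t : ℝ) A
    (fun n => ENNReal.ofReal (4 * e n)) hlim (fun n (x : u n) => Metric.ball x.1 (2 * e n))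
    (Eventually.of_forall hdiam)
    (Eventually.of_forall fun n a ha => by
      obtain ⟨b, hb, z, hz⟩ := hcov n a ha
      refine mem_iUnion.2 ⟨⟨b, hb⟩, ?_⟩
      have h1 := Metric.mem_ball.1 hz.1
      have h2 := Metric.mem_ball.1 hz.2
      rw [Metric.mem_ball]
      have := dist_triangle_left a b z
      linarith)
  refine ne_top_of_le_ne_top ?_ (key.trans (liminf_le_of_frequently_le'
    (x := ENNReal.ofReal 4 ^ (t : ℝ) * M) (Frequently.of_forall fun n => ?_)))
  · exact ENNReal.mul_ne_top (ENNReal.rpow_ne_top_of_nonneg t.2 ENNReal.ofReal_ne_top) hM.ne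
  · calc ∑' x : u n, Metric.ediam (Metric.ball x.1 (2 * e n)) ^ (t : ℝ)
        ≤ ∑' _ : u n, ENNReal.ofReal 4 ^ (t : ℝ) * ENNReal.ofReal (e n) ^ (t : ℝ) := by
          refine ENNReal.tsum_le_tsum fun x => ?_
          rw [← ENNReal.mul_rpow_of_nonneg _ _ t.coe_nonneg, ← ENNReal.ofReal_mul (by norm_num)]
          exact ENNReal.rpow_le_rpow (hdiam n x) t.coe_nonneg
      _ ≤ _ := by
          rw [ENNReal.tsum_mul_left]
          gcongr
          exact hsum n

/-- If the `t`-packing measure is not infinite, the set has a countable cover by sets of finite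
`t`-premeasure. Each of these has finite `t`-Hausdorff measure, and Hausdorff dimension is countably
stable. -/
theorem dimH_le_packingDim (A : Set X) : dimH A ≤ packingDim A := by
  borelize X
  refine le_of_forall_lt fun c hc => ?_
  obtain ⟨t, hct, htA⟩ := ENNReal.lt_iff_exists_nnreal_btwn.1 hc
  refine hct.trans_le ?_
  by_cases h : packingMeasure t A = ∞
  · exact le_iSup₂ (f := fun (t : ℝ≥0) (_ : packingMeasure t A = ∞) => (t : ℝ≥0∞)) t h
  exfalso
  obtain ⟨C, hC⟩ := iInf_lt_iff.1 (lt_top_iff_ne_top.2 h)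
  obtain ⟨hAC, hC⟩ := iInf_lt_iff.1 hC
  refine not_le.2 htA ((dimH_mono hAC).trans ?_)
  rw [dimH_iUnion]
  exact iSup_le fun i => dimH_le_of_hausdorffMeasure_ne_top
    (hausdorffMeasure_ne_top_of_packingPremeasure (ENNReal.ne_top_of_tsum_ne_top hC.ne i))

/-! ### Cantor sets given by binary addresses -/

/-- Reading the address as a binary expansion maps the range onto `[0, 1]`. As `θ ^ D = 1/2`, the
separation makes this map Hölder with exponent `D`, so `1 ≤ dimH / D`. -/
theorem dimH_range_ge_of_binary {P : (ℕ → Fin 2) → X} {c θ D : ℝ} (hc : 0 < c) (hθ : 0 < θ)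
    (hD : 0 < D) (hθD : θ ^ D = 1 / 2)
    (hP : ∀ a b k, (∀ i < k, a i = b i) → a k ≠ b k → c * θ ^ k ≤ dist (P a) (P b)) :
    ENNReal.ofReal D ≤ dimH (range P) := by
  have hdiff : ∀ a b : ℕ → Fin 2, a ≠ b → ∃ k, (∀ i < k, a i = b i) ∧ a k ≠ b k := by
    classical
    intro a b hab
    have hex : ∃ k, a k ≠ b k := Function.ne_iff.1 hab
    exact ⟨Nat.find hex, fun i hi => not_not.1 (Nat.find_min hex hi), Nat.find_spec hex⟩
  have hinj : Function.Injective P := by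
    intro a b h
    by_contra hab
    obtain ⟨k, h1, h2⟩ := hdiff a b hab
    have := hP a b k h1 h2
    rw [h, dist_self] at this
    exact absurd this (not_le.2 (by positivity))
  let f : X → ℝ := fun x => Real.ofDigits (Function.invFun P x)
  have hf : ∀ a, f (P a) = Real.ofDigits a := fun a => by
    simp only [f, Function.leftInverse_invFun hinj a]
  have hH : HolderOnWith (Real.toNNReal ((1 / c) ^ D)) (Real.toNNReal D) f (range P) := by
    rintro _ ⟨a, rfl⟩ _ ⟨b, rfl⟩
    rw [hf, hf]
    by_cases hab : a = b
    · simp [hab]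
    obtain ⟨k, h1, h2⟩ := hdiff a b hab
    have h3 := Real.abs_ofDigits_sub_ofDigits_le h1
    have h4 := hP a b k h1 h2
    rw [edist_dist, edist_dist, Real.coe_toNNReal _ hD.le, Real.dist_eq,
      ENNReal.ofReal_rpow_of_nonneg dist_nonneg hD.le, ← ENNReal.ofReal, 
      ← ENNReal.ofReal_mul (by positivity)]
    refine ENNReal.ofReal_le_ofReal (h3.trans ?_)
    rw [← Real.mul_rpow (by positivity) dist_nonneg]
    have h5 : θ ^ k ≤ 1 / c * dist (P a) (P b) := by
      rw [one_div, ← div_eq_inv_mul, le_div_iff₀ hc]; linarith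
    have h6 : (((2 : ℕ) : ℝ) ^ k)⁻¹ = (θ ^ k) ^ D := by
      rw [← Real.rpow_natCast θ, ← Real.rpow_mul hθ.le, mul_comm, Real.rpow_mul hθ.le, hθD,
        Real.rpow_natCast]
      simp
    rw [h6]
    exact Real.rpow_le_rpow (by positivity) h5 hD.le
  have h1 := hH.dimH_image_le (Real.toNNReal_pos.2 hD)
  have h2 : Icc (0 : ℝ) 1 ⊆ f '' range P := by
    intro x hx
    obtain ⟨a, -, ha⟩ := Real.ofDigits_SurjOn one_lt_two hx
    exact ⟨P a, mem_range_self a, by rw [hf, ha]⟩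
  have h3 : dimH (Icc (0 : ℝ) 1) = 1 := by
    have := Real.dimH_of_nonempty_interior (E := ℝ) (s := Icc 0 1) (by simp)
    simpa using this
  have h4 := h3.symm.le.trans ((dimH_mono h2).trans h1)
  rw [ENNReal.le_div_iff_mul_le (Or.inl (by simpa using hD)) (Or.inl (by simp)), one_mul] at h4
  exact h4

/-- The `2 ^ n` cylinders of length `n` have diameter at most `C θ ^ n`. -/
theorem packingDim_range_le_of_binary {P : (ℕ → Fin 2) → X} {C θ D : ℝ} (hC : 0 < C)
    (hθ : 0 < θ) (hθ' : θ < 1) (hθD : θ ^ D = 1 / 2)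
    (hP : ∀ a b k, (∀ i < k, a i = b i) → dist (P a) (P b) ≤ C * θ ^ k) :
    packingDim (range P) ≤ ENNReal.ofReal D := by
  classical
  -- The same constant also bounds the number of sets, hence the maximum with `1`.
  refine packingDim_le_of_coverable (C := max C 1) (K := 2) (θ := θ) (by positivity) (by norm_num)
    hθ hθ' (by rw [hθD]; norm_num) fun n => ?_
  refine ⟨Finset.univ.image fun w : Fin n → Fin 2 => {x | ∃ a, (∀ i : Fin n, a i = w i) ∧ P a = x},
    ?_, ?_, ?_⟩
  · have h1 : ((Finset.univ.image fun w : Fin n → Fin 2 =>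
        {x | ∃ a, (∀ i : Fin n, a i = w i) ∧ P a = x}).card : ℝ) ≤ 2 ^ n := by
      refine (Nat.cast_le.2 Finset.card_image_le).trans ?_
      simp
    refine h1.trans (le_mul_of_one_le_left (by positivity) ?_)
    have : (1 : ℝ) ≤ max C 1 := le_max_right _ _
    nlinarith [(Nat.cast_nonneg n : (0 : ℝ) ≤ n)]
  · rintro _ ⟨a, rfl⟩
    refine ⟨{x | ∃ b, (∀ i : Fin n, b i = a i) ∧ P b = x}, ?_, a, fun _ => rfl, rfl⟩
    simp only [Finset.coe_image, Finset.coe_univ, image_univ]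
    exact ⟨fun i => a i, rfl⟩
  · intro S hS
    obtain ⟨w, -, rfl⟩ := Finset.mem_image.1 hS
    rintro _ ⟨a, ha, rfl⟩ _ ⟨b, hb, rfl⟩
    refine (hP a b n fun i hi => (ha ⟨i, hi⟩).trans (hb ⟨i, hi⟩).symm).trans ?_
    gcongr
    exact le_max_left _ _

/-- A Lipschitz preimage of a set of positive area has dimension at least `2`. -/
theorem two_le_dimH_of_volume_image_ne_zero {B : Set X} {f : X → ℂ} {L : ℝ≥0}
    (hf : LipschitzWith L f) (hB : volume (f '' B) ≠ 0) : 2 ≤ dimH B := by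
  refine le_trans ?_ (hf.dimH_image_le B)
  by_contra h
  rw [not_le] at h
  -- Area and two-dimensional Hausdorff measure are both Haar measures on the plane, so a set of
  -- dimension below `2` has area zero.
  have hac : (volume : Measure ℂ) ≪ μH[((2 : ℝ≥0) : ℝ)] := by
    have := Measure.absolutelyContinuous_isAddHaarMeasure (volume : Measure ℂ)
      (μH[(Module.finrank ℝ ℂ : ℝ)])
    rw [Complex.finrank_real_complex] at this
    exact_mod_cast this
  exact hB (measure_zero_of_dimH_lt hac (by exact_mod_cast h))

end Dimensions

/-! ### The distance to the boundary -/

section BoundaryDistance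

variable {Ω : Set ℂ}

theorem bdryDist_nonneg (z : ℂ) : 0 ≤ bdryDist Ω z := Metric.infDist_nonneg

/-- The point of the complement nearest to `z` lies on the frontier, so measuring to the frontier or
to the complement is the same for points of `Ω`. -/
theorem bdryDist_le_dist {z e : ℂ} (hz : z ∈ Ω) (he : e ∉ Ω) : bdryDist Ω z ≤ dist z e := by
  obtain ⟨y, hy, hyd⟩ := exists_mem_frontier_infDist_compl_eq_dist hz
    (fun h => he (h ▸ mem_univ e))
  exact (Metric.infDist_le_dist_of_mem hy).trans
    (hyd ▸ Metric.infDist_le_dist_of_mem (show e ∈ Ωᶜ from he))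

/-- A disc in `Ω` is interior and misses the frontier. The frontier must be nonempty because
`infDist` to the empty set is `0`. -/
theorem le_bdryDist (hfr : (frontier Ω).Nonempty) {z : ℂ} {r : ℝ} (h : Metric.ball z r ⊆ Ω) :
    r ≤ bdryDist Ω z := by
  refine (Metric.le_infDist hfr).2 fun y hy => ?_
  by_contra hlt
  have h1 : y ∈ Metric.ball z r := by rw [Metric.mem_ball, dist_comm]; exact not_le.1 hlt
  exact hy.2 (interior_maximal h Metric.isOpen_ball h1)

theorem ball_bdryDist_subset {z : ℂ} (hz : z ∈ Ω) : Metric.ball z (bdryDist Ω z) ⊆ Ω := by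
  intro y hy
  by_contra h
  rw [Metric.mem_ball, dist_comm] at hy
  exact absurd (bdryDist_le_dist hz h) (not_le.2 hy)

theorem bdryDist_pos (hΩ : IsOpen Ω) (hfr : (frontier Ω).Nonempty) {z : ℂ} (hz : z ∈ Ω) :
    0 < bdryDist Ω z := by
  obtain ⟨r, hr, h⟩ := Metric.isOpen_iff.1 hΩ z hz
  exact hr.trans_le (le_bdryDist hfr h)

theorem abs_bdryDist_sub_le (z w : ℂ) : |bdryDist Ω z - bdryDist Ω w| ≤ dist z w := by
  rw [abs_sub_le_iff]
  constructor
  · have := Metric.infDist_le_infDist_add_dist (s := frontier Ω) (x := z) (y := w)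
    unfold bdryDist; linarith
  · have := Metric.infDist_le_infDist_add_dist (s := frontier Ω) (x := w) (y := z)
    rw [dist_comm] at this
    unfold bdryDist; linarith

theorem continuousOn_bdryDist_rpow (hΩ : IsOpen Ω) (hfr : (frontier Ω).Nonempty) (e : ℝ) :
    ContinuousOn (fun z => bdryDist Ω z ^ e) Ω := by
  have hc : Continuous (fun z => bdryDist Ω z) := Metric.continuous_infDist_pt _
  exact hc.continuousOn.rpow_const fun z hz => Or.inl (bdryDist_pos hΩ hfr hz).ne'

end BoundaryDistance

/-! ### Curves -/

section CurveLemmas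

variable {Ω : Set ℂ} {ρ : ℂ → ℝ}

theorem IsCurveIn.dist_le {γ : ℝ → ℂ} {L : ℝ} {x y : ℂ} (h : IsCurveIn Ω γ L x y) {t t' : ℝ}
    (ht : t ∈ Icc 0 L) (ht' : t' ∈ Icc 0 L) : dist (γ t) (γ t') ≤ |t - t'| := by
  wlog hle : t' ≤ t generalizing t t'
  · rw [dist_comm, abs_sub_comm]
    exact this ht' ht (not_le.1 hle).le
  have h1 := eVariationOn.edist_le γ (s := Icc 0 L ∩ Icc t' t) ⟨ht, hle, le_rfl⟩ ⟨ht', le_rfl, hle⟩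
  rw [h.unitSpeed ht' ht, edist_dist, NNReal.coe_one, one_mul] at h1
  rw [abs_of_nonneg (sub_nonneg.2 hle)]
  exact (ENNReal.ofReal_le_ofReal_iff (sub_nonneg.2 hle)).1 h1

theorem IsCurveIn.continuousOn {γ : ℝ → ℂ} {L : ℝ} {x y : ℂ} (h : IsCurveIn Ω γ L x y) :
    ContinuousOn γ (Icc 0 L) := by
  have : LipschitzOnWith 1 γ (Icc 0 L) := LipschitzOnWith.of_dist_le_mul fun t ht t' ht' => by
    simpa [Real.dist_eq] using h.dist_le ht ht'
  exact this.continuousOn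

theorem rhoLength_one (γ : ℝ → ℂ) (L : ℝ) : rhoLength (fun _ => 1) γ L = ENNReal.ofReal L := by
  simp [rhoLength]

theorem edist_le_rhoEDist_one (x y : ℂ) :
    ENNReal.ofReal (dist x y) ≤ rhoEDist Ω (fun _ => 1) x y := by
  refine le_iInf₂ fun γ L => le_iInf fun h => ?_
  rw [rhoLength_one]
  have := h.dist_le (t := 0) (t' := L) ⟨le_rfl, h.nonneg⟩ ⟨h.nonneg, le_rfl⟩
  rw [h.start, h.finish, zero_sub, abs_neg, abs_of_nonneg h.nonneg] at this
  exact ENNReal.ofReal_le_ofReal this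

theorem exists_curve_of_rhoEDist_one_lt {x y : ℂ} {r : ℝ}
    (h : rhoEDist Ω (fun _ => 1) x y < ENNReal.ofReal r) : ∃ γ L, IsCurveIn Ω γ L x y ∧ L < r := by
  obtain ⟨γ, h⟩ := iInf_lt_iff.1 h
  obtain ⟨L, h⟩ := iInf_lt_iff.1 h
  obtain ⟨hγ, h⟩ := iInf_lt_iff.1 h
  rw [rhoLength_one] at h
  exact ⟨γ, L, hγ, (ENNReal.ofReal_lt_ofReal_iff_of_nonneg hγ.nonneg).1 h⟩

theorem rhoEDist_one_le_mul {m : ℝ} (hm : 0 < m) (hρ : ∀ z ∈ Ω, m ≤ ρ z) (x y : ℂ) :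
    rhoEDist Ω (fun _ => 1) x y ≤ ENNReal.ofReal (1 / m) * rhoEDist Ω ρ x y := by
  have hm0 : ENNReal.ofReal (1 / m) ≠ 0 := by simpa using hm
  have e : ENNReal.ofReal (1 / m) * rhoEDist Ω ρ x y =
      ⨅ (γ : ℝ → ℂ) (L : ℝ) (_ : IsCurveIn Ω γ L x y),
        ENNReal.ofReal (1 / m) * rhoLength ρ γ L := by
    simp only [rhoEDist, ENNReal.mul_iInf_of_ne hm0 ENNReal.ofReal_ne_top]
  rw [e]
  refine le_iInf₂ fun γ L => le_iInf fun h => (rhoEDist_le h).trans ?_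
  rw [rhoLength, rhoLength, ← lintegral_const_mul' _ _ ENNReal.ofReal_ne_top]
  refine setLIntegral_mono' measurableSet_Icc fun t ht => ?_
  rw [← ENNReal.ofReal_mul (by positivity)]
  refine ENNReal.ofReal_le_ofReal ?_
  rw [one_div, ← div_eq_inv_mul, le_div_iff₀ hm, one_mul]
  exact hρ _ (h.mem t ht)

theorem rhoEDist_segment_le {M : ℝ} {x y : ℂ} (hseg : segment ℝ x y ⊆ Ω)
    (hM : ∀ z ∈ segment ℝ x y, ρ z ≤ M) :
    rhoEDist Ω ρ x y ≤ ENNReal.ofReal (M * dist x y) := by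
  by_cases hxy : x = y
  · subst hxy
    rw [rhoEDist_self (hseg (left_mem_segment ℝ x x))]
    exact zero_le
  refine (rhoEDist_le (isCurveIn_segment hseg hxy)).trans ?_
  have hcurve := isCurveIn_segment (Subset.refl (segment ℝ x y)) hxy
  refine (setLIntegral_mono' (g := fun _ => ENNReal.ofReal M) measurableSet_Icc fun t ht =>
    ENNReal.ofReal_le_ofReal (hM _ (hcurve.mem t ht))).trans ?_
  rw [setLIntegral_const, Real.volume_Icc, sub_zero, ← ENNReal.ofReal_mul' (norm_nonneg _),
    dist_comm, dist_eq_norm]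

/-- A path in `Ω` that leaves `P` passes through the gate `B` of `P`. -/
theorem exists_crossing {P B : Set ℂ} {γ : ℝ → ℂ} {p q : ℝ} (hpq : p ≤ q)
    (hγ : ContinuousOn γ (Icc p q)) (hγΩ : ∀ t ∈ Icc p q, γ t ∈ Ω)
    (hcl : ∃ K, IsClosed K ∧ P = Ω ∩ K) (hop : ∃ V, IsOpen V ∧ P \ B = Ω ∩ V)
    (hp : γ p ∈ P) (hq : γ q ∉ P) :
    ∃ t ∈ Icc p q, γ t ∈ B ∧ ∀ t' ∈ Icc p t, γ t' ∈ P := by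
  obtain ⟨K, hK, rfl⟩ := hcl
  obtain ⟨V, hV, hPV⟩ := hop
  set S := {t ∈ Icc p q | γ t ∉ Ω ∩ K} with hS
  have hqS : q ∈ S := ⟨⟨hpq, le_rfl⟩, hq⟩
  have hbdd : BddBelow S := ⟨p, fun t ht => ht.1.1⟩
  set τ := sInf S with hτ
  have hτq : τ ≤ q := csInf_le hbdd hqS
  have hpτ : p ≤ τ := le_csInf ⟨q, hqS⟩ fun t ht => ht.1.1
  have hτI : τ ∈ Icc p q := ⟨hpτ, hτq⟩
  have hbefore : ∀ t ∈ Ico p τ, γ t ∈ Ω ∩ K := by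
    intro t ht
    by_contra h
    exact absurd (csInf_le hbdd (show t ∈ S from ⟨⟨ht.1, ht.2.le.trans hτq⟩, h⟩)) (not_le.2 ht.2)
  have hτP : γ τ ∈ Ω ∩ K := by
    refine ⟨hγΩ τ hτI, ?_⟩
    rcases hpτ.eq_or_lt with h | h
    · rw [← h]; exact hp.2
    have hmem : τ ∈ closure (Ico p τ) := by
      rw [closure_Ico h.ne]; exact ⟨hpτ, le_rfl⟩
    have hcont : ContinuousWithinAt γ (Ico p τ) τ :=
      (hγ τ hτI).mono fun t ht => ⟨ht.1, ht.2.le.trans hτq⟩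
    have := hcont.mem_closure_image hmem
    exact closure_minimal (image_subset_iff.2 fun t ht => (hbefore t ht).2) hK this
  refine ⟨τ, hτI, ?_, ?_⟩
  · by_contra hB
    have hτV : γ τ ∈ V := by
      have : γ τ ∈ Ω ∩ V := hPV ▸ ⟨hτP, hB⟩
      exact this.2
    have hnhds : ∀ᶠ t in 𝓝[Icc p q] τ, γ t ∈ V := (hγ τ hτI) (hV.mem_nhds hτV)
    obtain ⟨ε, hε, hball⟩ := Metric.mem_nhdsWithin_iff.1 hnhds
    obtain ⟨t, htS, htε⟩ := exists_lt_of_csInf_lt ⟨q, hqS⟩ (show sInf S < τ + ε by linarith)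
    have hτt : τ ≤ t := csInf_le hbdd htS
    have h1 : γ t ∈ V := hball ⟨by
      rw [Metric.mem_ball, Real.dist_eq, abs_of_nonneg (sub_nonneg.2 hτt)]; linarith, htS.1⟩
    have h2 : γ t ∈ (Ω ∩ K) \ B := hPV ▸ ⟨hγΩ t htS.1, h1⟩
    exact htS.2 h2.1
  · intro t ht
    rcases ht.2.eq_or_lt with h | h
    · rw [h]; exact hτP
    · exact hbefore t ⟨ht.1, h⟩

/-- A curve from `x` to `y` stays in `P` until it reaches the gate, which takes length at least `δ`,
and on this part the weight is at least `m`. -/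
theorem le_rhoEDist_of_crossing {P B : Set ℂ} {x y : ℂ} {m δ : ℝ}
    (hcl : ∃ K, IsClosed K ∧ P = Ω ∩ K) (hop : ∃ V, IsOpen V ∧ P \ B = Ω ∩ V)
    (hx : x ∈ P) (hy : y ∉ P) (hm : 0 ≤ m) (hρ : ∀ z ∈ P, m ≤ ρ z)
    (hδ : ∀ b ∈ B, δ ≤ dist x b) : ENNReal.ofReal (m * δ) ≤ rhoEDist Ω ρ x y := by
  refine le_iInf₂ fun γ L => le_iInf fun h => ?_
  obtain ⟨t, ht, htB, htP⟩ := exists_crossing h.nonneg h.continuousOn h.mem hcl hop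
    (h.start ▸ hx) (h.finish ▸ hy)
  have h1 : δ ≤ t := by
    have := (hδ _ htB).trans (le_of_eq_of_le (by rw [h.start])
      (h.dist_le (t := 0) (t' := t) ⟨le_rfl, h.nonneg⟩ ht))
    rwa [zero_sub, abs_neg, abs_of_nonneg ht.1] at this
  calc ENNReal.ofReal (m * δ) ≤ ENNReal.ofReal (m * t) :=
        ENNReal.ofReal_le_ofReal (mul_le_mul_of_nonneg_left h1 hm)
    _ = ∫⁻ _ in Icc 0 t, ENNReal.ofReal m := by
        rw [setLIntegral_const, Real.volume_Icc, sub_zero, ENNReal.ofReal_mul hm]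
    _ ≤ ∫⁻ u in Icc 0 t, ENNReal.ofReal (ρ (γ u)) :=
        setLIntegral_mono' measurableSet_Icc fun u hu => ENNReal.ofReal_le_ofReal (hρ _ (htP u hu))
    _ ≤ rhoLength ρ γ L := lintegral_mono_set (Icc_subset_Icc_right ht.2)

end CurveLemmas

/-! ### Distances in a convex piece of the domain -/

section Convex

variable {Ω H : Set ℂ} {c u v : ℂ} {w l : ℝ}

theorem towardCenter_mem (hconv : Convex ℝ H) (hH : IsOpen H) (hc : c ∈ H) (hu : u ∈ closure H)
    {t : ℝ} (ht : 0 < t) (ht1 : t ≤ 1) : u + t • (c - u) ∈ H := by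
  have := hconv.combo_interior_closure_mem_interior (hH.interior_eq.symm ▸ hc) hu ht
    (sub_nonneg.2 ht1) (by ring)
  rw [hH.interior_eq] at this
  convert this using 1
  rw [smul_sub, sub_smul, one_smul]; ring

/-- The homothety with centre `u` and ratio `t` carries the disc of radius `w` about `c` to a disc
of radius `t w`, which convexity keeps inside `H`. -/
theorem le_bdryDist_towardCenter (hfr : (frontier Ω).Nonempty) (hconv : Convex ℝ H)
    (hH : IsOpen H) (hHΩ : H ⊆ Ω) (hball : Metric.ball c w ⊆ H) (hu : u ∈ closure H) {t : ℝ}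
    (ht : 0 < t) (ht1 : t ≤ 1) : t * w ≤ bdryDist Ω (u + t • (c - u)) := by
  refine le_bdryDist hfr (Subset.trans (fun z hz => ?_) hHΩ)
  have hz' : c + t⁻¹ • (z - (u + t • (c - u))) ∈ Metric.ball c w := by
    rw [Metric.mem_ball, dist_eq_norm] at hz ⊢
    rw [add_sub_cancel_left, norm_smul, norm_inv, Real.norm_of_nonneg ht.le, ← div_eq_inv_mul,
      div_lt_iff₀ ht, mul_comm w]
    exact hz
  have := towardCenter_mem hconv hH (hball hz') hu ht ht1
  convert this using 1
  rw [add_sub_right_comm, smul_add, smul_smul, mul_inv_cancel₀ ht.ne', one_smul]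
  ring

theorem segment_towardCenter_subset (hconv : Convex ℝ H) (hH : IsOpen H) (hHΩ : H ⊆ Ω)
    (hc : c ∈ H) (hu : u ∈ closure H) (huΩ : u ∈ Ω) {t : ℝ} (ht1 : t ≤ 1) (ht : 0 ≤ t) :
    segment ℝ u (u + t • (c - u)) ⊆ Ω := by
  rw [segment_eq_image']
  rintro _ ⟨θ, hθ, rfl⟩
  simp only [add_sub_cancel_left, smul_smul]
  rcases (mul_nonneg hθ.1 ht).eq_or_lt with h | h
  · rw [← h]; simpa using huΩ
  · exact hHΩ (towardCenter_mem hconv hH hc hu h (mul_le_one₀ hθ.2 ht ht1))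

theorem towardCenter_sub (t : ℝ) :
    (u + t • (c - u)) - (v + t • (c - v)) = (1 - t) • (u - v) := by
  simp only [smul_sub, sub_smul, one_smul]; ring

theorem segment_towardCenter (hconv : Convex ℝ H) (hu : u ∈ closure H) (hv : v ∈ closure H)
    {t : ℝ} {z : ℂ} (hz : z ∈ segment ℝ (u + t • (c - u)) (v + t • (c - v))) :
    ∃ p ∈ closure H, z = p + t • (c - p) := by
  rw [segment_eq_image'] at hz
  obtain ⟨θ, hθ, rfl⟩ := hz
  refine ⟨u + θ • (v - u), ?_, ?_⟩
  · have := hconv.closure.segment_subset hu hv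
    rw [segment_eq_image'] at this
    exact this ⟨θ, hθ, rfl⟩
  · simp only [smul_sub, smul_add]
    rw [smul_comm t θ u, smul_comm t θ v]
    ring

/-- The straight segment may run along the boundary of `H` and leave `Ω`. So both ends are moved by
the fraction `t` toward `c`, the shifted segment is used, and `t` tends to `0`. -/
theorem rhoEDist_one_le_of_convex (hconv : Convex ℝ H) (hH : IsOpen H) (hHΩ : H ⊆ Ω)
    (hc : c ∈ H) (hu : u ∈ closure H) (huΩ : u ∈ Ω) (hv : v ∈ closure H) (hvΩ : v ∈ Ω) :
    rhoEDist Ω (fun _ => 1) u v ≤ ENNReal.ofReal (dist u v) := by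
  have key : ∀ t ∈ Ioc (0 : ℝ) 1, rhoEDist Ω (fun _ => 1) u v ≤
      ENNReal.ofReal (t * ‖c - u‖ + dist u v + t * ‖c - v‖) := by
    intro t ht
    have h1 : ∀ p ∈ closure H, p ∈ Ω →
        rhoEDist Ω (fun _ => 1) p (p + t • (c - p)) ≤ ENNReal.ofReal (t * ‖c - p‖) := by
      intro p hp hpΩ
      refine (rhoEDist_segment_le (M := 1)
        (segment_towardCenter_subset hconv hH hHΩ hc hp hpΩ ht.2 ht.1.le)
        (fun _ _ => le_rfl)).trans (le_of_eq ?_)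
      rw [one_mul, dist_self_add_right, norm_smul, Real.norm_of_nonneg ht.1.le]
    have h2 : rhoEDist Ω (fun _ => 1) (u + t • (c - u)) (v + t • (c - v)) ≤
        ENNReal.ofReal (dist u v) := by
      refine (rhoEDist_segment_le (M := 1) (fun z hz => ?_) (fun _ _ => le_rfl)).trans
        (ENNReal.ofReal_le_ofReal ?_)
      · obtain ⟨p, hp, rfl⟩ := segment_towardCenter hconv hu hv hz
        exact hHΩ (towardCenter_mem hconv hH hc hp ht.1 ht.2)
      · rw [one_mul, dist_eq_norm, towardCenter_sub, norm_smul, dist_eq_norm,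
          Real.norm_of_nonneg (sub_nonneg.2 ht.2)]
        exact mul_le_of_le_one_left (norm_nonneg _) (by linarith [ht.1])
    refine (rhoEDist_triangle u (v + t • (c - v)) v).trans ?_
    rw [ENNReal.ofReal_add (by have := ht.1; positivity) (by have := ht.1; positivity),
      ENNReal.ofReal_add (by have := ht.1; positivity) (by positivity)]
    refine add_le_add ((rhoEDist_triangle u (u + t • (c - u)) _).trans
      (add_le_add (h1 u hu huΩ) h2)) ((rhoEDist_comm_le _ _).trans (h1 v hv hvΩ))
  have hlim : Tendsto (fun t : ℝ => ENNReal.ofReal (t * ‖c - u‖ + dist u v + t * ‖c - v‖))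
      (𝓝[>] 0) (𝓝 (ENNReal.ofReal (dist u v))) := by
    refine ENNReal.tendsto_ofReal (tendsto_nhdsWithin_of_tendsto_nhds ?_)
    have : Continuous fun t : ℝ => t * ‖c - u‖ + dist u v + t * ‖c - v‖ := by fun_prop
    simpa using this.tendsto 0
  refine ge_of_tendsto hlim ?_
  filter_upwards [Ioc_mem_nhdsGT one_pos] with t ht using key t ht

/-! ### The weight `d ^ (-1/2)` in a convex piece. -/

theorem lintegral_sqrt_inv {a R : ℝ} (ha : 0 < a) (hR : 0 ≤ R) :
    ∫⁻ r in Icc 0 R, ENNReal.ofReal ((a * r) ^ (-1 / 2 : ℝ)) = ENNReal.ofReal (2 * √(R / a)) := by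
  have hint : IntervalIntegrable (fun r : ℝ => r ^ (-1 / 2 : ℝ)) volume 0 R :=
    intervalIntegral.intervalIntegrable_rpow' (by norm_num)
  have hI := hint.const_mul (a ^ (-1 / 2 : ℝ))
  rw [intervalIntegrable_iff_integrableOn_Ioc_of_le hR] at hI
  have e : ∀ r ∈ Ioc 0 R, ENNReal.ofReal ((a * r) ^ (-1 / 2 : ℝ)) =
      ENNReal.ofReal (a ^ (-1 / 2 : ℝ) * r ^ (-1 / 2 : ℝ)) := fun r hr => by
    rw [Real.mul_rpow ha.le hr.1.le]
  rw [setLIntegral_congr Ioc_ae_eq_Icc.symm, setLIntegral_congr_fun measurableSet_Ioc e,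
    ← ofReal_integral_eq_lintegral_ofReal hI, ← intervalIntegral.integral_of_le hR,
    intervalIntegral.integral_const_mul, integral_rpow (Or.inl (by norm_num))]
  · congr 1
    rw [Real.zero_rpow (by norm_num), sub_zero, Real.sqrt_eq_rpow,
      Real.div_rpow hR ha.le, show (-1 / 2 : ℝ) = -(1 / 2) by norm_num, Real.rpow_neg ha.le]
    norm_num
    ring
  · exact (ae_restrict_mem measurableSet_Ioc).mono fun r hr => by
      have := hr.1; simp only [Pi.zero_apply]; positivity

/-- At arc length `r` from `u` on the way to `c` the distance to the boundary is at least `(w / l)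
r`, and `(w r / l) ^ (-1/2)` is integrable at `0`. -/
theorem rhoEDist_towardCenter_le (hfr : (frontier Ω).Nonempty) (hconv : Convex ℝ H)
    (hH : IsOpen H) (hHΩ : H ⊆ Ω) (hw : 0 < w) (hball : Metric.ball c w ⊆ H)
    (hu : u ∈ closure H) (huΩ : u ∈ Ω) (hl : 0 < l) (hul : dist u c ≤ l) {t : ℝ} (ht : 0 < t)
    (ht1 : t ≤ 1) :
    rhoEDist Ω (fun z => bdryDist Ω z ^ (-1 / 2 : ℝ)) u (u + t • (c - u)) ≤
      ENNReal.ofReal (2 * √(t * l * l / w)) := by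
  by_cases huc : u = c
  · subst huc
    simp [rhoEDist_self huΩ]
  have hcu : 0 < ‖c - u‖ := norm_pos_iff.2 (sub_ne_zero.2 (Ne.symm huc))
  have hne : u ≠ u + t • (c - u) := by
    intro h
    have h0 := left_eq_add.1 h
    exact (smul_ne_zero ht.ne' (sub_ne_zero.2 (Ne.symm huc))) h0
  have hc : c ∈ H := hball (Metric.mem_ball_self hw)
  have hcurve := isCurveIn_segment (segment_towardCenter_subset hconv hH hHΩ hc hu huΩ ht1 ht.le) hne
  refine (rhoEDist_le hcurve).trans ?_
  have hnorm : ‖u + t • (c - u) - u‖ = t * ‖c - u‖ := by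
    rw [add_sub_cancel_left, norm_smul, Real.norm_of_nonneg ht.le]
  have hlc : ‖c - u‖ ≤ l := by rw [← dist_eq_norm, dist_comm]; exact hul
  rw [hnorm]
  unfold rhoLength
  calc _ ≤ ∫⁻ r in Icc 0 (t * ‖c - u‖), ENNReal.ofReal ((w / l * r) ^ (-1 / 2 : ℝ)) := by
        -- The end `r = 0` must be removed: there the majorant is the default value `0` of a
        -- negative power of `0`.
        rw [setLIntegral_congr Ioc_ae_eq_Icc.symm,
          setLIntegral_congr (Ioc_ae_eq_Icc (a := (0 : ℝ)) (b := t * ‖c - u‖)).symm]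
        refine setLIntegral_mono' measurableSet_Ioc fun r hr => ENNReal.ofReal_le_ofReal ?_
        have hr0 := hr.1
        refine Real.rpow_le_rpow_of_nonpos (by positivity) ?_ (by norm_num)
        have e : u + (r / (t * ‖c - u‖)) • (u + t • (c - u) - u) = u + (r / ‖c - u‖) • (c - u) := by
          rw [add_sub_cancel_left, smul_smul]
          congr 2; field_simp
        beta_reduce
        rw [e]
        have h1 : r / ‖c - u‖ ≤ 1 := by
          rw [div_le_one hcu]
          exact hr.2.trans (mul_le_of_le_one_left hcu.le ht1)
        refine le_trans ?_ (le_bdryDist_towardCenter hfr hconv hH hHΩ hball hu (by positivity) h1)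
        rw [div_mul_eq_mul_div, mul_comm w, mul_div_right_comm]
        gcongr
    _ = ENNReal.ofReal (2 * √(t * ‖c - u‖ / (w / l))) :=
        lintegral_sqrt_inv (by positivity) (by positivity)
    _ ≤ _ := by
        refine ENNReal.ofReal_le_ofReal ?_
        have : t * ‖c - u‖ / (w / l) ≤ t * l * l / w := by
          rw [div_div_eq_mul_div]; gcongr
        gcongr

/-- The `ρ`-distance, for `ρ = d^(-1/2)`, of two points of a convex piece of the domain that
contains a disc of radius `w` and has size `l`. -/
theorem rhoEDist_le_of_convex (hfr : (frontier Ω).Nonempty) (hconv : Convex ℝ H) (hH : IsOpen H)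
    (hHΩ : H ⊆ Ω) (hw : 0 < w) (hball : Metric.ball c w ⊆ H) (hl : 0 < l)
    (hHl : H ⊆ Metric.closedBall c l) (hu : u ∈ closure H) (huΩ : u ∈ Ω) (hv : v ∈ closure H)
    (hvΩ : v ∈ Ω) :
    rhoEDist Ω (fun z => bdryDist Ω z ^ (-1 / 2 : ℝ)) u v ≤
      ENNReal.ofReal (6 * √(dist u v * l / w)) := by
  have hcl : ∀ p ∈ closure H, dist p c ≤ l := fun p hp =>
    closure_minimal hHl Metric.isClosed_closedBall hp
  by_cases huv : u = v
  · subst huv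
    simp [rhoEDist_self huΩ]
  have hr : 0 < dist u v := dist_pos.2 huv
  have hr2 : dist u v ≤ 2 * l := by
    have := dist_triangle_right u v c
    linarith [hcl u hu, hcl v hv]
  set r := dist u v with hrdef
  -- This depth balances the three parts: the two legs toward `c` and the crossing at distance at
  -- least `t w` from the boundary each cost at most `2 √(r l / w)`.
  set t := r / (2 * l) with htdef
  have ht : 0 < t := by positivity
  have ht1 : t ≤ 1 := (div_le_one (by positivity)).2 hr2
  have hS : √(t * l * l / w) ≤ √(r * l / w) := by
    apply Real.sqrt_le_sqrt
    have : t * l * l / w = (r * l / w) / 2 := by rw [htdef]; field_simp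
    rw [this]
    have : 0 ≤ r * l / w := by positivity
    linarith
  have h1 : ∀ p ∈ closure H, p ∈ Ω →
      rhoEDist Ω (fun z => bdryDist Ω z ^ (-1 / 2 : ℝ)) p (p + t • (c - p)) ≤
        ENNReal.ofReal (2 * √(r * l / w)) := fun p hp hpΩ =>
    (rhoEDist_towardCenter_le hfr hconv hH hHΩ hw hball hp hpΩ hl (hcl p hp) ht ht1).trans
      (ENNReal.ofReal_le_ofReal (by gcongr))
  have h2 : rhoEDist Ω (fun z => bdryDist Ω z ^ (-1 / 2 : ℝ)) (u + t • (c - u)) (v + t • (c - v)) ≤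
      ENNReal.ofReal (2 * √(r * l / w)) := by
    refine (rhoEDist_segment_le (M := (t * w) ^ (-1 / 2 : ℝ)) (fun z hz => ?_)
      (fun z hz => ?_)).trans (ENNReal.ofReal_le_ofReal ?_)
    · obtain ⟨p, hp, rfl⟩ := segment_towardCenter hconv hu hv hz
      exact hHΩ (towardCenter_mem hconv hH (hball (Metric.mem_ball_self hw)) hp ht ht1)
    · obtain ⟨p, hp, rfl⟩ := segment_towardCenter hconv hu hv hz
      exact Real.rpow_le_rpow_of_nonpos (by positivity)
        (le_bdryDist_towardCenter hfr hconv hH hHΩ hball hp ht ht1) (by norm_num)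
    · have hd : dist (u + t • (c - u)) (v + t • (c - v)) ≤ r := by
        rw [dist_eq_norm, towardCenter_sub, norm_smul, hrdef, dist_eq_norm,
          Real.norm_of_nonneg (sub_nonneg.2 ht1)]
        exact mul_le_of_le_one_left (norm_nonneg _) (by linarith)
      calc (t * w) ^ (-1 / 2 : ℝ) * dist (u + t • (c - u)) (v + t • (c - v))
          ≤ (t * w) ^ (-1 / 2 : ℝ) * r := by gcongr
        _ = √(2 * (r * l / w)) := by
          rw [show (-1 / 2 : ℝ) = -(1 / 2) by norm_num, Real.rpow_neg (by positivity),
            ← Real.sqrt_eq_rpow, ← div_eq_inv_mul, div_eq_iff (by positivity),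
            ← Real.sqrt_mul (by positivity)]
          have : 2 * (r * l / w) * (t * w) = r ^ 2 := by rw [htdef]; field_simp
          rw [this, Real.sqrt_sq hr.le]
        _ ≤ 2 * √(r * l / w) := by
          rw [Real.sqrt_mul (by norm_num)]
          gcongr
          rw [Real.sqrt_le_left (by norm_num)]; norm_num
  refine (rhoEDist_triangle u (v + t • (c - v)) v).trans ?_
  rw [show 6 * √(r * l / w) = 2 * √(r * l / w) + 2 * √(r * l / w) + 2 * √(r * l / w) by ring,
    ENNReal.ofReal_add (by positivity) (by positivity),
    ENNReal.ofReal_add (by positivity) (by positivity)]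
  exact add_le_add ((rhoEDist_triangle u (u + t • (c - u)) _).trans
    (add_le_add (h1 u hu huΩ) h2)) ((rhoEDist_comm_le _ _).trans (h1 v hv hvΩ))

end Convex

/-! ### The completions -/

section Completions

variable {Ω : Set ℂ} {ρ : ℂ → ℝ}

theorem dist_toRhoClosure_eq (x y : RhoSpace Ω ρ) :
    dist (toRhoClosure Ω ρ x) (toRhoClosure Ω ρ y) = dist x y :=
  UniformSpace.Completion.dist_eq x y

theorem dist_toRhoClosure (hΩ : IsOpen Ω) (hc : IsPreconnected Ω) (hρ : ContinuousOn ρ Ω)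
    (x y : Ω) : dist (toRhoClosure Ω ρ x) (toRhoClosure Ω ρ y) = (rhoEDist Ω ρ x y).toReal := by
  unfold toRhoClosure
  rw [UniformSpace.Completion.dist_eq, RhoSpace.dist_eq hΩ hc hρ]

theorem dist_toRhoClosure_le (hΩ : IsOpen Ω) (hc : IsPreconnected Ω) (hρ : ContinuousOn ρ Ω)
    {x y : Ω} {r : ℝ} (hr : 0 ≤ r) (h : rhoEDist Ω ρ x y ≤ ENNReal.ofReal r) :
    dist (toRhoClosure Ω ρ x) (toRhoClosure Ω ρ y) ≤ r := by
  rw [dist_toRhoClosure hΩ hc hρ]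
  exact ENNReal.toReal_le_of_le_ofReal hr h

theorem le_dist_toRhoClosure (hΩ : IsOpen Ω) (hc : IsPreconnected Ω) (hρ : ContinuousOn ρ Ω)
    {x y : Ω} {r : ℝ} (h : ENNReal.ofReal r ≤ rhoEDist Ω ρ x y) :
    r ≤ dist (toRhoClosure Ω ρ x) (toRhoClosure Ω ρ y) := by
  rw [dist_toRhoClosure hΩ hc hρ]
  exact (ENNReal.ofReal_le_iff_le_toReal (rhoEDist_ne_top hΩ hc hρ x.2 y.2)).1 h

theorem denseRange_toRhoClosure : DenseRange (toRhoClosure Ω ρ) :=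
  UniformSpace.Completion.denseRange_coe (α := RhoSpace Ω ρ)

/-- A uniformly continuous map of `(Ω, d_ρ)` to a complete space extends to the completion. -/
theorem exists_extension_rhoClosure {Y : Type*} [MetricSpace Y] [CompleteSpace Y] (g : Ω → Y)
    {C e : ℝ} (he : 0 < e)
    (hg : ∀ x y, dist (g x) (g y) ≤ C * dist (toRhoClosure Ω ρ x) (toRhoClosure Ω ρ y) ^ e) :
    ∃ f : RhoClosure Ω ρ → Y, Continuous f ∧ ∀ x, f (toRhoClosure Ω ρ x) = g x := by
  let g' : RhoSpace Ω ρ → Y := g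
  have hu : UniformContinuous g' := by
    rw [Metric.uniformContinuous_iff]
    intro ε hε
    have hlim : Tendsto (fun r : ℝ => C * r ^ e) (𝓝 0) (𝓝 0) := by
      have : ContinuousAt (fun r : ℝ => C * r ^ e) 0 :=
        continuousAt_const.mul (Real.continuousAt_rpow_const _ _ (Or.inr he.le))
      simpa [ContinuousAt, Real.zero_rpow he.ne'] using this
    obtain ⟨δ, hδ, h⟩ := Metric.eventually_nhds_iff.1 (hlim.eventually (gt_mem_nhds hε))
    refine ⟨δ, hδ, fun {x y} hxy => (hg x y).trans_lt (h ?_)⟩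
    rw [Real.dist_eq, sub_zero, abs_of_nonneg dist_nonneg]
    rw [dist_toRhoClosure_eq]
    exact hxy
  exact ⟨UniformSpace.Completion.extension _, UniformSpace.Completion.continuous_extension,
    fun x => UniformSpace.Completion.extension_coe hu x⟩

theorem exists_tendsto_toRhoClosure (p : RhoClosure Ω ρ) :
    ∃ x : ℕ → Ω, Tendsto (fun n => toRhoClosure Ω ρ (x n)) atTop (𝓝 p) := by
  have hp : p ∈ closure (range (toRhoClosure Ω ρ)) := denseRange_toRhoClosure p
  obtain ⟨y, hy, hlim⟩ := mem_closure_iff_seq_limit.1 hp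
  choose x hx using hy
  exact ⟨x, by simpa only [hx] using hlim⟩

theorem dist_le_dist_internal (hΩ : IsOpen Ω) (hc : IsPreconnected Ω) (x y : Ω) :
    dist (x : ℂ) y ≤ dist (toRhoClosure Ω (fun _ => 1) x) (toRhoClosure Ω (fun _ => 1) y) :=
  le_dist_toRhoClosure hΩ hc continuousOn_const (edist_le_rhoEDist_one _ _)

/-- The canonical map of the internal completion to the plane. -/
theorem exists_internalClosure_map (hΩ : IsOpen Ω) (hc : IsPreconnected Ω) :
    ∃ f : InternalClosure Ω → ℂ, LipschitzWith 1 f ∧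
      ∀ x : Ω, f (toRhoClosure Ω (fun _ => 1) x) = x := by
  let g : RhoSpace Ω (fun _ : ℂ => (1 : ℝ)) → ℂ := fun x => x.1
  have hL : LipschitzWith 1 g := by
    refine LipschitzWith.of_dist_le_mul fun x y => ?_
    rw [NNReal.coe_one, one_mul, ← dist_toRhoClosure_eq]
    exact dist_le_dist_internal hΩ hc x y
  exact ⟨_, hL.completion_extension, fun x =>
    UniformSpace.Completion.extension_coe hL.uniformContinuous x⟩

/-- The distance to the boundary extends continuously to the completion. If it were positive at `q`,
a disc about the plane image of `q` would lie in `Ω`; along radii of this disc internal and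
Euclidean distance agree, so `q` would be a point of `Ω`. -/
theorem tendsto_bdryDist_internalBoundary (hΩ : IsOpen Ω) (hc : IsPreconnected Ω)
    {q : InternalClosure Ω} (hq : q ∈ internalBoundary Ω) :
    Tendsto (fun y : Ω => bdryDist Ω (y : ℂ)) (comap (toRhoClosure Ω (fun _ => 1)) (𝓝 q))
      (𝓝 0) := by
  obtain ⟨Φ, hΦ, hΦΩ⟩ := exists_internalClosure_map hΩ hc
  set D : InternalClosure Ω → ℝ := fun p => bdryDist Ω (Φ p) with hD
  have hDc : Continuous D := (Metric.continuous_infDist_pt _).comp hΦ.continuous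
  have hlim : Tendsto (fun y : Ω => bdryDist Ω (y : ℂ))
      (comap (toRhoClosure Ω (fun _ => 1)) (𝓝 q)) (𝓝 (D q)) := by
    have : (fun y : Ω => bdryDist Ω (y : ℂ)) = D ∘ toRhoClosure Ω (fun _ => 1) := by
      funext y; simp [hD, hΦΩ]
    rw [this]
    exact (hDc.tendsto q).comp tendsto_comap
  suffices D q = 0 by rwa [this] at hlim
  by_contra hne
  have hpos : 0 < D q := lt_of_le_of_ne (bdryDist_nonneg _) (Ne.symm hne)
  obtain ⟨y, hy⟩ := exists_tendsto_toRhoClosure q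
  have hy' : Tendsto (fun n => (y n : ℂ)) atTop (𝓝 (Φ q)) := by
    have := (hΦ.continuous.tendsto q).comp hy
    simpa only [Function.comp_def, hΦΩ] using this
  have hzΩ : ∀ᶠ n in atTop, Metric.ball (Φ q) (D q / 2) ⊆ Ω ∧ (y n : ℂ) ∈ Metric.ball (Φ q) (D q / 2) := by
    filter_upwards [hy'.eventually (Metric.ball_mem_nhds (Φ q) (show 0 < D q / 4 by positivity))]
      with n hn
    refine ⟨fun z hz => ball_bdryDist_subset (y n).2 ?_, hn.trans (by linarith)⟩
    rw [Metric.mem_ball] at hz ⊢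
    have h1 := abs_le.1 (abs_bdryDist_sub_le (Ω := Ω) (y n : ℂ) (Φ q))
    have h2 := dist_triangle_right z (y n : ℂ) (Φ q)
    have h3 : D q = bdryDist Ω (Φ q) := rfl
    linarith [h1.1]
  obtain ⟨n₀, hn₀⟩ := hzΩ.exists
  have hzmem : Φ q ∈ Ω := hn₀.1 (Metric.mem_ball_self (by positivity))
  refine hq ⟨⟨Φ q, hzmem⟩, ?_⟩
  refine tendsto_nhds_unique (tendsto_iff_dist_tendsto_zero.2 ?_) hy
  refine squeeze_zero' (Eventually.of_forall fun _ => dist_nonneg) ?_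
    (tendsto_iff_dist_tendsto_zero.1 hy')
  filter_upwards [hzΩ] with n hn
  refine dist_toRhoClosure_le hΩ hc continuousOn_const dist_nonneg ?_
  refine (rhoEDist_segment_le (M := 1) (((convex_ball _ _).segment_subset hn.2
    (Metric.mem_ball_self (by positivity))).trans hn.1) (fun _ _ => le_rfl)).trans ?_
  rw [one_mul]

/-- As soon as `0 < d < 1` the quotient of logarithms is exactly `e`, and near the internal boundary
this is always the case. -/
theorem exponents_of_rpow_bdryDist (hΩ : IsOpen Ω) (hc : IsPreconnected Ω)
    (hfr : (frontier Ω).Nonempty) (e : ℝ) {q : InternalClosure Ω} (hq : q ∈ internalBoundary Ω) :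
    lowerExponent Ω (fun z => bdryDist Ω z ^ e) q = (e : EReal) ∧
      upperExponent Ω (fun z => bdryDist Ω z ^ e) q = (e : EReal) := by
  have hne : NeBot (comap (toRhoClosure Ω (fun _ => 1)) (𝓝 q)) :=
    by
    refine comap_neBot fun t ht => ?_
    obtain ⟨_, hy, y, rfl⟩ := mem_closure_iff_nhds.1 (denseRange_toRhoClosure q) t ht
    exact ⟨y, hy⟩
  have hev : (fun y : Ω => ((Real.log (bdryDist Ω (y : ℂ) ^ e) / Real.log (bdryDist Ω (y : ℂ)) :
      ℝ) : EReal)) =ᶠ[comap (toRhoClosure Ω (fun _ => 1)) (𝓝 q)] fun _ => (e : EReal) := by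
    filter_upwards [(tendsto_bdryDist_internalBoundary hΩ hc hq).eventually
      (gt_mem_nhds one_pos)] with y hy
    have hpos := bdryDist_pos hΩ hfr y.2
    rw [Real.log_rpow hpos, mul_div_cancel_right₀ _ (Real.log_neg hpos hy).ne]
  exact ⟨(liminf_congr hev).trans (liminf_const _), (limsup_congr hev).trans (limsup_const _)⟩

/-- A continuous extension of the identity turns the relation into the graph of `φ`, so images of
sets can be computed as `φ '' A`. -/
theorem isSamePoint_iff {φ : RhoClosure Ω ρ → InternalClosure Ω} (hφ : Continuous φ)
    (hφΩ : ∀ x, φ (toRhoClosure Ω ρ x) = toRhoClosure Ω (fun _ => 1) x) {p : RhoClosure Ω ρ}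
    {q : InternalClosure Ω} : IsSamePoint Ω ρ p q ↔ q = φ p := by
  constructor
  · rintro ⟨x, h1, h2⟩
    have := (hφ.tendsto p).comp h1
    simp only [Function.comp_def, hφΩ] at this
    exact tendsto_nhds_unique h2 this
  · rintro rfl
    obtain ⟨x, hx⟩ := exists_tendsto_toRhoClosure p
    refine ⟨x, hx, ?_⟩
    have := (hφ.tendsto p).comp hx
    simpa only [Function.comp_def, hφΩ] using this

theorem internalImage_eq {φ : RhoClosure Ω ρ → InternalClosure Ω} (hφ : Continuous φ)
    (hφΩ : ∀ x, φ (toRhoClosure Ω ρ x) = toRhoClosure Ω (fun _ => 1) x)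
    (A : Set (RhoClosure Ω ρ)) : internalImage A = φ '' A := by
  ext q
  simp only [internalImage, mem_ofPred_eq, isSamePoint_iff hφ hφΩ, mem_image, eq_comm]

/-- If the identity map is Lipschitz from `d_ρ` to `d` and Hölder continuous from `d` to `d_ρ`,
then `ρ` is a density. -/
theorem isDensity_of_hoelder (hρ : ContinuousOn ρ Ω) (hpos : ∀ x ∈ Ω, 0 < ρ x)
    {φ : RhoClosure Ω ρ → InternalClosure Ω} (hφ : Continuous φ)
    (hφΩ : ∀ x, φ (toRhoClosure Ω ρ x) = toRhoClosure Ω (fun _ => 1) x)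
    {ψ : InternalClosure Ω → RhoClosure Ω ρ} (hψ : Continuous ψ)
    (hψΩ : ∀ x, ψ (toRhoClosure Ω (fun _ => 1) x) = toRhoClosure Ω ρ x)
    (hne : (rhoBoundary Ω ρ).Nonempty) : IsDensity Ω ρ where
  continuousOn := hρ
  pos := hpos
  nonempty := hne
  converges := by
    rintro x ⟨p, hp⟩
    refine ⟨φ p, ?_⟩
    have := (hφ.tendsto p).comp hp
    simpa only [Function.comp_def, hφΩ] using this
  unique := by
    rintro x ⟨q, hq⟩ p _ p' _ hp hp'
    have h := (hψ.tendsto q).comp hq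
    simp only [Function.comp_def, hψΩ] at h
    -- The sequence converges to `ψ q` in the `ρ`-completion, so this is its only cluster point.
    have key : ∀ r, MapClusterPt r atTop (fun n => toRhoClosure Ω ρ (x n)) → r = ψ q := by
      intro r hr
      by_contra hne
      obtain ⟨U, V, hU, hV, hrU, hqV, hUV⟩ := t2_separation hne
      have h1 := (mapClusterPt_iff_frequently.1 hr) U (hU.mem_nhds hrU)
      have h2 := h.eventually (hV.mem_nhds hqV)
      obtain ⟨n, hn1, hn2⟩ := (h1.and_eventually h2).exists
      exact Set.disjoint_left.1 hUV hn1 hn2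
    rw [key p hp, key p' hp']

end Completions

/-! ### Estimates for the lengths and the ratios -/

section Sequences

variable {s α₁ : ℝ}

theorem kochRatio_pos (hα₀ : 0 < α₁) (hα₁ : α₁ < 1 / 2) : ∀ k, 0 < kochRatio s α₁ (k + 1)
  | 0 => hα₀
  | k + 1 => by
    have h1 := kochLength_pos s (show α₁ < 1 by linarith) (k + 1)
    simp only [kochRatio]
    positivity

theorem kochLength_succ_le_half (hα₀ : 0 < α₁) (hα₁ : α₁ < 1 / 2) (k : ℕ) :
    kochLength s α₁ (k + 1) ≤ kochLength s α₁ k / 2 := by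
  rw [kochLength_succ s (by linarith)]
  have h1 := kochLength_pos s (show α₁ < 1 by linarith) k
  have h2 := kochRatio_pos (s := s) hα₀ hα₁ k
  nlinarith

theorem kochLength_le_pow (hα₀ : 0 < α₁) (hα₁ : α₁ < 1 / 2) (k : ℕ) :
    kochLength s α₁ k ≤ (1 / 2) ^ k := by
  induction k with
  | zero => simp [kochLength]
  | succ k ih =>
    have := kochLength_succ_le_half (s := s) hα₀ hα₁ k
    rw [pow_succ]; linarith

theorem kochLength_le_one (hα₀ : 0 < α₁) (hα₁ : α₁ < 1 / 2) (k : ℕ) : kochLength s α₁ k ≤ 1 :=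
  (kochLength_le_pow hα₀ hα₁ k).trans (pow_le_one₀ (by norm_num) (by norm_num))

theorem kochLength_antitone (hα₀ : 0 < α₁) (hα₁ : α₁ < 1 / 2) : Antitone (kochLength s α₁) :=
  antitone_nat_of_succ_le fun k => by
    have := kochLength_succ_le_half (s := s) hα₀ hα₁ k
    have := kochLength_pos s (show α₁ < 1 by linarith) k
    linarith

/-- For `k ≥ 1` and `x = l_k ^ (1 - 2s)` the ratio is `x / (2 + x)`. As `0 < x ≤ 1`, it lies between
`x / 3` and `x / 2`, and below `1/3`. Only the first ratio is free, which is why minima and maxima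
of `α₁` and `1/3` occur below. -/
theorem kochRatio_le_rpow (hα₁ : α₁ < 1 / 2) : ∀ k,
    kochRatio s α₁ (k + 1) ≤ kochLength s α₁ k ^ (1 - 2 * s) / 2
  | 0 => by simp only [kochRatio, kochLength, Real.one_rpow]; linarith
  | k + 1 => by
    have h1 := kochLength_pos s (show α₁ < 1 by linarith) (k + 1)
    have h2 : 0 < kochLength s α₁ (k + 1) ^ (1 - 2 * s) := by positivity
    simp only [kochRatio]
    gcongr
    linarith

theorem rpow_le_kochRatio (hs₁ : s < 1 / 2) (hα₀ : 0 < α₁) (hα₁ : α₁ < 1 / 2) : ∀ k,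
    min α₁ (1 / 3) * kochLength s α₁ k ^ (1 - 2 * s) ≤ kochRatio s α₁ (k + 1)
  | 0 => by simp [kochRatio, kochLength]
  | k + 1 => by
    have h1 := kochLength_pos s (show α₁ < 1 by linarith) (k + 1)
    have h2 : 0 < kochLength s α₁ (k + 1) ^ (1 - 2 * s) := by positivity
    have h3 : kochLength s α₁ (k + 1) ^ (1 - 2 * s) ≤ 1 :=
      Real.rpow_le_one h1.le (kochLength_le_one hα₀ hα₁ _) (by linarith)
    simp only [kochRatio]
    rw [le_div_iff₀ (by positivity)]
    have : min α₁ (1 / 3) * (2 + kochLength s α₁ (k + 1) ^ (1 - 2 * s)) ≤ 1 := by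
      have := min_le_right α₁ (1 / 3)
      have : 0 < min α₁ (1 / 3) := lt_min hα₀ (by norm_num)
      nlinarith
    nlinarith

theorem kochRatio_le_max (hs₁ : s < 1 / 2) (hα₀ : 0 < α₁) (hα₁ : α₁ < 1 / 2) : ∀ k,
    kochRatio s α₁ (k + 1) ≤ max α₁ (1 / 3)
  | 0 => le_max_left _ _
  | k + 1 => by
    refine le_trans ?_ (le_max_right _ _)
    have h1 := kochLength_pos s (show α₁ < 1 by linarith) (k + 1)
    have h2 : 0 < kochLength s α₁ (k + 1) ^ (1 - 2 * s) := by positivity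
    have h3 : kochLength s α₁ (k + 1) ^ (1 - 2 * s) ≤ 1 :=
      Real.rpow_le_one h1.le (kochLength_le_one hα₀ hα₁ _) (by linarith)
    simp only [kochRatio]
    rw [div_le_div_iff₀ (by positivity) (by norm_num)]
    linarith

theorem kochRatio_lt_half (hs₁ : s < 1 / 2) (hα₀ : 0 < α₁) (hα₁ : α₁ < 1 / 2) (k : ℕ) :
    kochRatio s α₁ (k + 1) < 1 / 2 :=
  (kochRatio_le_max hs₁ hα₀ hα₁ k).trans_lt (max_lt hα₁ (by norm_num))

theorem quarter_le_kochLength_succ (hs₁ : s < 1 / 2) (hα₀ : 0 < α₁) (hα₁ : α₁ < 1 / 2) (k : ℕ) :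
    kochLength s α₁ k / 4 ≤ kochLength s α₁ (k + 1) := by
  rw [kochLength_succ s (by linarith)]
  have h1 := kochLength_pos s (show α₁ < 1 by linarith) k
  have h2 := kochRatio_lt_half hs₁ hα₀ hα₁ k
  nlinarith

/-- The bases of the spikes: `α_{k+1} l_k ≤ l_k^(2 - 2 s) / 2`. -/
theorem kochRatio_mul_kochLength_le (hα₁ : α₁ < 1 / 2) (k : ℕ) :
    kochRatio s α₁ (k + 1) * kochLength s α₁ k ≤ kochLength s α₁ k ^ (2 - 2 * s) / 2 := by
  have h1 := kochLength_pos s (show α₁ < 1 by linarith) k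
  have h2 := kochRatio_le_rpow (s := s) hα₁ k
  rw [show 2 - 2 * s = (1 - 2 * s) + 1 by ring, Real.rpow_add_one h1.ne']
  nlinarith

theorem tendsto_kochLength (hα₀ : 0 < α₁) (hα₁ : α₁ < 1 / 2) :
    Tendsto (kochLength s α₁) atTop (𝓝 0) :=
  squeeze_zero (fun k => (kochLength_pos s (by linarith) k).le) (kochLength_le_pow hα₀ hα₁)
    (tendsto_pow_atTop_nhds_zero_of_lt_one (by norm_num) (by norm_num))

theorem summable_kochRatio (hs₁ : s < 1 / 2) (hα₀ : 0 < α₁) (hα₁ : α₁ < 1 / 2) :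
    Summable fun k => kochRatio s α₁ (k + 1) := by
  have hq : ((1 / 2 : ℝ)) ^ (1 - 2 * s) < 1 :=
    Real.rpow_lt_one (by norm_num) (by norm_num) (by linarith)
  refine Summable.of_nonneg_of_le (fun k => (kochRatio_pos hα₀ hα₁ k).le) (fun k => ?_)
    (summable_geometric_of_lt_one (by positivity) hq)
  have h1 := kochLength_pos s (show α₁ < 1 by linarith) k
  have h2 : 0 < kochLength s α₁ k ^ (1 - 2 * s) := by positivity
  calc kochRatio s α₁ (k + 1) ≤ kochLength s α₁ k ^ (1 - 2 * s) := by
        linarith [kochRatio_le_rpow (s := s) hα₁ k]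
    _ ≤ ((1 / 2) ^ k) ^ (1 - 2 * s) :=
        Real.rpow_le_rpow h1.le (kochLength_le_pow hα₀ hα₁ k) (by linarith)
    _ = _ := by
        rw [← Real.rpow_natCast, ← Real.rpow_natCast, ← Real.rpow_mul (by norm_num),
          ← Real.rpow_mul (by norm_num), mul_comm]

/-- Here `l_k = 2 ^ (-k) ∏ (1 - α_i)`, and the product stays away from `0` because `∑ α_i`
converges. This is what makes the dimensions exactly `1`, `1 / s` and `2`. -/
theorem exists_le_kochLength (hs₁ : s < 1 / 2) (hα₀ : 0 < α₁) (hα₁ : α₁ < 1 / 2) :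
    ∃ c, 0 < c ∧ ∀ k, c * (1 / 2) ^ k ≤ kochLength s α₁ k := by
  have hsum := summable_kochRatio hs₁ hα₀ hα₁
  refine ⟨Real.exp (-2 * ∑' k, kochRatio s α₁ (k + 1)), Real.exp_pos _, fun k => ?_⟩
  have key : ∀ k, Real.exp (-2 * ∑ i ∈ Finset.range k, kochRatio s α₁ (i + 1)) * (1 / 2) ^ k ≤
      kochLength s α₁ k := by
    intro k
    induction k with
    | zero => simp [kochLength]
    | succ k ih =>
      rw [kochLength_succ s (by linarith), Finset.sum_range_succ, mul_add, Real.exp_add, pow_succ]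
      set x := kochRatio s α₁ (k + 1)
      have hx : x < 1 / 2 := kochRatio_lt_half hs₁ hα₀ hα₁ k
      have hx0 : 0 < x := kochRatio_pos hα₀ hα₁ k
      -- For `0 < x < 1/2` one has `1 / (1 - x) ≤ 1 + 2 x ≤ exp (2 x)`.
      have h1 : Real.exp (-2 * x) ≤ 1 - x := by
        rw [show -2 * x = -(2 * x) by ring, Real.exp_neg]
        refine inv_le_of_inv_le₀ (by linarith) ?_
        refine le_trans ?_ (Real.add_one_le_exp _)
        rw [inv_le_iff_one_le_mul₀ (by linarith)]
        nlinarith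
      have h2 : 0 < Real.exp (-2 * ∑ i ∈ Finset.range k, kochRatio s α₁ (i + 1)) * (1 / 2) ^ k := by
        positivity
      have h3 := mul_le_mul ih h1 (Real.exp_pos _).le (h2.le.trans ih)
      linarith
  refine le_trans (mul_le_mul_of_nonneg_right (Real.exp_le_exp.2 ?_) (by positivity)) (key k)
  have := hsum.sum_le_tsum (Finset.range k) (fun i _ => (kochRatio_pos hα₀ hα₁ i).le)
  linarith

end Sequences

/-! ### Coordinates along a segment -/

section Coordinates

/-- The point with coordinates `(x, y)` along the segment `σ`; the second coordinate is positive
on the right of `σ`, the outside of the domain. -/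
def segPoint (σ : ℂ × ℂ) (x y : ℝ) : ℂ := σ.1 + (x - y * Complex.I) * (σ.2 - σ.1)

/-- The coordinate along the segment `σ`. -/
def segX (σ : ℂ × ℂ) (z : ℂ) : ℝ := ((z - σ.1) / (σ.2 - σ.1)).re

/-- The coordinate perpendicular to the segment `σ`. -/
def segY (σ : ℂ × ℂ) (z : ℂ) : ℝ := -((z - σ.1) / (σ.2 - σ.1)).im

variable {σ : ℂ × ℂ}

theorem continuous_segX : Continuous (segX σ) := by unfold segX; fun_prop
theorem continuous_segY : Continuous (segY σ) := by unfold segY; fun_prop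

theorem segPoint_segX_segY (hσ : σ.1 ≠ σ.2) (z : ℂ) : segPoint σ (segX σ z) (segY σ z) = z := by
  have h : σ.2 - σ.1 ≠ 0 := sub_ne_zero.2 hσ.symm
  have e : ((segX σ z : ℂ) - segY σ z * Complex.I) = (z - σ.1) / (σ.2 - σ.1) := by
    apply Complex.ext <;> simp [segX, segY]
  rw [segPoint, e, div_mul_cancel₀ _ h]; ring

theorem segX_segPoint (hσ : σ.1 ≠ σ.2) (x y : ℝ) : segX σ (segPoint σ x y) = x := by
  have h : σ.2 - σ.1 ≠ 0 := sub_ne_zero.2 hσ.symm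
  rw [segX, segPoint, add_sub_cancel_left, mul_div_cancel_right₀ _ h]; simp

theorem segY_segPoint (hσ : σ.1 ≠ σ.2) (x y : ℝ) : segY σ (segPoint σ x y) = y := by
  have h : σ.2 - σ.1 ≠ 0 := sub_ne_zero.2 hσ.symm
  rw [segY, segPoint, add_sub_cancel_left, mul_div_cancel_right₀ _ h]; simp

theorem coords_of_eq (hσ : σ.1 ≠ σ.2) {z : ℂ} {x y : ℝ} (h : z = segPoint σ x y) :
    segX σ z = x ∧ segY σ z = y := by
  rw [h]; exact ⟨segX_segPoint hσ x y, segY_segPoint hσ x y⟩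

theorem sub_eq_of_coords (hσ : σ.1 ≠ σ.2) (z w : ℂ) :
    z - w = ((segX σ z - segX σ w : ℝ) - (segY σ z - segY σ w : ℝ) * Complex.I) * (σ.2 - σ.1) := by
  conv_lhs => rw [← segPoint_segX_segY hσ z, ← segPoint_segX_segY hσ w]
  simp only [segPoint]; push_cast; ring

theorem abs_segX_sub_mul_le (hσ : σ.1 ≠ σ.2) (z w : ℂ) :
    |segX σ z - segX σ w| * ‖σ.2 - σ.1‖ ≤ dist z w := by
  rw [dist_eq_norm, sub_eq_of_coords hσ z w, norm_mul]
  apply mul_le_mul_of_nonneg_right _ (norm_nonneg (σ.2 - σ.1))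
  have := Complex.abs_re_le_norm
    (((segX σ z - segX σ w : ℝ) : ℂ) - (segY σ z - segY σ w : ℝ) * Complex.I)
  simpa using this

theorem abs_segY_sub_mul_le (hσ : σ.1 ≠ σ.2) (z w : ℂ) :
    |segY σ z - segY σ w| * ‖σ.2 - σ.1‖ ≤ dist z w := by
  rw [dist_eq_norm, sub_eq_of_coords hσ z w, norm_mul]
  apply mul_le_mul_of_nonneg_right _ (norm_nonneg (σ.2 - σ.1))
  have := Complex.abs_im_le_norm
    (((segX σ z - segX σ w : ℝ) : ℂ) - (segY σ z - segY σ w : ℝ) * Complex.I)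
  simpa [abs_sub_comm] using this

theorem dist_le_of_coords (hσ : σ.1 ≠ σ.2) (z w : ℂ) :
    dist z w ≤ (|segX σ z - segX σ w| + |segY σ z - segY σ w|) * ‖σ.2 - σ.1‖ := by
  rw [dist_eq_norm, sub_eq_of_coords hσ z w, norm_mul]
  gcongr
  refine (norm_sub_le _ _).trans ?_
  rw [norm_mul, Complex.norm_I, mul_one, Complex.norm_real, Complex.norm_real]
  simp [Real.norm_eq_abs]

/-! ### Half-planes and triangles in coordinates. -/

theorem convex_halfPlane (k p : ℂ) (c : ℝ) : Convex ℝ {z : ℂ | (k * (z - p)).re ≤ c} := by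
  intro x hx y hy a b ha hb hab
  simp only [mem_ofPred_eq] at hx hy ⊢
  have e : k * (a • x + b • y - p) = a • (k * (x - p)) + b • (k * (y - p)) := by
    simp only [Complex.real_smul]
    have h2 : (a : ℂ) + b = 1 := by exact_mod_cast hab
    linear_combination k * p * h2
  rw [e]
  simp only [Complex.add_re, Complex.smul_re, smul_eq_mul]
  calc a * (k * (x - p)).re + b * (k * (y - p)).re ≤ a * c + b * c := by gcongr
    _ = c := by rw [← add_mul, hab, one_mul]

/-- An interior point can be moved a little in the direction of the conjugate of `k`, which strictly
increases the linear function. -/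
theorem lt_of_mem_interior_halfPlane {k p z : ℂ} {c : ℝ} (hk : k ≠ 0)
    (hz : z ∈ interior {z : ℂ | (k * (z - p)).re ≤ c}) : (k * (z - p)).re < c := by
  obtain ⟨ε, hε, hball⟩ := Metric.isOpen_iff.1 isOpen_interior z hz
  have hk' : 0 < ‖k‖ := norm_pos_iff.2 hk
  set t : ℝ := ε / (2 * ‖k‖) with ht
  have htpos : 0 < t := by positivity
  have hmem : z + t * (starRingEnd ℂ) k ∈ Metric.ball z ε := by
    rw [Metric.mem_ball, dist_self_add_left, norm_mul, Complex.norm_real, RCLike.norm_conj,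
      Real.norm_of_nonneg htpos.le, ht]
    field_simp
    linarith
  have h1 := interior_subset (s := {z : ℂ | (k * (z - p)).re ≤ c}) (hball hmem)
  rw [mem_ofPred_eq] at h1
  have e : k * (z + t * (starRingEnd ℂ) k - p) = k * (z - p) + (t * ‖k‖ ^ 2 : ℝ) := by
    have := Complex.mul_conj' k
    push_cast
    linear_combination (t : ℂ) * this
  rw [e, Complex.add_re, Complex.ofReal_re] at h1
  have : 0 < t * ‖k‖ ^ 2 := by positivity
  linarith

/-- A linear function of the coordinates is the real part of a complex multiple of `z - σ.1`, the
form used for half-planes above. -/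
theorem lin_coords (A B : ℝ) (z : ℂ) :
    A * segX σ z + B * segY σ z = (((A + B * Complex.I) / (σ.2 - σ.1)) * (z - σ.1)).re := by
  rw [div_mul_eq_mul_div, mul_div_assoc]
  simp only [segX, segY, Complex.mul_re, Complex.add_re, Complex.add_im, Complex.ofReal_re,
    Complex.ofReal_im, Complex.mul_im, Complex.I_re, Complex.I_im]
  ring

theorem lin_le_of_mem_convexHull {S : Set ℂ} {A B c : ℝ}
    (h : ∀ z ∈ S, A * segX σ z + B * segY σ z ≤ c) {z : ℂ} (hz : z ∈ convexHull ℝ S) :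
    A * segX σ z + B * segY σ z ≤ c := by
  have := convexHull_min (fun z hz => (by
    have := h z hz
    rw [lin_coords] at this
    exact this : z ∈ {z : ℂ | (((A + B * Complex.I) / (σ.2 - σ.1)) * (z - σ.1)).re ≤ c}))
    (convex_halfPlane _ _ _) hz
  rw [lin_coords]
  exact this

theorem lin_lt_of_mem_interior_convexHull (hσ : σ.1 ≠ σ.2) {S : Set ℂ} {A B c : ℝ}
    (hAB : A ≠ 0 ∨ B ≠ 0) (h : ∀ z ∈ S, A * segX σ z + B * segY σ z ≤ c) {z : ℂ}
    (hz : z ∈ interior (convexHull ℝ S)) : A * segX σ z + B * segY σ z < c := by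
  rw [lin_coords]
  refine lt_of_mem_interior_halfPlane (div_ne_zero ?_ (sub_ne_zero.2 hσ.symm))
    (interior_mono (fun w hw => ?_) hz)
  · intro h0
    have h1 := congrArg Complex.re h0
    have h2 := congrArg Complex.im h0
    simp at h1 h2
    rcases hAB with h | h
    exacts [h h1, h h2]
  · have := lin_le_of_mem_convexHull h hw
    rwa [lin_coords] at this

/-- The interior of an isosceles triangle whose base lies on the segment `σ`. -/
theorem mem_interior_triangle_iff (hσ : σ.1 ≠ σ.2) {b H : ℝ} (hb : 0 < b) (hH : H ≠ 0) {z : ℂ} :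
    z ∈ interior (convexHull ℝ {segPoint σ (1 / 2 - b) 0, segPoint σ (1 / 2) H,
      segPoint σ (1 / 2 + b) 0}) ↔
    0 < segY σ z / H ∧ segX σ z - 1 / 2 < b * (1 - segY σ z / H) ∧
      1 / 2 - segX σ z < b * (1 - segY σ z / H) := by
  constructor
  · intro hz
    refine ⟨?_, ?_, ?_⟩
    · have := lin_lt_of_mem_interior_convexHull (A := 0) (B := -1 / H) (c := 0) hσ
        (Or.inr (div_ne_zero (by norm_num) hH)) (by
        rintro w (rfl | rfl | rfl)
        · simp [segX_segPoint hσ, segY_segPoint hσ]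
        · rw [segX_segPoint hσ, segY_segPoint hσ, div_mul_cancel₀ _ hH]; norm_num
        · simp [segX_segPoint hσ, segY_segPoint hσ]) hz
      rw [div_eq_inv_mul]
      rw [zero_mul, zero_add, neg_div, neg_mul, one_div] at this
      linarith
    · have := lin_lt_of_mem_interior_convexHull (A := 1) (B := b / H) (c := 1 / 2 + b) hσ
        (Or.inl one_ne_zero) (by
        rintro w (rfl | rfl | rfl)
        · rw [segX_segPoint hσ, segY_segPoint hσ]; linarith
        · rw [segX_segPoint hσ, segY_segPoint hσ, div_mul_cancel₀ _ hH]; linarith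
        · rw [segX_segPoint hσ, segY_segPoint hσ]; linarith) hz
      have e : b / H * segY σ z = b * (segY σ z / H) := by ring
      linarith
    · have := lin_lt_of_mem_interior_convexHull (A := -1) (B := b / H) (c := -1 / 2 + b) hσ
        (Or.inl (by norm_num)) (by
        rintro w (rfl | rfl | rfl)
        · rw [segX_segPoint hσ, segY_segPoint hσ]; linarith
        · rw [segX_segPoint hσ, segY_segPoint hσ, div_mul_cancel₀ _ hH]; linarith
        · rw [segX_segPoint hσ, segY_segPoint hσ]; linarith) hz
      have e : b / H * segY σ z = b * (segY σ z / H) := by ring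
      linarith
  · intro hz
    set S : Set ℂ := {segPoint σ (1 / 2 - b) 0, segPoint σ (1 / 2) H, segPoint σ (1 / 2 + b) 0}
    have hopen : IsOpen {z : ℂ | 0 < segY σ z / H ∧ segX σ z - 1 / 2 < b * (1 - segY σ z / H) ∧
      1 / 2 - segX σ z < b * (1 - segY σ z / H)} := by
      have hX := continuous_segX (σ := σ)
      have hY := continuous_segY (σ := σ)
      refine IsOpen.and (isOpen_lt ?_ ?_) (IsOpen.and (isOpen_lt ?_ ?_) (isOpen_lt ?_ ?_)) <;>
        fun_prop
    refine interior_maximal ?_ hopen hz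
    rintro w ⟨h1, h2, h3⟩
    set τ := segY σ w / H with hτ
    set v := (segX σ w - 1 / 2) / b with hv
    have hX : segX σ w = 1 / 2 + b * v := by rw [hv]; field_simp; ring
    have hY : segY σ w = τ * H := by rw [hτ]; field_simp
    have hv1 : v < 1 - τ := by
      rw [hv, div_lt_iff₀ hb]; linarith
    have hv2 : -v < 1 - τ := by
      rw [hv, ← neg_div, div_lt_iff₀ hb]; linarith
    -- Barycentric coordinates; the three inequalities say that the weights are positive.
    have hw : w = ((1 - τ - v) / 2) • segPoint σ (1 / 2 - b) 0 + τ • segPoint σ (1 / 2) H +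
        ((1 - τ + v) / 2) • segPoint σ (1 / 2 + b) 0 := by
      conv_lhs => rw [← segPoint_segX_segY hσ w, hX, hY]
      simp only [segPoint, Complex.real_smul]; push_cast; ring
    rw [hw]
    have key := (convex_convexHull ℝ S).sum_mem (t := (Finset.univ : Finset (Fin 3)))
      (w := ![(1 - τ - v) / 2, τ, (1 - τ + v) / 2])
      (z := ![segPoint σ (1 / 2 - b) 0, segPoint σ (1 / 2) H, segPoint σ (1 / 2 + b) 0])
      (by
        intro i _
        fin_cases i
        · simp; linarith
        · exact h1.le
        · simp; linarith)
      (by simp [Fin.sum_univ_three]; ring)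
      (by
        intro i _
        apply subset_convexHull
        fin_cases i <;> simp [S])
    simpa [Fin.sum_univ_three] using key

end Coordinates

/-! ### One step of the construction in coordinates -/

section OneStep

variable {σ : ℂ × ℂ} {α : ℝ}

/-- The height of the spike over a segment of length `1`. -/
def spikeHeight (α : ℝ) : ℝ := √(1 - 2 * α) / 2

theorem spikeHeight_pos (h1 : α < 1 / 2) : 0 < spikeHeight α := by
  have : 0 < √(1 - 2 * α) := Real.sqrt_pos.2 (by linarith)
  unfold spikeHeight; positivity

theorem spikeHeight_sq (h1 : α < 1 / 2) : spikeHeight α ^ 2 = (1 - 2 * α) / 4 := by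
  rw [spikeHeight, div_pow, Real.sq_sqrt (by linarith)]; norm_num

theorem spikeHeight_lt (h0 : 0 < α) (h1 : α < 1 / 2) : spikeHeight α < (1 - α) / 2 := by
  refine lt_of_pow_lt_pow_left₀ 2 (by linarith) ?_
  rw [spikeHeight_sq h1]; nlinarith

theorem baseLeft_eq : baseLeft α σ = segPoint σ (1 / 2 - α / 2) 0 := by
  simp only [baseLeft, segPoint]; push_cast; ring

theorem baseRight_eq : baseRight α σ = segPoint σ (1 / 2 + α / 2) 0 := by
  simp only [baseRight, segPoint]; push_cast; ring

theorem spikeTip_eq : spikeTip α σ = segPoint σ (1 / 2) (spikeHeight α) := by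
  simp only [spikeTip, segPoint, spikeHeight]; push_cast; ring

/-- The open triangle of a spike, without its base. -/
def spikeInterior (α : ℝ) (σ : ℂ × ℂ) : Set ℂ :=
  interior (convexHull ℝ {baseLeft α σ, spikeTip α σ, baseRight α σ})

/-- The open base of a spike. -/
def spikeBase (α : ℝ) (σ : ℂ × ℂ) : Set ℂ := openSegment ℝ (baseLeft α σ) (baseRight α σ)

theorem mem_spikeInterior_iff (hσ : σ.1 ≠ σ.2) (h0 : 0 < α) (h1 : α < 1 / 2) {z : ℂ} :
    z ∈ spikeInterior α σ ↔ 0 < segY σ z ∧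
      2 * spikeHeight α * (segX σ z - 1 / 2) < α * (spikeHeight α - segY σ z) ∧
      2 * spikeHeight α * (1 / 2 - segX σ z) < α * (spikeHeight α - segY σ z) := by
  have hη := spikeHeight_pos h1
  rw [spikeInterior, baseLeft_eq, baseRight_eq, spikeTip_eq,
    mem_interior_triangle_iff hσ (by positivity) hη.ne', div_pos_iff_of_pos_right hη]
  have key : ∀ x : ℝ, x < α / 2 * (1 - segY σ z / spikeHeight α) ↔
      2 * spikeHeight α * x < α * (spikeHeight α - segY σ z) := by
    intro x
    have e : α / 2 * (1 - segY σ z / spikeHeight α) =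
      α * (spikeHeight α - segY σ z) / (2 * spikeHeight α) := by field_simp
    rw [e, lt_div_iff₀ (by positivity), mul_comm x]
  rw [key, key]

theorem mem_spikeBase_iff (hσ : σ.1 ≠ σ.2) (h0 : 0 < α) {z : ℂ} :
    z ∈ spikeBase α σ ↔ segY σ z = 0 ∧ (1 - α) / 2 < segX σ z ∧ segX σ z < (1 + α) / 2 := by
  rw [spikeBase, baseLeft_eq, baseRight_eq, openSegment_eq_image]
  constructor
  · rintro ⟨θ, hθ, rfl⟩
    have e : (1 - θ) • segPoint σ (1 / 2 - α / 2) 0 + θ • segPoint σ (1 / 2 + α / 2) 0 =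
        segPoint σ (1 / 2 - α / 2 + θ * α) 0 := by
      simp only [segPoint, Complex.real_smul]; push_cast; ring
    simp only
    rw [e, segX_segPoint hσ, segY_segPoint hσ]
    have h1 := hθ.1; have h2 := hθ.2
    refine ⟨rfl, by nlinarith, by nlinarith⟩
  · rintro ⟨hY, h1, h2⟩
    refine ⟨(segX σ z - (1 - α) / 2) / α, ⟨div_pos (by linarith) h0, ?_⟩, ?_⟩
    · rw [div_lt_one h0]; linarith
    · conv_rhs => rw [← segPoint_segX_segY hσ z, hY]
      have hα : (α : ℂ) ≠ 0 := by exact_mod_cast h0.ne'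
      simp only [segPoint, Complex.real_smul]; push_cast; field_simp; ring

theorem spike_eq : spike α σ = spikeInterior α σ ∪ spikeBase α σ := rfl

theorem mem_spike_iff (hσ : σ.1 ≠ σ.2) (h0 : 0 < α) (h1 : α < 1 / 2) {z : ℂ} :
    z ∈ spike α σ ↔ 0 ≤ segY σ z ∧
      2 * spikeHeight α * (segX σ z - 1 / 2) < α * (spikeHeight α - segY σ z) ∧
      2 * spikeHeight α * (1 / 2 - segX σ z) < α * (spikeHeight α - segY σ z) := by
  have hη := spikeHeight_pos h1
  rw [spike_eq, mem_union, mem_spikeInterior_iff hσ h0 h1, mem_spikeBase_iff hσ h0]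
  constructor
  · rintro (⟨h, h'⟩ | ⟨h, h2, h3⟩)
    · exact ⟨h.le, h'⟩
    · rw [h, sub_zero]
      exact ⟨le_rfl, by nlinarith, by nlinarith⟩
  · rintro ⟨h, h2, h3⟩
    rcases h.eq_or_lt with h | h
    · rw [← h, sub_zero] at h2 h3
      refine Or.inr ⟨h.symm, ?_, ?_⟩
      · by_contra hc; nlinarith
      · by_contra hc; nlinarith
    · exact Or.inl ⟨h, h2, h3⟩

/-- The frame of `τ` arises from that of `σ` by a translation and multiplication by `u - v i`. Every
inclusion between tents and spikes below is a set of inequalities in such coordinates. -/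
theorem coords_of_sub {τ : ℂ × ℂ} {p q u v : ℝ} (hσ : σ.1 ≠ σ.2) (h1 : τ.1 = segPoint σ p q)
    (h2 : τ.2 - τ.1 = (u - v * Complex.I) * (σ.2 - σ.1)) (huv : 0 < u ^ 2 + v ^ 2) :
    τ.1 ≠ τ.2 ∧ ‖τ.2 - τ.1‖ = √(u ^ 2 + v ^ 2) * ‖σ.2 - σ.1‖ ∧
      ∀ z, segX σ z = p + segX τ z * u - segY τ z * v ∧
        segY σ z = q + segX τ z * v + segY τ z * u := by
  have hn : ‖((u : ℂ) - v * Complex.I)‖ = √(u ^ 2 + v ^ 2) := by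
    rw [Complex.norm_eq_sqrt_sq_add_sq]; simp
  have hτn : ‖τ.2 - τ.1‖ = √(u ^ 2 + v ^ 2) * ‖σ.2 - σ.1‖ := by rw [h2, norm_mul, hn]
  have hτ : τ.1 ≠ τ.2 := by
    intro h
    rw [h, sub_self, norm_zero] at hτn
    have : 0 < √(u ^ 2 + v ^ 2) * ‖σ.2 - σ.1‖ :=
      mul_pos (Real.sqrt_pos.2 huv) (norm_pos_iff.2 (sub_ne_zero.2 hσ.symm))
    linarith
  refine ⟨hτ, hτn, fun z => coords_of_eq hσ ?_⟩
  conv_lhs => rw [← segPoint_segX_segY hτ z]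
  rw [segPoint, h2, h1]
  simp only [segPoint]
  push_cast
  linear_combination (segY τ z : ℂ) * v * (σ.2 - σ.1) * Complex.I_sq

theorem kochChild_zero_coords (hσ : σ.1 ≠ σ.2) (h1 : α < 1 / 2) :
    (kochChild α σ 0).1 ≠ (kochChild α σ 0).2 ∧
    ‖(kochChild α σ 0).2 - (kochChild α σ 0).1‖ = (1 - α) / 2 * ‖σ.2 - σ.1‖ ∧
      ∀ z, segX σ z = (1 - α) / 2 * segX (kochChild α σ 0) z ∧
        segY σ z = (1 - α) / 2 * segY (kochChild α σ 0) z := by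
  have := coords_of_sub (τ := kochChild α σ 0) (p := 0) (q := 0) (u := (1 - α) / 2) (v := 0) hσ
    (by simp [kochChild, segPoint]) (by simp [kochChild, baseLeft]) (by
      have : 0 < (1 - α) / 2 := by linarith
      positivity)
  refine ⟨this.1, ?_, fun z => ?_⟩
  · rw [this.2.1, show ((1 - α) / 2) ^ 2 + (0 : ℝ) ^ 2 = ((1 - α) / 2) ^ 2 by ring,
      Real.sqrt_sq (by linarith)]
  · obtain ⟨e1, e2⟩ := this.2.2 z
    exact ⟨by rw [e1]; ring, by rw [e2]; ring⟩

theorem kochChild_three_coords (hσ : σ.1 ≠ σ.2) (h1 : α < 1 / 2) :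
    (kochChild α σ 3).1 ≠ (kochChild α σ 3).2 ∧
    ‖(kochChild α σ 3).2 - (kochChild α σ 3).1‖ = (1 - α) / 2 * ‖σ.2 - σ.1‖ ∧
      ∀ z, segX σ z = (1 + α) / 2 + (1 - α) / 2 * segX (kochChild α σ 3) z ∧
        segY σ z = (1 - α) / 2 * segY (kochChild α σ 3) z := by
  have := coords_of_sub (τ := kochChild α σ 3) (p := (1 + α) / 2) (q := 0) (u := (1 - α) / 2)
    (v := 0) hσ (by simp [kochChild, segPoint, baseRight])
    (by simp [kochChild, baseRight]; ring) (by
      have : 0 < (1 - α) / 2 := by linarith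
      positivity)
  refine ⟨this.1, ?_, fun z => ?_⟩
  · rw [this.2.1, show ((1 - α) / 2) ^ 2 + (0 : ℝ) ^ 2 = ((1 - α) / 2) ^ 2 by ring,
      Real.sqrt_sq (by linarith)]
  · obtain ⟨e1, e2⟩ := this.2.2 z
    exact ⟨by rw [e1]; ring, by rw [e2]; ring⟩

/-- The sides of the spike have the same length as the two outer children; the height of the spike
is chosen for this. -/
theorem sqrt_slope (h1 : α < 1 / 2) : √((α / 2) ^ 2 + spikeHeight α ^ 2) = (1 - α) / 2 := by
  rw [spikeHeight_sq h1, show (α / 2) ^ 2 + (1 - 2 * α) / 4 = ((1 - α) / 2) ^ 2 by ring,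
    Real.sqrt_sq (by linarith)]

theorem kochChild_one_coords (hσ : σ.1 ≠ σ.2) (h1 : α < 1 / 2) :
    (kochChild α σ 1).1 ≠ (kochChild α σ 1).2 ∧
    ‖(kochChild α σ 1).2 - (kochChild α σ 1).1‖ = (1 - α) / 2 * ‖σ.2 - σ.1‖ ∧
      ∀ z, segX σ z = (1 - α) / 2 + segX (kochChild α σ 1) z * (α / 2) -
          segY (kochChild α σ 1) z * spikeHeight α ∧
        segY σ z = segX (kochChild α σ 1) z * spikeHeight α +
          segY (kochChild α σ 1) z * (α / 2) := by
  have := coords_of_sub (τ := kochChild α σ 1) (p := (1 - α) / 2) (q := 0) (u := α / 2)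
    (v := spikeHeight α) hσ (by simp [kochChild, segPoint, baseLeft])
    (by simp only [kochChild, baseLeft, spikeTip, spikeHeight]; simp; ring) (by
      have := spikeHeight_pos h1
      positivity)
  refine ⟨this.1, ?_, fun z => ?_⟩
  · rw [this.2.1, sqrt_slope h1]
  · obtain ⟨e1, e2⟩ := this.2.2 z
    exact ⟨e1, by rw [e2]; ring⟩

theorem kochChild_two_coords (hσ : σ.1 ≠ σ.2) (h1 : α < 1 / 2) :
    (kochChild α σ 2).1 ≠ (kochChild α σ 2).2 ∧
    ‖(kochChild α σ 2).2 - (kochChild α σ 2).1‖ = (1 - α) / 2 * ‖σ.2 - σ.1‖ ∧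
      ∀ z, segX σ z = 1 / 2 + segX (kochChild α σ 2) z * (α / 2) +
          segY (kochChild α σ 2) z * spikeHeight α ∧
        segY σ z = (1 - segX (kochChild α σ 2) z) * spikeHeight α +
          segY (kochChild α σ 2) z * (α / 2) := by
  have := coords_of_sub (τ := kochChild α σ 2) (p := 1 / 2) (q := spikeHeight α) (u := α / 2)
    (v := -spikeHeight α) hσ (by simp [kochChild, spikeTip_eq])
    (by simp only [kochChild, baseRight, spikeTip, spikeHeight]; simp; ring) (by
      have := spikeHeight_pos h1
      rw [neg_sq]
      positivity)
  refine ⟨this.1, ?_, fun z => ?_⟩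
  · rw [this.2.1, neg_sq, sqrt_slope h1]
  · obtain ⟨e1, e2⟩ := this.2.2 z
    exact ⟨by rw [e1]; ring, by rw [e2]; ring⟩

theorem kochChild_ne (hσ : σ.1 ≠ σ.2) (h1 : α < 1 / 2) (c : Fin 4) :
    (kochChild α σ c).1 ≠ (kochChild α σ c).2 := by
  fin_cases c
  exacts [(kochChild_zero_coords hσ h1).1, (kochChild_one_coords hσ h1).1,
    (kochChild_two_coords hσ h1).1, (kochChild_three_coords hσ h1).1]

theorem norm_kochChild (hσ : σ.1 ≠ σ.2) (h1 : α < 1 / 2) (c : Fin 4) :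
    ‖(kochChild α σ c).2 - (kochChild α σ c).1‖ = (1 - α) / 2 * ‖σ.2 - σ.1‖ := by
  fin_cases c
  exacts [(kochChild_zero_coords hσ h1).2.1, (kochChild_one_coords hσ h1).2.1,
    (kochChild_two_coords hσ h1).2.1, (kochChild_three_coords hσ h1).2.1]

/-! ### The right isosceles triangle over a segment -/

/-- The closed right isosceles triangle over the segment `σ`, outside of the domain. -/
def closedTent (σ : ℂ × ℂ) : Set ℂ := {z | 0 ≤ segY σ z ∧ segY σ z ≤ segX σ z ∧ segX σ z + segY σ z ≤ 1}

/-- The right isosceles triangle over the segment `σ` without its two equal sides. -/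
def tent (σ : ℂ × ℂ) : Set ℂ := {z | 0 ≤ segY σ z ∧ segY σ z < segX σ z ∧ segX σ z + segY σ z < 1}

theorem tent_subset_closedTent : tent σ ⊆ closedTent σ := fun _ h => ⟨h.1, h.2.1.le, h.2.2.le⟩

theorem isClosed_closedTent : IsClosed (closedTent σ) := by
  have hX := continuous_segX (σ := σ)
  have hY := continuous_segY (σ := σ)
  refine IsClosed.and (isClosed_le ?_ ?_) (IsClosed.and (isClosed_le ?_ ?_) (isClosed_le ?_ ?_)) <;>
    fun_prop

theorem spike_subset_tent (hσ : σ.1 ≠ σ.2) (h0 : 0 < α) (h1 : α < 1 / 2) :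
    spike α σ ⊆ tent σ := by
  intro z hz
  obtain ⟨h, h2, h3⟩ := (mem_spike_iff hσ h0 h1).1 hz
  have hη := spikeHeight_pos h1
  have hη2 := spikeHeight_lt h0 h1
  have hYη : segY σ z < spikeHeight α := by nlinarith
  refine ⟨h, ?_, ?_⟩ <;> by_contra hc <;> nlinarith

/-- The critical points are the right-angled corners of the tents over the sides of the spike, whose
gaps `X - Y` and `1 - X - Y` to the sides of the large tent are `(1 - α) / 2 - spikeHeight α`. This
is positive by `spikeHeight_lt`. -/
theorem tent_kochChild_subset (hσ : σ.1 ≠ σ.2) (h0 : 0 < α) (h1 : α < 1 / 2) (c : Fin 4) :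
    tent (kochChild α σ c) ⊆ tent σ := by
  have hη := spikeHeight_pos h1
  have hη2 := spikeHeight_lt h0 h1
  rintro z ⟨hy, hyx, hxy⟩
  fin_cases c
  · obtain ⟨e1, e2⟩ := (kochChild_zero_coords hσ h1).2.2 z
    simp only [Fin.zero_eta] at hy hyx hxy
    refine ⟨?_, ?_, ?_⟩ <;> rw [e2] <;> try rw [e1]
    · have : 0 ≤ (1 - α) / 2 := by linarith
      positivity
    · nlinarith
    · nlinarith
  · obtain ⟨e1, e2⟩ := (kochChild_one_coords hσ h1).2.2 z
    simp only [Fin.mk_one] at hy hyx hxy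
    refine ⟨?_, ?_, ?_⟩ <;> rw [e2] <;> try rw [e1]
    · have : 0 ≤ segX (kochChild α σ 1) z := by linarith
      positivity
    · nlinarith
    · nlinarith
  · obtain ⟨e1, e2⟩ := (kochChild_two_coords hσ h1).2.2 z
    simp only [Fin.reduceFinMk] at hy hyx hxy
    refine ⟨?_, ?_, ?_⟩ <;> rw [e2] <;> try rw [e1]
    · have : 0 ≤ 1 - segX (kochChild α σ 2) z := by linarith
      positivity
    · nlinarith
    · nlinarith
  · obtain ⟨e1, e2⟩ := (kochChild_three_coords hσ h1).2.2 z
    simp only [Fin.reduceFinMk] at hy hyx hxy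
    refine ⟨?_, ?_, ?_⟩ <;> rw [e2] <;> try rw [e1]
    · have : 0 ≤ (1 - α) / 2 := by linarith
      positivity
    · nlinarith
    · nlinarith

theorem closedTent_kochChild_subset (hσ : σ.1 ≠ σ.2) (h0 : 0 < α) (h1 : α < 1 / 2) (c : Fin 4) :
    closedTent (kochChild α σ c) ⊆ closedTent σ := by
  have hη := spikeHeight_pos h1
  have hη2 := spikeHeight_lt h0 h1
  rintro z ⟨hy, hyx, hxy⟩
  fin_cases c
  · obtain ⟨e1, e2⟩ := (kochChild_zero_coords hσ h1).2.2 z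
    simp only [Fin.zero_eta] at hy hyx hxy
    refine ⟨?_, ?_, ?_⟩ <;> rw [e2] <;> try rw [e1]
    · have : 0 ≤ (1 - α) / 2 := by linarith
      positivity
    · nlinarith
    · nlinarith
  · obtain ⟨e1, e2⟩ := (kochChild_one_coords hσ h1).2.2 z
    simp only [Fin.mk_one] at hy hyx hxy
    refine ⟨?_, ?_, ?_⟩ <;> rw [e2] <;> try rw [e1]
    · have : 0 ≤ segX (kochChild α σ 1) z := by linarith
      positivity
    · nlinarith
    · nlinarith
  · obtain ⟨e1, e2⟩ := (kochChild_two_coords hσ h1).2.2 z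
    simp only [Fin.reduceFinMk] at hy hyx hxy
    refine ⟨?_, ?_, ?_⟩ <;> rw [e2] <;> try rw [e1]
    · have : 0 ≤ 1 - segX (kochChild α σ 2) z := by linarith
      positivity
    · nlinarith
    · nlinarith
  · obtain ⟨e1, e2⟩ := (kochChild_three_coords hσ h1).2.2 z
    simp only [Fin.reduceFinMk] at hy hyx hxy
    refine ⟨?_, ?_, ?_⟩ <;> rw [e2] <;> try rw [e1]
    · have : 0 ≤ (1 - α) / 2 := by linarith
      positivity
    · nlinarith
    · nlinarith

/-- The lines `X + Y = (1 - α) / 2`, `X = 1 / 2` and `X - Y = (1 + α) / 2`, together with the sides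
of the spike, separate the four tents from each other and from the spike. The region lemmas place
each set on its side of these lines, strictly for tents without their equal sides and for spikes. -/
theorem closedTent_zero_region (hσ : σ.1 ≠ σ.2) (h1 : α < 1 / 2) {z : ℂ}
    (hz : z ∈ closedTent (kochChild α σ 0)) :
    segX σ z + segY σ z ≤ (1 - α) / 2 ∧ segX σ z ≤ (1 - α) / 2 := by
  obtain ⟨hy, hyx, hxy⟩ := hz
  obtain ⟨e1, e2⟩ := (kochChild_zero_coords hσ h1).2.2 z
  rw [e1, e2]
  constructor <;> nlinarith

theorem closedTent_three_region (hσ : σ.1 ≠ σ.2) (h1 : α < 1 / 2) {z : ℂ}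
    (hz : z ∈ closedTent (kochChild α σ 3)) :
    (1 + α) / 2 ≤ segX σ z - segY σ z ∧ (1 + α) / 2 ≤ segX σ z := by
  obtain ⟨hy, hyx, hxy⟩ := hz
  obtain ⟨e1, e2⟩ := (kochChild_three_coords hσ h1).2.2 z
  rw [e1, e2]
  constructor <;> nlinarith

theorem closedTent_one_region (hσ : σ.1 ≠ σ.2) (h0 : 0 < α) (h1 : α < 1 / 2) {z : ℂ}
    (hz : z ∈ closedTent (kochChild α σ 1)) :
    (1 - α) / 2 ≤ segX σ z + segY σ z ∧ segX σ z ≤ 1 / 2 ∧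
      α * (spikeHeight α - segY σ z) ≤ 2 * spikeHeight α * (1 / 2 - segX σ z) := by
  obtain ⟨hy, hyx, hxy⟩ := hz
  obtain ⟨e1, e2⟩ := (kochChild_one_coords hσ h1).2.2 z
  have hη := spikeHeight_pos h1
  have hηsq := spikeHeight_sq h1
  rw [e1, e2]
  refine ⟨by nlinarith, by nlinarith, ?_⟩
  have : 0 ≤ segY (kochChild α σ 1) z * (α ^ 2 / 2 + 2 * spikeHeight α ^ 2) := by positivity
  linarith

theorem closedTent_two_region (hσ : σ.1 ≠ σ.2) (h0 : 0 < α) (h1 : α < 1 / 2) {z : ℂ}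
    (hz : z ∈ closedTent (kochChild α σ 2)) :
    segX σ z - segY σ z ≤ (1 + α) / 2 ∧ 1 / 2 ≤ segX σ z ∧
      α * (spikeHeight α - segY σ z) ≤ 2 * spikeHeight α * (segX σ z - 1 / 2) := by
  obtain ⟨hy, hyx, hxy⟩ := hz
  obtain ⟨e1, e2⟩ := (kochChild_two_coords hσ h1).2.2 z
  have hη := spikeHeight_pos h1
  have hηsq := spikeHeight_sq h1
  rw [e1, e2]
  refine ⟨by nlinarith, by nlinarith, ?_⟩
  have : 0 ≤ segY (kochChild α σ 2) z * (α ^ 2 / 2 + 2 * spikeHeight α ^ 2) := by positivity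
  linarith

theorem tent_zero_region (hσ : σ.1 ≠ σ.2) (h1 : α < 1 / 2) {z : ℂ}
    (hz : z ∈ tent (kochChild α σ 0)) : segX σ z + segY σ z < (1 - α) / 2 := by
  obtain ⟨hy, hyx, hxy⟩ := hz
  obtain ⟨e1, e2⟩ := (kochChild_zero_coords hσ h1).2.2 z
  rw [e1, e2]
  nlinarith

theorem tent_three_region (hσ : σ.1 ≠ σ.2) (h1 : α < 1 / 2) {z : ℂ}
    (hz : z ∈ tent (kochChild α σ 3)) : (1 + α) / 2 < segX σ z - segY σ z := by
  obtain ⟨hy, hyx, hxy⟩ := hz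
  obtain ⟨e1, e2⟩ := (kochChild_three_coords hσ h1).2.2 z
  rw [e1, e2]
  nlinarith

theorem tent_one_region (hσ : σ.1 ≠ σ.2) (h0 : 0 < α) (h1 : α < 1 / 2) {z : ℂ}
    (hz : z ∈ tent (kochChild α σ 1)) :
    (1 - α) / 2 < segX σ z + segY σ z ∧ segX σ z < 1 / 2 ∧ 0 < segY σ z := by
  obtain ⟨hy, hyx, hxy⟩ := hz
  obtain ⟨e1, e2⟩ := (kochChild_one_coords hσ h1).2.2 z
  have hη := spikeHeight_pos h1
  rw [e1, e2]
  refine ⟨by nlinarith, by nlinarith, by nlinarith⟩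

theorem tent_two_region (hσ : σ.1 ≠ σ.2) (h0 : 0 < α) (h1 : α < 1 / 2) {z : ℂ}
    (hz : z ∈ tent (kochChild α σ 2)) :
    segX σ z - segY σ z < (1 + α) / 2 ∧ 1 / 2 < segX σ z ∧ 0 < segY σ z := by
  obtain ⟨hy, hyx, hxy⟩ := hz
  obtain ⟨e1, e2⟩ := (kochChild_two_coords hσ h1).2.2 z
  have hη := spikeHeight_pos h1
  rw [e1, e2]
  refine ⟨by nlinarith, by nlinarith, by nlinarith⟩

theorem spike_region (hσ : σ.1 ≠ σ.2) (h0 : 0 < α) (h1 : α < 1 / 2) {z : ℂ}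
    (hz : z ∈ spike α σ) : (1 - α) / 2 < segX σ z + segY σ z ∧
      segX σ z - segY σ z < (1 + α) / 2 := by
  obtain ⟨h, h2, h3⟩ := (mem_spike_iff hσ h0 h1).1 hz
  have hη := spikeHeight_pos h1
  constructor <;> by_contra hc <;> nlinarith

/-- One tent is closed so that the statement also applies to limits of a branch: they do not reach
the branch over another child. -/
theorem disjoint_closedTent_tent (hσ : σ.1 ≠ σ.2) (h0 : 0 < α) (h1 : α < 1 / 2) {c c' : Fin 4}
    (hc : c ≠ c') : Disjoint (closedTent (kochChild α σ c)) (tent (kochChild α σ c')) := by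
  refine Set.disjoint_left.2 fun z hz hz' => ?_
  fin_cases c <;> fin_cases c' <;> simp only [Fin.zero_eta, Fin.mk_one, Fin.reduceFinMk] at hz hz' hc
  all_goals first
    | exact hc rfl
    | skip
  · linarith [closedTent_zero_region hσ h1 hz, tent_one_region hσ h0 h1 hz']
  · linarith [closedTent_zero_region hσ h1 hz, tent_two_region hσ h0 h1 hz']
  · linarith [closedTent_zero_region hσ h1 hz,
      closedTent_three_region hσ h1 (tent_subset_closedTent hz')]
  · linarith [closedTent_one_region hσ h0 h1 hz, tent_zero_region hσ h1 hz']
  · linarith [closedTent_one_region hσ h0 h1 hz, tent_two_region hσ h0 h1 hz']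
  · linarith [closedTent_one_region hσ h0 h1 hz,
      closedTent_three_region hσ h1 (tent_subset_closedTent hz')]
  · linarith [closedTent_two_region hσ h0 h1 hz,
      closedTent_zero_region hσ h1 (tent_subset_closedTent hz')]
  · linarith [closedTent_two_region hσ h0 h1 hz, tent_one_region hσ h0 h1 hz']
  · linarith [closedTent_two_region hσ h0 h1 hz, tent_three_region hσ h1 hz']
  · linarith [closedTent_three_region hσ h1 hz,
      closedTent_zero_region hσ h1 (tent_subset_closedTent hz')]
  · linarith [closedTent_three_region hσ h1 hz, tent_one_region hσ h0 h1 hz']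
  · linarith [closedTent_three_region hσ h1 hz, tent_two_region hσ h0 h1 hz']

theorem disjoint_closedTent_spike (hσ : σ.1 ≠ σ.2) (h0 : 0 < α) (h1 : α < 1 / 2) (c : Fin 4) :
    Disjoint (closedTent (kochChild α σ c)) (spike α σ) := by
  refine Set.disjoint_left.2 fun z hz hz' => ?_
  obtain ⟨h, h2, h3⟩ := (mem_spike_iff hσ h0 h1).1 hz'
  have h4 := spike_region hσ h0 h1 hz'
  fin_cases c <;> simp only [Fin.zero_eta, Fin.mk_one, Fin.reduceFinMk] at hz
  · linarith [closedTent_zero_region hσ h1 hz]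
  · linarith [closedTent_one_region hσ h0 h1 hz]
  · linarith [closedTent_two_region hσ h0 h1 hz]
  · linarith [closedTent_three_region hσ h1 hz]

/-! ### Sets that lie along the left of a segment -/

/-- The set `H` lies on the left of the line of `σ` and contains all points on the left of `σ`
that are close to an inner point of `σ`. -/
def LeftOf (H : Set ℂ) (σ : ℂ × ℂ) : Prop :=
  (∀ z ∈ H, segY σ z < 0) ∧
    ∀ x ∈ Ioo (0 : ℝ) 1, ∀ᶠ z in 𝓝 (segPoint σ x 0), segY σ z < 0 → z ∈ H

/-- The segment `τ` is contained in the segment `σ`, and has the same direction. -/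
def IsSubsegment (τ σ : ℂ × ℂ) : Prop :=
  ∃ p l : ℝ, 0 ≤ p ∧ 0 < l ∧ p + l ≤ 1 ∧ ‖τ.2 - τ.1‖ = l * ‖σ.2 - σ.1‖ ∧
    ∀ z, segX σ z = p + l * segX τ z ∧ segY σ z = l * segY τ z

theorem IsSubsegment.refl (σ : ℂ × ℂ) : IsSubsegment σ σ :=
  ⟨0, 1, le_rfl, one_pos, by simp, by simp, fun z => by simp⟩

theorem IsSubsegment.trans {υ τ : ℂ × ℂ} (h : IsSubsegment υ τ) (h' : IsSubsegment τ σ) :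
    IsSubsegment υ σ := by
  obtain ⟨p, l, hp, hl, hpl, hn, h⟩ := h
  obtain ⟨p', l', hp', hl', hpl', hn', h'⟩ := h'
  refine ⟨p' + l' * p, l' * l, by positivity, by positivity, by nlinarith, ?_, fun z => ?_⟩
  · rw [hn, hn']; ring
  · rw [(h' z).1, (h' z).2, (h z).1, (h z).2]
    constructor <;> ring

theorem isSubsegment_zero (hσ : σ.1 ≠ σ.2) (h0 : 0 < α) (h1 : α < 1 / 2) :
    IsSubsegment (kochChild α σ 0) σ := by
  obtain ⟨-, hn, h⟩ := kochChild_zero_coords hσ h1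
  exact ⟨0, (1 - α) / 2, le_rfl, by linarith, by linarith, hn, fun z => by
    rw [(h z).1, (h z).2]; simp⟩

theorem isSubsegment_three (hσ : σ.1 ≠ σ.2) (h1 : α < 1 / 2) (h0 : 0 < α) :
    IsSubsegment (kochChild α σ 3) σ := by
  obtain ⟨-, hn, h⟩ := kochChild_three_coords hσ h1
  exact ⟨(1 + α) / 2, (1 - α) / 2, by linarith, by linarith, by linarith, hn, h⟩

theorem LeftOf.mono {H : Set ℂ} {τ : ℂ × ℂ} (h : LeftOf H σ) (hσ : σ.1 ≠ σ.2) (hτ : τ.1 ≠ τ.2)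
    (hτσ : IsSubsegment τ σ) : LeftOf H τ := by
  obtain ⟨p, l, hp, hl, hpl, -, hc⟩ := hτσ
  refine ⟨fun z hz => ?_, fun x hx => ?_⟩
  · have := h.1 z hz
    rw [(hc z).2] at this
    by_contra hcon
    rw [not_lt] at hcon
    exact absurd this (not_lt.2 (by positivity))
  · have e : segPoint τ x 0 = segPoint σ (p + l * x) 0 := by
      rw [← segPoint_segX_segY hσ (segPoint τ x 0), (hc _).1, (hc _).2, segX_segPoint hτ,
        segY_segPoint hτ, mul_zero]
    rw [e]
    have hx' : p + l * x ∈ Ioo (0 : ℝ) 1 := by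
      have h1 := hx.1; have h2 := hx.2
      constructor
      · positivity
      · nlinarith
    filter_upwards [h.2 _ hx'] with z hz hY
    refine hz ?_
    rw [(hc z).2]
    exact mul_neg_of_pos_of_neg hl hY

/-- Near an inner point of this side the other two sides of the spike are at positive distance, so
only the sign of the coordinate across this side decides. -/
theorem leftOf_one (hσ : σ.1 ≠ σ.2) (h0 : 0 < α) (h1 : α < 1 / 2) :
    LeftOf (spikeInterior α σ) (kochChild α σ 1) := by
  obtain ⟨hτ, -, hc⟩ := kochChild_one_coords hσ h1
  have hη := spikeHeight_pos h1
  have hX := continuous_segX (σ := kochChild α σ 1)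
  have hY := continuous_segY (σ := kochChild α σ 1)
  refine ⟨fun z hz => ?_, fun x hx => ?_⟩
  · obtain ⟨-, -, h⟩ := (mem_spikeInterior_iff hσ h0 h1).1 hz
    obtain ⟨e1, e2⟩ := hc z
    rw [e1, e2] at h
    by_contra hcon
    rw [not_lt] at hcon
    have : 0 ≤ segY (kochChild α σ 1) z * (α ^ 2 / 2 + 2 * spikeHeight α ^ 2) := by positivity
    linarith
  · have c1 : ∀ᶠ z in 𝓝 (segPoint (kochChild α σ 1) x 0), 0 <
        segX (kochChild α σ 1) z * spikeHeight α + segY (kochChild α σ 1) z * (α / 2) := by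
      refine (by fun_prop : Continuous fun z => segX (kochChild α σ 1) z * spikeHeight α +
        segY (kochChild α σ 1) z * (α / 2)).continuousAt.eventually (lt_mem_nhds ?_)
      beta_reduce
      rw [segX_segPoint hτ, segY_segPoint hτ]
      have := hx.1
      nlinarith
    -- The inequality for the opposite side of the spike in the frame of this side. At the point
    -- itself it reads `0 < 2 α η (1 - x)` with `η` the height.
    have c2 : ∀ᶠ z in 𝓝 (segPoint (kochChild α σ 1) x 0),
        0 < 2 * α * spikeHeight α * (1 - segX (kochChild α σ 1) z) +
          segY (kochChild α σ 1) z * (spikeHeight α ^ 2 * 2 - α ^ 2 / 2) := by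
      refine (by fun_prop : Continuous fun z => 2 * α * spikeHeight α * (1 - segX (kochChild α σ 1) z) +
          segY (kochChild α σ 1) z * (spikeHeight α ^ 2 * 2 - α ^ 2 / 2)).continuousAt.eventually
          (lt_mem_nhds ?_)
      beta_reduce
      rw [segX_segPoint hτ, segY_segPoint hτ, zero_mul, add_zero]
      have := hx.2
      have : 0 < 1 - x := by linarith
      positivity
    filter_upwards [c1, c2] with z h2 h3 hYz
    refine (mem_spikeInterior_iff hσ h0 h1).2 ?_
    obtain ⟨e1, e2⟩ := hc z
    rw [e1, e2]
    have h4 : 0 < -segY (kochChild α σ 1) z * (α ^ 2 / 2 + 2 * spikeHeight α ^ 2) := by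
      have : 0 < -segY (kochChild α σ 1) z := by linarith
      positivity
    have h5 : 0 < α * spikeHeight α := by positivity
    refine ⟨h2, ?_, ?_⟩
    · linarith
    · linarith

theorem leftOf_two (hσ : σ.1 ≠ σ.2) (h0 : 0 < α) (h1 : α < 1 / 2) :
    LeftOf (spikeInterior α σ) (kochChild α σ 2) := by
  obtain ⟨hτ, -, hc⟩ := kochChild_two_coords hσ h1
  have hη := spikeHeight_pos h1
  have hX := continuous_segX (σ := kochChild α σ 2)
  have hY := continuous_segY (σ := kochChild α σ 2)
  refine ⟨fun z hz => ?_, fun x hx => ?_⟩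
  · obtain ⟨-, h, -⟩ := (mem_spikeInterior_iff hσ h0 h1).1 hz
    obtain ⟨e1, e2⟩ := hc z
    rw [e1, e2] at h
    by_contra hcon
    rw [not_lt] at hcon
    have : 0 ≤ segY (kochChild α σ 2) z * (α ^ 2 / 2 + 2 * spikeHeight α ^ 2) := by positivity
    linarith
  · have c1 : ∀ᶠ z in 𝓝 (segPoint (kochChild α σ 2) x 0), 0 <
        (1 - segX (kochChild α σ 2) z) * spikeHeight α + segY (kochChild α σ 2) z * (α / 2) := by
      refine (by fun_prop : Continuous fun z => (1 - segX (kochChild α σ 2) z) * spikeHeight α +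
        segY (kochChild α σ 2) z * (α / 2)).continuousAt.eventually (lt_mem_nhds ?_)
      beta_reduce
      rw [segX_segPoint hτ, segY_segPoint hτ]
      have := hx.2
      nlinarith
    have c2 : ∀ᶠ z in 𝓝 (segPoint (kochChild α σ 2) x 0),
        0 < 2 * α * spikeHeight α * segX (kochChild α σ 2) z +
          segY (kochChild α σ 2) z * (spikeHeight α ^ 2 * 2 - α ^ 2 / 2) := by
      refine (by fun_prop : Continuous fun z => 2 * α * spikeHeight α * segX (kochChild α σ 2) z +
          segY (kochChild α σ 2) z * (spikeHeight α ^ 2 * 2 - α ^ 2 / 2)).continuousAt.eventually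
          (lt_mem_nhds ?_)
      beta_reduce
      rw [segX_segPoint hτ, segY_segPoint hτ, zero_mul, add_zero]
      have := hx.1
      positivity
    filter_upwards [c1, c2] with z h2 h3 hYz
    refine (mem_spikeInterior_iff hσ h0 h1).2 ?_
    obtain ⟨e1, e2⟩ := hc z
    rw [e1, e2]
    have h4 : 0 < -segY (kochChild α σ 2) z * (α ^ 2 / 2 + 2 * spikeHeight α ^ 2) := by
      have : 0 < -segY (kochChild α σ 2) z := by linarith
      positivity
    have h5 : 0 < α * spikeHeight α := by positivity
    refine ⟨h2, ?_, ?_⟩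
    · linarith
    · linarith

/-- Inner points of `σ` are limits of points of a set along the left of `σ`. -/
theorem LeftOf.mem_closure {H : Set ℂ} (h : LeftOf H σ) (hσ : σ.1 ≠ σ.2) {x : ℝ}
    (hx : x ∈ Ioo (0 : ℝ) 1) : segPoint σ x 0 ∈ closure H := by
  have hcont : Continuous fun y : ℝ => segPoint σ x y := by unfold segPoint; fun_prop
  have hlim : Tendsto (fun y : ℝ => segPoint σ x y) (𝓝[<] 0) (𝓝 (segPoint σ x 0)) :=
    (hcont.tendsto 0).mono_left nhdsWithin_le_nhds
  refine mem_closure_of_tendsto hlim ?_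
  filter_upwards [hlim.eventually (h.2 x hx), self_mem_nhdsWithin] with y hy hy0
  exact hy (by rw [segY_segPoint hσ]; exact hy0)

end OneStep

/-! ### The tree of segments -/

section Tree

/-- `z` lies in one of the spikes over the segment `σ` of step `k` or over one of its
descendants. -/
inductive KochBranch (s α₁ : ℝ) : ℕ → ℂ × ℂ → ℂ → Prop
  | spike {k : ℕ} {σ : ℂ × ℂ} {z : ℂ} (h : z ∈ spike (kochRatio s α₁ (k + 1)) σ) :
      KochBranch s α₁ k σ z
  | child {k : ℕ} {σ : ℂ × ℂ} {z : ℂ} (c : Fin 4)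
      (h : KochBranch s α₁ (k + 1) (kochChild (kochRatio s α₁ (k + 1)) σ c) z) :
      KochBranch s α₁ k σ z

/-- `σ` is a segment of step `k`. -/
inductive IsKochSegment (s α₁ : ℝ) : ℕ → ℂ × ℂ → Prop
  | side (j : Fin 3) : IsKochSegment s α₁ 0 (triangleSide j)
  | child {k : ℕ} {σ : ℂ × ℂ} (c : Fin 4) (h : IsKochSegment s α₁ k σ) :
      IsKochSegment s α₁ (k + 1) (kochChild (kochRatio s α₁ (k + 1)) σ c)

/-- The part of the domain that is reached through the base of the spike over `σ`: this spike
and the branches over its two sides. -/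
def KochPiece (s α₁ : ℝ) (k : ℕ) (σ : ℂ × ℂ) (z : ℂ) : Prop :=
  z ∈ spike (kochRatio s α₁ (k + 1)) σ ∨
    KochBranch s α₁ (k + 1) (kochChild (kochRatio s α₁ (k + 1)) σ 1) z ∨
    KochBranch s α₁ (k + 1) (kochChild (kochRatio s α₁ (k + 1)) σ 2) z

variable {s α₁ : ℝ} {k : ℕ} {σ : ℂ × ℂ} {z : ℂ}

theorem KochPiece.branch (h : KochPiece s α₁ k σ z) : KochBranch s α₁ k σ z := by
  rcases h with h | h | h
  exacts [.spike h, .child 1 h, .child 2 h]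

theorem isKochSegment_kochSegment (j : Fin 3) (a : ℕ → Fin 4) :
    ∀ k, IsKochSegment s α₁ k (kochSegment s α₁ j a k)
  | 0 => .side j
  | k + 1 => .child (a k) (isKochSegment_kochSegment j a k)

theorem kochSegment_congr {j : Fin 3} {a b : ℕ → Fin 4} :
    ∀ {k : ℕ}, (∀ i < k, a i = b i) → kochSegment s α₁ j a k = kochSegment s α₁ j b k
  | 0, _ => rfl
  | k + 1, h => by
    simp only [kochSegment]
    rw [kochSegment_congr fun i hi => h i (by omega), h k (by omega)]

theorem IsKochSegment.exists_address (h : IsKochSegment s α₁ k σ) :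
    ∃ j a, σ = kochSegment s α₁ j a k := by
  induction h with
  | side j => exact ⟨j, 0, rfl⟩
  | @child k σ c h ih =>
    obtain ⟨j, a, rfl⟩ := ih
    refine ⟨j, Function.update a k c, ?_⟩
    simp only [kochSegment, Function.update_self]
    rw [kochSegment_congr (a := Function.update a k c) (b := a)
      fun i hi => Function.update_of_ne hi.ne _ _]

/-- The open triangle `Ω_0`. -/
def kochTriangle : Set ℂ := interior (convexHull ℝ {0, 1, apex})

theorem KochBranch.of_kochSegment {j : Fin 3} {a : ℕ → Fin 4} :
    ∀ {k : ℕ}, KochBranch s α₁ k (kochSegment s α₁ j a k) z →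
      KochBranch s α₁ 0 (triangleSide j) z
  | 0, h => h
  | k + 1, h => KochBranch.of_kochSegment (k := k) (.child (a k) h)

theorem KochBranch.mem_snowflake (h : KochBranch s α₁ k σ z) (hσ : IsKochSegment s α₁ k σ) :
    z ∈ snowflake s α₁ := by
  induction h with
  | @spike k σ z h =>
    obtain ⟨j, a, rfl⟩ := hσ.exists_address
    exact mem_iUnion.2 ⟨k + 1, Or.inr (mem_iUnion₂.2 ⟨j, a, h⟩)⟩
  | child c h ih => exact ih (.child c hσ)

/-- This replaces the union over steps and addresses by the inductive predicate, on which the later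
proofs by induction run. -/
theorem mem_snowflake_iff :
    z ∈ snowflake s α₁ ↔ z ∈ kochTriangle ∨ ∃ j, KochBranch s α₁ 0 (triangleSide j) z := by
  constructor
  · intro hz
    obtain ⟨k, hk⟩ := mem_iUnion.1 hz
    induction k with
    | zero => exact Or.inl hk
    | succ k ih =>
      rcases hk with hk | hk
      · exact ih hk
      · obtain ⟨j, a, h⟩ := mem_iUnion₂.1 hk
        exact Or.inr ⟨j, KochBranch.of_kochSegment (.spike h)⟩
  · rintro (h | ⟨j, h⟩)
    · exact mem_iUnion.2 ⟨0, h⟩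
    · exact h.mem_snowflake (.side j)

theorem kochTriangle_subset : kochTriangle ⊆ snowflake s α₁ := fun _ h =>
  mem_snowflake_iff.2 (Or.inl h)

/-! ### The initial triangle -/

theorem sqrt_three_sq : (√3 : ℝ) ^ 2 = 3 := Real.sq_sqrt (by norm_num)

theorem apex_sq : apex ^ 2 = apex - 1 := by
  have h : ((√3 : ℝ) : ℂ) ^ 2 = 3 := by exact_mod_cast sqrt_three_sq
  simp only [apex]; push_cast
  linear_combination (Complex.I ^ 2 / 4) * h + (3 / 4) * Complex.I_sq

theorem norm_apex : ‖apex‖ = 1 := by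
  rw [Complex.norm_eq_sqrt_sq_add_sq]
  have : apex.re ^ 2 + apex.im ^ 2 = 1 := by
    simp [apex, div_pow]; norm_num
  rw [this, Real.sqrt_one]

theorem norm_triangleSide (j : Fin 3) : ‖(triangleSide j).2 - (triangleSide j).1‖ = 1 := by
  fin_cases j
  · simp [triangleSide]
  · simp only [triangleSide, Fin.mk_one, Matrix.cons_val_one, Matrix.cons_val_zero]
    rw [← apex_sq, norm_pow, norm_apex, one_pow]
  · simp [triangleSide, norm_apex]

theorem triangleSide_ne (j : Fin 3) : (triangleSide j).1 ≠ (triangleSide j).2 := by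
  intro h
  have := norm_triangleSide j
  rw [h, sub_self, norm_zero] at this
  exact zero_ne_one this

/-- The triangle looks the same from all three sides, by `apex ^ 2 = apex - 1`. It lies on the left
of each side, hence the negative height. -/
theorem mem_kochTriangle_iff (j : Fin 3) : z ∈ kochTriangle ↔
    0 < segY (triangleSide j) z / (-(√3 / 2)) ∧
      segX (triangleSide j) z - 1 / 2 < 1 / 2 * (1 - segY (triangleSide j) z / (-(√3 / 2))) ∧
      1 / 2 - segX (triangleSide j) z < 1 / 2 * (1 - segY (triangleSide j) z / (-(√3 / 2))) := by
  rw [← mem_interior_triangle_iff (triangleSide_ne j) (by norm_num) (by simp), kochTriangle]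
  have e : ∀ σ : ℂ × ℂ, ({segPoint σ (1 / 2 - 1 / 2) 0, segPoint σ (1 / 2) (-(√3 / 2)),
      segPoint σ (1 / 2 + 1 / 2) 0} : Set ℂ) = {σ.1, σ.1 + apex * (σ.2 - σ.1), σ.2} := by
    intro σ
    congr 1
    · simp [segPoint]
    congr 1
    · simp only [segPoint, apex]; push_cast; ring
    · simp only [segPoint]; push_cast; congr 1; ring
  rw [e]
  congr! 2
  fin_cases j
  · simp only [triangleSide, Fin.zero_eta, Matrix.cons_val_zero]
    rw [sub_zero, mul_one, zero_add, pair_comm 1 apex]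
  · simp only [triangleSide, Fin.mk_one, Matrix.cons_val_one, Matrix.cons_val_zero]
    rw [show 1 + apex * (apex - 1) = 0 by linear_combination apex_sq, insert_comm]
  · simp only [triangleSide, Fin.reduceFinMk, Matrix.cons_val]
    rw [show apex + apex * (0 - apex) = 1 by linear_combination -apex_sq,
      insert_comm 0 1, pair_comm 0 apex, insert_comm]

theorem leftOf_kochTriangle (j : Fin 3) : LeftOf kochTriangle (triangleSide j) := by
  have h3 : 0 < √3 / 2 := by positivity
  have hX := continuous_segX (σ := triangleSide j)
  have hY := continuous_segY (σ := triangleSide j)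
  have hdiv : ∀ z, 0 < segY (triangleSide j) z / (-(√3 / 2)) ↔ segY (triangleSide j) z < 0 :=
    fun z => by rw [div_neg, ← neg_div, div_pos_iff_of_pos_right h3, neg_pos]
  refine ⟨fun z hz => (hdiv z).1 ((mem_kochTriangle_iff j).1 hz).1, fun x hx => ?_⟩
  have c1 : ∀ᶠ z in 𝓝 (segPoint (triangleSide j) x 0), segX (triangleSide j) z - 1 / 2 <
      1 / 2 * (1 - segY (triangleSide j) z / (-(√3 / 2))) := by
    refine (isOpen_lt (f := fun z => segX (triangleSide j) z - 1 / 2)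
      (g := fun z => 1 / 2 * (1 - segY (triangleSide j) z / (-(√3 / 2))))
      (by fun_prop) (by fun_prop)).eventually_mem ?_
    rw [mem_ofPred_eq, segX_segPoint (triangleSide_ne j), segY_segPoint (triangleSide_ne j)]
    have := hx.2
    rw [zero_div]; linarith
  have c2 : ∀ᶠ z in 𝓝 (segPoint (triangleSide j) x 0), 1 / 2 - segX (triangleSide j) z <
      1 / 2 * (1 - segY (triangleSide j) z / (-(√3 / 2))) := by
    refine (isOpen_lt (f := fun z => 1 / 2 - segX (triangleSide j) z)
      (g := fun z => 1 / 2 * (1 - segY (triangleSide j) z / (-(√3 / 2))))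
      (by fun_prop) (by fun_prop)).eventually_mem ?_
    rw [mem_ofPred_eq, segX_segPoint (triangleSide_ne j), segY_segPoint (triangleSide_ne j)]
    have := hx.1
    rw [zero_div]; linarith
  filter_upwards [c1, c2] with z h1 h2 h
  exact (mem_kochTriangle_iff j).2 ⟨(hdiv z).2 h, h1, h2⟩

theorem triangleSide_zero_coords (z : ℂ) :
    z.re = segX (triangleSide 0) z ∧ z.im = -segY (triangleSide 0) z := by
  simp [segX, segY, triangleSide]

theorem triangleSide_one_coords (z : ℂ) :
    z.re = 1 - segX (triangleSide 1) z / 2 + segY (triangleSide 1) z * (√3 / 2) ∧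
      z.im = segX (triangleSide 1) z * (√3 / 2) + segY (triangleSide 1) z / 2 := by
  have h := segPoint_segX_segY (triangleSide_ne 1) z
  have h1 := congrArg Complex.re h
  have h2 := congrArg Complex.im h
  rw [← h1, ← h2]
  simp only [segPoint, triangleSide, apex, Matrix.cons_val_one, Matrix.cons_val_zero]
  simp
  constructor <;> ring

theorem triangleSide_two_coords (z : ℂ) :
    z.re = (1 - segX (triangleSide 2) z) / 2 - segY (triangleSide 2) z * (√3 / 2) ∧
      z.im = (1 - segX (triangleSide 2) z) * (√3 / 2) + segY (triangleSide 2) z / 2 := by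
  have h := segPoint_segX_segY (triangleSide_ne 2) z
  have h1 := congrArg Complex.re h
  have h2 := congrArg Complex.im h
  rw [← h1, ← h2]
  simp only [segPoint, triangleSide, apex, Matrix.cons_val]
  simp
  constructor <;> ring

/-- The base angles of the tents are 45 degrees, so neighbouring tents meet only in a vertex of the
triangle, which `tent` omits. -/
theorem disjoint_closedTent_tent_side {i j : Fin 3} (hij : i ≠ j) :
    Disjoint (closedTent (triangleSide i)) (tent (triangleSide j)) := by
  have h3 : 0 < √3 / 2 := by positivity
  refine Set.disjoint_left.2 fun z hz hz' => ?_
  obtain ⟨a1, a2, a3⟩ := hz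
  obtain ⟨b1, b2, b3⟩ := hz'
  obtain ⟨e0, f0⟩ := triangleSide_zero_coords z
  obtain ⟨e1, f1⟩ := triangleSide_one_coords z
  obtain ⟨e2, f2⟩ := triangleSide_two_coords z
  set t := √3 / 2
  fin_cases i <;> fin_cases j <;>
    simp only [Fin.zero_eta, Fin.mk_one, Fin.reduceFinMk] at a1 a2 a3 b1 b2 b3 hij
  all_goals first
    | exact hij rfl
    | skip
  · nlinarith
  · nlinarith
  · have h1 : segX (triangleSide 1) z * t ≤ 0 := by linarith
    have h2 := nonpos_of_mul_nonpos_left h1 h3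
    nlinarith
  · nlinarith
  · have h1 : (1 - segX (triangleSide 2) z) * t ≤ 0 := by linarith
    have h2 := nonpos_of_mul_nonpos_left h1 h3
    nlinarith
  · nlinarith

end Tree

/-! ### The domain and the tents -/

section Domain

variable {s α₁ : ℝ} {k : ℕ} {σ : ℂ × ℂ} {z : ℂ}

theorem IsKochSegment.norm_eq (hs₁ : s < 1 / 2) (hα₀ : 0 < α₁) (hα₁ : α₁ < 1 / 2)
    (h : IsKochSegment s α₁ k σ) : σ.1 ≠ σ.2 ∧ ‖σ.2 - σ.1‖ = kochLength s α₁ k := by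
  induction h with
  | side j => exact ⟨triangleSide_ne j, by simp [norm_triangleSide, kochLength]⟩
  | @child k σ c h ih =>
    have h1 := kochRatio_lt_half hs₁ hα₀ hα₁ k
    refine ⟨kochChild_ne ih.1 h1 c, ?_⟩
    rw [norm_kochChild ih.1 h1, ih.2, kochLength_succ s (by linarith)]; ring

theorem KochBranch.mem_tent (hs₁ : s < 1 / 2) (hα₀ : 0 < α₁) (hα₁ : α₁ < 1 / 2)
    (hz : KochBranch s α₁ k σ z) (hσ : σ.1 ≠ σ.2) : z ∈ tent σ := by
  induction hz with
  | @spike k σ z h =>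
    exact spike_subset_tent hσ (kochRatio_pos hα₀ hα₁ k) (kochRatio_lt_half hs₁ hα₀ hα₁ k) h
  | @child k σ z c h ih =>
    exact tent_kochChild_subset hσ (kochRatio_pos hα₀ hα₁ k) (kochRatio_lt_half hs₁ hα₀ hα₁ k) c
      (ih (kochChild_ne hσ (kochRatio_lt_half hs₁ hα₀ hα₁ k) c))

/-- Inside the closed tent of a segment, the domain consists of the branch over this segment. -/
theorem IsKochSegment.branch_of_mem_closedTent (hs₁ : s < 1 / 2) (hα₀ : 0 < α₁)
    (hα₁ : α₁ < 1 / 2) (hσ : IsKochSegment s α₁ k σ) (hz : z ∈ snowflake s α₁)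
    (hzσ : z ∈ closedTent σ) : KochBranch s α₁ k σ z := by
  induction hσ with
  | side j =>
    rcases mem_snowflake_iff.1 hz with h | ⟨i, h⟩
    · exact absurd hzσ.1 (not_le.2 ((leftOf_kochTriangle j).1 z h))
    · by_cases hij : j = i
      · rwa [hij]
      · exact absurd (h.mem_tent hs₁ hα₀ hα₁ (triangleSide_ne i))
          (Set.disjoint_left.1 (disjoint_closedTent_tent_side hij) hzσ)
  | @child k σ c h ih =>
    have hne := (h.norm_eq hs₁ hα₀ hα₁).1
    have h0 := kochRatio_pos (s := s) hα₀ hα₁ k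
    have h1 := kochRatio_lt_half hs₁ hα₀ hα₁ k
    cases ih (closedTent_kochChild_subset hne h0 h1 c hzσ) with
    | spike h' => exact absurd h' (Set.disjoint_left.1 (disjoint_closedTent_spike hne h0 h1 c) hzσ)
    | child c' h' =>
      by_cases hcc : c = c'
      · rwa [hcc]
      · exact absurd (h'.mem_tent hs₁ hα₀ hα₁ (kochChild_ne hne h1 c'))
          (Set.disjoint_left.1 (disjoint_closedTent_tent hne h0 h1 hcc) hzσ)

theorem IsKochSegment.notMem_snowflake (hs₁ : s < 1 / 2) (hα₀ : 0 < α₁)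
    (hα₁ : α₁ < 1 / 2) (hσ : IsKochSegment s α₁ k σ) (hzσ : z ∈ closedTent σ)
    (hz : z ∉ tent σ) : z ∉ snowflake s α₁ := fun h =>
  hz ((hσ.branch_of_mem_closedTent hs₁ hα₀ hα₁ h hzσ).mem_tent hs₁ hα₀ hα₁
    (hσ.norm_eq hs₁ hα₀ hα₁).1)

theorem IsKochSegment.fst_notMem (hs₁ : s < 1 / 2) (hα₀ : 0 < α₁) (hα₁ : α₁ < 1 / 2)
    (hσ : IsKochSegment s α₁ k σ) : σ.1 ∉ snowflake s α₁ := by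
  refine hσ.notMem_snowflake hs₁ hα₀ hα₁ ?_ ?_ <;> simp [closedTent, tent, segX, segY]

/-- The two lines through the ends of the base separate the piece from the tents over the first and
the last child. Within the domain, weak inequalities therefore suffice to describe the piece, and it
is relatively closed. -/
theorem IsKochSegment.kochPiece_iff (hs₁ : s < 1 / 2) (hα₀ : 0 < α₁) (hα₁ : α₁ < 1 / 2)
    (hσ : IsKochSegment s α₁ k σ) : KochPiece s α₁ k σ z ↔ z ∈ snowflake s α₁ ∧
      z ∈ closedTent σ ∧ (1 - kochRatio s α₁ (k + 1)) / 2 ≤ segX σ z + segY σ z ∧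
      segX σ z - segY σ z ≤ (1 + kochRatio s α₁ (k + 1)) / 2 := by
  have hne := (hσ.norm_eq hs₁ hα₀ hα₁).1
  have h0 := kochRatio_pos (s := s) hα₀ hα₁ k
  have h1 := kochRatio_lt_half hs₁ hα₀ hα₁ k
  constructor
  · intro h
    refine ⟨h.branch.mem_snowflake hσ, tent_subset_closedTent (h.branch.mem_tent hs₁ hα₀ hα₁ hne), ?_⟩
    rcases h with h | h | h
    · have := spike_region hne h0 h1 h
      exact ⟨this.1.le, this.2.le⟩
    · have ht := h.mem_tent hs₁ hα₀ hα₁ (kochChild_ne hne h1 _)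
      have := tent_one_region hne h0 h1 ht
      constructor <;> linarith
    · have ht := h.mem_tent hs₁ hα₀ hα₁ (kochChild_ne hne h1 _)
      have := tent_two_region hne h0 h1 ht
      constructor <;> linarith
  · rintro ⟨hz, hzσ, h2, h3⟩
    cases hσ.branch_of_mem_closedTent hs₁ hα₀ hα₁ hz hzσ with
    | spike h => exact Or.inl h
    | child c h =>
      have ht := h.mem_tent hs₁ hα₀ hα₁ (kochChild_ne hne h1 c)
      fin_cases c <;> simp only [Fin.zero_eta, Fin.mk_one, Fin.reduceFinMk] at h ht
      · linarith [tent_zero_region hne h1 ht]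
      · exact Or.inr (Or.inl h)
      · exact Or.inr (Or.inr h)
      · linarith [tent_three_region hne h1 ht]

theorem IsKochSegment.kochPiece_closed (hs₁ : s < 1 / 2) (hα₀ : 0 < α₁) (hα₁ : α₁ < 1 / 2)
    (hσ : IsKochSegment s α₁ k σ) :
    ∃ K, IsClosed K ∧ {z | KochPiece s α₁ k σ z} = snowflake s α₁ ∩ K := by
  have hX := continuous_segX (σ := σ)
  have hY := continuous_segY (σ := σ)
  refine ⟨closedTent σ ∩ {z | (1 - kochRatio s α₁ (k + 1)) / 2 ≤ segX σ z + segY σ z ∧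
      segX σ z - segY σ z ≤ (1 + kochRatio s α₁ (k + 1)) / 2}, ?_, ?_⟩
  · refine isClosed_closedTent.inter (IsClosed.and (isClosed_le ?_ ?_) (isClosed_le ?_ ?_)) <;>
      fun_prop
  · ext z
    exact hσ.kochPiece_iff hs₁ hα₀ hα₁

/-- Off the base all the inequalities that bound the piece are strict, so the base is the only way
out. -/
theorem KochPiece.mem_spikeBase_or_pos (hs₁ : s < 1 / 2) (hα₀ : 0 < α₁) (hα₁ : α₁ < 1 / 2)
    (hne : σ.1 ≠ σ.2) (h : KochPiece s α₁ k σ z) :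
    z ∈ spikeBase (kochRatio s α₁ (k + 1)) σ ∨ (0 < segY σ z ∧
      (1 - kochRatio s α₁ (k + 1)) / 2 < segX σ z + segY σ z ∧
      segX σ z - segY σ z < (1 + kochRatio s α₁ (k + 1)) / 2) := by
  have h0 := kochRatio_pos (s := s) hα₀ hα₁ k
  have h1 := kochRatio_lt_half hs₁ hα₀ hα₁ k
  rcases h with h | h | h
  · have hr := spike_region hne h0 h1 h
    rcases h with h | h
    · exact Or.inr ⟨((mem_spikeInterior_iff hne h0 h1).1 h).1, hr⟩
    · exact Or.inl h
  · have ht := h.mem_tent hs₁ hα₀ hα₁ (kochChild_ne hne h1 _)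
    have := tent_one_region hne h0 h1 ht
    refine Or.inr ⟨?_, ?_, ?_⟩ <;> linarith
  · have ht := h.mem_tent hs₁ hα₀ hα₁ (kochChild_ne hne h1 _)
    have := tent_two_region hne h0 h1 ht
    refine Or.inr ⟨?_, ?_, ?_⟩ <;> linarith

theorem IsKochSegment.kochPiece_open (hs₁ : s < 1 / 2) (hα₀ : 0 < α₁) (hα₁ : α₁ < 1 / 2)
    (hσ : IsKochSegment s α₁ k σ) : ∃ V, IsOpen V ∧
      {z | KochPiece s α₁ k σ z} \ spikeBase (kochRatio s α₁ (k + 1)) σ = snowflake s α₁ ∩ V := by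
  have hX := continuous_segX (σ := σ)
  have hY := continuous_segY (σ := σ)
  have hne := (hσ.norm_eq hs₁ hα₀ hα₁).1
  refine ⟨{z | (0 < segY σ z ∧ segY σ z < segX σ z ∧ segX σ z + segY σ z < 1) ∧
    (1 - kochRatio s α₁ (k + 1)) / 2 < segX σ z + segY σ z ∧
      segX σ z - segY σ z < (1 + kochRatio s α₁ (k + 1)) / 2}, ?_, ?_⟩
  · refine IsOpen.and (IsOpen.and (isOpen_lt ?_ ?_) (IsOpen.and (isOpen_lt ?_ ?_)
      (isOpen_lt ?_ ?_))) (IsOpen.and (isOpen_lt ?_ ?_) (isOpen_lt ?_ ?_)) <;> fun_prop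
  · ext z
    constructor
    · rintro ⟨h, hB⟩
      have h : KochPiece s α₁ k σ z := h
      have ht := h.branch.mem_tent hs₁ hα₀ hα₁ hne
      obtain h' := (h.mem_spikeBase_or_pos hs₁ hα₀ hα₁ hne).resolve_left hB
      exact ⟨h.branch.mem_snowflake hσ, ⟨h'.1, ht.2⟩, h'.2⟩
    · rintro ⟨hz, ⟨h1, h2⟩, h3, h4⟩
      refine ⟨(hσ.kochPiece_iff hs₁ hα₀ hα₁).2 ⟨hz, tent_subset_closedTent ⟨h1.le, h2⟩, h3.le, h4.le⟩,
        fun hB => ?_⟩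
      rw [((mem_spikeBase_iff hne (kochRatio_pos hα₀ hα₁ k)).1 hB).1] at h1
      exact lt_irrefl _ h1

/-! ### The convex sets of which the domain consists -/

/-- The open triangle `Ω_0` and the open triangles of the spikes. -/
def IsKochRoom (s α₁ : ℝ) (H : Set ℂ) : Prop :=
  H = kochTriangle ∨ ∃ k σ, IsKochSegment s α₁ k σ ∧ H = spikeInterior (kochRatio s α₁ (k + 1)) σ

theorem IsKochRoom.convex {H : Set ℂ} (h : IsKochRoom s α₁ H) : Convex ℝ H := by
  rcases h with rfl | ⟨k, σ, -, rfl⟩ <;> exact (convex_convexHull ℝ _).interior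

theorem IsKochRoom.isOpen {H : Set ℂ} (h : IsKochRoom s α₁ H) : IsOpen H := by
  rcases h with rfl | ⟨k, σ, -, rfl⟩ <;> exact isOpen_interior

theorem IsKochRoom.subset {H : Set ℂ} (h : IsKochRoom s α₁ H) : H ⊆ snowflake s α₁ := by
  rcases h with rfl | ⟨k, σ, hσ, rfl⟩
  · exact kochTriangle_subset
  · exact fun z hz => (KochBranch.spike (Or.inl hz)).mem_snowflake hσ

/-- The outer children keep the room of their parent; the two sides of the spike have the spike as
their room. -/
theorem IsKochSegment.exists_room (hs₁ : s < 1 / 2) (hα₀ : 0 < α₁) (hα₁ : α₁ < 1 / 2)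
    (hσ : IsKochSegment s α₁ k σ) : ∃ H, IsKochRoom s α₁ H ∧ LeftOf H σ := by
  induction hσ with
  | side j => exact ⟨_, Or.inl rfl, leftOf_kochTriangle j⟩
  | @child k σ c h ih =>
    have hne := (h.norm_eq hs₁ hα₀ hα₁).1
    have h0 := kochRatio_pos (s := s) hα₀ hα₁ k
    have h1 := kochRatio_lt_half hs₁ hα₀ hα₁ k
    obtain ⟨H, hH, hHσ⟩ := ih
    fin_cases c
    · exact ⟨H, hH, hHσ.mono hne (kochChild_ne hne h1 0) (isSubsegment_zero hne h0 h1)⟩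
    · exact ⟨_, Or.inr ⟨k, σ, h, rfl⟩, leftOf_one hne h0 h1⟩
    · exact ⟨_, Or.inr ⟨k, σ, h, rfl⟩, leftOf_two hne h0 h1⟩
    · exact ⟨H, hH, hHσ.mono hne (kochChild_ne hne h1 3) (isSubsegment_three hne h1 h0)⟩

/-- Only points of the base of a spike need an argument. A neighbourhood of such a point is filled
by the spike on one side and by the room along the left of the segment on the other. -/
theorem isOpen_snowflake (hs₁ : s < 1 / 2) (hα₀ : 0 < α₁) (hα₁ : α₁ < 1 / 2) :
    IsOpen (snowflake s α₁) := by
  have key : ∀ k σ z, KochBranch s α₁ k σ z → IsKochSegment s α₁ k σ → snowflake s α₁ ∈ 𝓝 z := by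
    intro k σ z hz
    induction hz with
    | @spike k σ z h =>
      intro hσ
      have hne := (hσ.norm_eq hs₁ hα₀ hα₁).1
      have h0 := kochRatio_pos (s := s) hα₀ hα₁ k
      have h1 := kochRatio_lt_half hs₁ hα₀ hα₁ k
      have hroom : IsKochRoom s α₁ (spikeInterior (kochRatio s α₁ (k + 1)) σ) :=
        Or.inr ⟨k, σ, hσ, rfl⟩
      rcases h with h | h
      · exact mem_of_superset (hroom.isOpen.mem_nhds h) hroom.subset
      · obtain ⟨H, hH, hHσ⟩ := hσ.exists_room hs₁ hα₀ hα₁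
        obtain ⟨hY, hX1, hX2⟩ := (mem_spikeBase_iff hne h0).1 h
        have hz : segPoint σ (segX σ z) 0 = z := by
          rw [← hY]; exact segPoint_segX_segY hne z
        have e1 := hHσ.2 (segX σ z) ⟨by linarith, by linarith⟩
        rw [hz] at e1
        have hcX := continuous_segX (σ := σ)
        have hcY := continuous_segY (σ := σ)
        obtain ⟨-, h2, h3⟩ := (mem_spike_iff hne h0 h1).1 (Or.inr h)
        have e2 := (isOpen_lt (f := fun w => 2 * spikeHeight (kochRatio s α₁ (k + 1)) *
          (segX σ w - 1 / 2)) (g := fun w => kochRatio s α₁ (k + 1) *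
          (spikeHeight (kochRatio s α₁ (k + 1)) - segY σ w)) (by fun_prop) (by fun_prop)).eventually_mem h2
        have e3 := (isOpen_lt (f := fun w => 2 * spikeHeight (kochRatio s α₁ (k + 1)) *
          (1 / 2 - segX σ w)) (g := fun w => kochRatio s α₁ (k + 1) *
          (spikeHeight (kochRatio s α₁ (k + 1)) - segY σ w)) (by fun_prop) (by fun_prop)).eventually_mem h3
        filter_upwards [e1, e2, e3] with w hw1 hw2 hw3
        rcases lt_or_ge (segY σ w) 0 with hw | hw
        · exact hH.subset (hw1 hw)
        · exact (KochBranch.spike ((mem_spike_iff hne h0 h1).2 ⟨hw, hw2, hw3⟩)).mem_snowflake hσ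
    | child c h ih => exact fun hσ => ih (.child c hσ)
  rw [isOpen_iff_mem_nhds]
  intro z hz
  rcases mem_snowflake_iff.1 hz with h | ⟨j, h⟩
  · exact mem_of_superset (isOpen_interior.mem_nhds h) kochTriangle_subset
  · exact key _ _ _ h (.side j)

end Domain

/-! ### Distances in the rooms of the domain -/

/-- The conditions on the parameters of the construction. -/
structure KochParameters (s α₁ : ℝ) : Prop where
  s_pos : 0 < s
  s_lt : s < 1 / 2
  pos : 0 < α₁
  lt : α₁ < 1 / 2

section Rooms

variable {s α₁ : ℝ} {k : ℕ} {σ : ℂ × ℂ} {z : ℂ}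

theorem dist_le_of_mem_closedTent (hσ : σ.1 ≠ σ.2) {u v : ℂ} (hu : u ∈ closedTent σ)
    (hv : v ∈ closedTent σ) : dist u v ≤ 2 * ‖σ.2 - σ.1‖ := by
  obtain ⟨h1, h2, h3⟩ := hu
  obtain ⟨h4, h5, h6⟩ := hv
  refine (dist_le_of_coords hσ u v).trans (mul_le_mul_of_nonneg_right ?_ (norm_nonneg _))
  have e1 : |segX σ u - segX σ v| ≤ 1 := abs_le.2 ⟨by linarith, by linarith⟩
  have e2 : |segY σ u - segY σ v| ≤ 1 := abs_le.2 ⟨by linarith, by linarith⟩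
  linarith

theorem ball_subset_kochTriangle : Metric.ball (1 / 2 + (1 / 4 : ℝ) * Complex.I) (1 / 8) ⊆ kochTriangle ∧
    kochTriangle ⊆ Metric.closedBall (1 / 2 + (1 / 4 : ℝ) * Complex.I) 2 := by
  have h3 : (3 / 2 : ℝ) ≤ √3 := Real.le_sqrt_of_sq_le (by norm_num)
  have h3' : √3 ≤ 2 := Real.sqrt_le_iff.2 ⟨by norm_num, by norm_num⟩
  have key : ∀ z : ℂ, segY (triangleSide 0) z / (-(√3 / 2)) = z.im / (√3 / 2) := fun z => by
    rw [(triangleSide_zero_coords z).2, neg_div, div_neg]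
  constructor
  · intro z hz
    rw [Metric.mem_ball, Complex.dist_eq] at hz
    have hre := (Complex.abs_re_le_norm _).trans_lt hz
    have him := (Complex.abs_im_le_norm _).trans_lt hz
    simp at hre him
    rw [abs_lt] at hre him
    have e : z.im / (√3 / 2) < 1 / 2 := by
      rw [div_lt_iff₀ (by positivity)]; linarith
    refine (mem_kochTriangle_iff 0).2 ?_
    rw [key, ← (triangleSide_zero_coords z).1]
    exact ⟨div_pos (by linarith) (by positivity), by linarith, by linarith⟩
  · intro z hz
    have h := (mem_kochTriangle_iff 0).1 hz
    rw [key, ← (triangleSide_zero_coords z).1] at h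
    obtain ⟨h1, h4, h5⟩ := h
    have h6 : z.im / (√3 / 2) < 1 := by linarith
    have h7 := h1
    rw [div_lt_iff₀ (by positivity)] at h6
    rw [div_pos_iff_of_pos_right (by positivity)] at h1
    rw [Metric.mem_closedBall, Complex.dist_eq]
    refine (Complex.norm_le_abs_re_add_abs_im _).trans ?_
    have a1 : |(z - (1 / 2 + (1 / 4 : ℝ) * Complex.I)).re| ≤ 1 := by
      simp; rw [abs_le]; constructor <;> linarith
    have a2 : |(z - (1 / 2 + (1 / 4 : ℝ) * Complex.I)).im| ≤ 1 := by
      simp; rw [abs_le]; constructor <;> linarith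
    linarith

theorem ball_subset_spikeInterior {α : ℝ} (hσ : σ.1 ≠ σ.2) (h0 : 0 < α) (h1 : α < 1 / 2) :
    Metric.ball (segPoint σ (1 / 2) (spikeHeight α / 2)) (α * spikeHeight α / 4 * ‖σ.2 - σ.1‖) ⊆
        spikeInterior α σ ∧
      spikeInterior α σ ⊆
        Metric.closedBall (segPoint σ (1 / 2) (spikeHeight α / 2)) ‖σ.2 - σ.1‖ := by
  have hη := spikeHeight_pos h1
  have hη' : spikeHeight α < 1 / 2 := by have := spikeHeight_lt h0 h1; linarith
  have hn : 0 < ‖σ.2 - σ.1‖ := norm_pos_iff.2 (sub_ne_zero.2 hσ.symm)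
  have hX := segX_segPoint hσ (1 / 2) (spikeHeight α / 2)
  have hY := segY_segPoint hσ (1 / 2) (spikeHeight α / 2)
  constructor
  · intro z hz
    have e1 := (abs_segX_sub_mul_le hσ z _).trans_lt hz
    have e2 := (abs_segY_sub_mul_le hσ z _).trans_lt hz
    rw [hX] at e1
    rw [hY] at e2
    have e1' := abs_lt.1 (lt_of_mul_lt_mul_right e1 hn.le)
    have e2' := abs_lt.1 (lt_of_mul_lt_mul_right e2 hn.le)
    have hαη : 0 < α * spikeHeight α := by positivity
    have b1 : α * spikeHeight α < spikeHeight α / 2 := by nlinarith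
    have b2 : spikeHeight α * (α * spikeHeight α) < α * spikeHeight α / 2 := by nlinarith
    have b3 : α * segY σ z < α * (spikeHeight α * (5 / 8)) := mul_lt_mul_of_pos_left (by linarith) h0
    refine (mem_spikeInterior_iff hσ h0 h1).2 ⟨by linarith, ?_, ?_⟩
    · have : 2 * spikeHeight α * (segX σ z - 1 / 2) < 2 * spikeHeight α * (α * spikeHeight α / 4) :=
        mul_lt_mul_of_pos_left (by linarith) (by positivity)
      nlinarith
    · have : 2 * spikeHeight α * (1 / 2 - segX σ z) < 2 * spikeHeight α * (α * spikeHeight α / 4) :=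
        mul_lt_mul_of_pos_left (by linarith) (by positivity)
      nlinarith
  · intro z hz
    obtain ⟨h2, h3, h4⟩ := (mem_spikeInterior_iff hσ h0 h1).1 hz
    rw [Metric.mem_closedBall]
    refine (dist_le_of_coords hσ z _).trans ?_
    rw [hX, hY]
    have h5 : segY σ z < spikeHeight α := by nlinarith
    have h6 : α * (spikeHeight α - segY σ z) < spikeHeight α / 2 := by nlinarith
    have e1 : |segX σ z - 1 / 2| ≤ 1 / 2 := by
      rw [abs_le]; constructor <;> nlinarith
    have e2 : |segY σ z - spikeHeight α / 2| ≤ 1 / 2 := by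
      rw [abs_le]; constructor <;> linarith
    nlinarith

/-- The size and the inner radius of a room. -/
theorem IsKochRoom.exists_ball (hp : KochParameters s α₁) : ∃ C₀, 0 < C₀ ∧
    ∀ H, IsKochRoom s α₁ H → ∃ c w l, 0 < w ∧ 0 < l ∧ Metric.ball c w ⊆ H ∧
      H ⊆ Metric.closedBall c l ∧ l ^ (2 - 2 * s) ≤ C₀ * w := by
  obtain ⟨hs₀, hs₁, hα₀, hα₁⟩ := hp
  set m := min α₁ (1 / 3) with hm
  have hm0 : 0 < m := lt_min hα₀ (by norm_num)
  set M := max α₁ (1 / 3)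
  have hM : M < 1 / 2 := max_lt hα₁ (by norm_num)
  have hh := spikeHeight_pos hM
  -- The triangle has `l = 2`, `w = 1/8` and `l ^ (2 - 2s) ≤ 4`, which needs `32`. The second term
  -- serves all spikes, with `m` from the lower bound of the ratios and `M` their upper bound.
  refine ⟨32 + 4 / (m * spikeHeight M), by positivity, ?_⟩
  rintro H (rfl | ⟨k, σ, hσ, rfl⟩)
  · refine ⟨_, _, _, by norm_num, by norm_num, ball_subset_kochTriangle.1,
      ball_subset_kochTriangle.2, ?_⟩
    have h1 : (2 : ℝ) ^ (2 - 2 * s) ≤ 2 ^ (2 : ℝ) :=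
      Real.rpow_le_rpow_of_exponent_le (by norm_num) (by linarith)
    have h2 : (2 : ℝ) ^ (2 : ℝ) = 4 := by norm_num
    have h3 : 0 < 4 / (m * spikeHeight M) := by positivity
    linarith
  · obtain ⟨hne, hnorm⟩ := hσ.norm_eq hs₁ hα₀ hα₁
    have h0 := kochRatio_pos (s := s) hα₀ hα₁ k
    have h1 := kochRatio_lt_half hs₁ hα₀ hα₁ k
    have hl := kochLength_pos s (show α₁ < 1 by linarith) k
    obtain ⟨hb, hb'⟩ := ball_subset_spikeInterior hne h0 h1
    have hηk := spikeHeight_pos h1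
    rw [hnorm] at hb hb'
    refine ⟨_, _, _, by positivity, hl, hb, hb', ?_⟩
    have e1 : spikeHeight M ≤ spikeHeight (kochRatio s α₁ (k + 1)) := by
      unfold spikeHeight
      have := kochRatio_le_max hs₁ hα₀ hα₁ k
      gcongr
    have e2 := rpow_le_kochRatio hs₁ hα₀ hα₁ k
    have e3 : kochLength s α₁ k ^ (2 - 2 * s) =
        kochLength s α₁ k ^ (1 - 2 * s) * kochLength s α₁ k := by
      rw [← Real.rpow_add_one hl.ne']; ring_nf
    have e4 : m * kochLength s α₁ k ^ (1 - 2 * s) * spikeHeight M / 4 * kochLength s α₁ k ≤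
        kochRatio s α₁ (k + 1) * spikeHeight (kochRatio s α₁ (k + 1)) / 4 * kochLength s α₁ k := by
      gcongr
    calc kochLength s α₁ k ^ (2 - 2 * s)
        = 4 / (m * spikeHeight M) *
          (m * kochLength s α₁ k ^ (1 - 2 * s) * spikeHeight M / 4 * kochLength s α₁ k) := by
            rw [e3]; field_simp
      _ ≤ (32 + 4 / (m * spikeHeight M)) * _ :=
        mul_le_mul (by linarith) e4 (by positivity) (by positivity)

theorem KochParameters.isOpen (hp : KochParameters s α₁) : IsOpen (snowflake s α₁) :=
  isOpen_snowflake hp.s_lt hp.pos hp.lt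

theorem kochCenter_mem : (1 / 2 + (1 / 4 : ℝ) * Complex.I : ℂ) ∈ kochTriangle :=
  ball_subset_kochTriangle.1 (Metric.mem_ball_self (by norm_num))

theorem frontier_nonempty_of {Ω : Set ℂ} {u v : ℂ} (hu : u ∈ Ω) (hv : v ∉ Ω) :
    (frontier Ω).Nonempty := nonempty_frontier_iff.2 ⟨⟨u, hu⟩, fun h => hv (h ▸ mem_univ v)⟩

theorem KochParameters.frontier_nonempty (hp : KochParameters s α₁) :
    (frontier (snowflake s α₁)).Nonempty :=
  frontier_nonempty_of (kochTriangle_subset kochCenter_mem)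
    ((IsKochSegment.side 0).fst_notMem hp.s_lt hp.pos hp.lt)

/-- A distance on the domain that is bounded by a power of the Euclidean distance in every
room. -/
structure IsRoomGauge (s α₁ : ℝ) (F : ℂ → ℂ → ℝ≥0∞) (C e : ℝ) : Prop where
  const_pos : 0 < C
  exp_pos : 0 < e
  symm : ∀ u v, F u v = F v u
  triangle : ∀ u v w, F u w ≤ F u v + F v w
  le_room : ∀ H, IsKochRoom s α₁ H → ∀ u ∈ closure H, u ∈ snowflake s α₁ → ∀ v ∈ closure H,
    v ∈ snowflake s α₁ → F u v ≤ ENNReal.ofReal (C * dist u v ^ e)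

theorem isRoomGauge_internal (hp : KochParameters s α₁) :
    IsRoomGauge s α₁ (rhoEDist (snowflake s α₁) fun _ => 1) 1 1 where
  const_pos := one_pos
  exp_pos := one_pos
  symm u v := le_antisymm (rhoEDist_comm_le _ _) (rhoEDist_comm_le _ _)
  triangle := rhoEDist_triangle
  le_room H hH u hu huΩ v hv hvΩ := by
    obtain ⟨C₀, -, h⟩ := IsKochRoom.exists_ball hp
    obtain ⟨c, w, l, hw, hl, hb, -, -⟩ := h H hH
    rw [one_mul, Real.rpow_one]
    exact rhoEDist_one_le_of_convex hH.convex hH.isOpen hH.subset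
      (hb (Metric.mem_ball_self hw)) hu huΩ hv hvΩ

/-- The exponent `s` arises here. With `r = dist u v ≤ 2 l` and `w ≥ l ^ (2 - 2s) / C₀`, the
quantity `r l / w` is at most `C₀ r l ^ (2s - 1) ≤ 2 C₀ r ^ (2s)`. -/
theorem exists_isRoomGauge_density (hp : KochParameters s α₁) :
    ∃ C, IsRoomGauge s α₁ (rhoEDist (snowflake s α₁) (snowflakeDensity s α₁)) C s := by
  obtain ⟨C₀, hC₀, h⟩ := IsKochRoom.exists_ball hp
  refine ⟨6 * √(2 * C₀), by positivity, hp.s_pos,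
    fun u v => le_antisymm (rhoEDist_comm_le _ _) (rhoEDist_comm_le _ _), rhoEDist_triangle,
    fun H hH u hu huΩ v hv hvΩ => ?_⟩
  obtain ⟨c, w, l, hw, hl, hb, hb', hlw⟩ := h H hH
  refine (rhoEDist_le_of_convex hp.frontier_nonempty hH.convex hH.isOpen hH.subset hw hb hl hb'
    hu huΩ hv hvΩ).trans (ENNReal.ofReal_le_ofReal ?_)
  have hs := hp.s_lt
  have hs0 := hp.s_pos
  rw [mul_assoc]
  refine mul_le_mul_of_nonneg_left ?_ (by norm_num)
  rcases eq_or_lt_of_le (dist_nonneg (x := u) (y := v)) with hd | hd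
  · rw [← hd]; simp; positivity
  have hcl : closure H ⊆ Metric.closedBall c l := closure_minimal hb' Metric.isClosed_closedBall
  have hd2 : dist u v ≤ 2 * l := by
    have := hcl hu
    have := hcl hv
    rw [Metric.mem_closedBall] at *
    linarith [dist_triangle_right u v c]
  refine Real.sqrt_le_iff.2 ⟨by positivity, ?_⟩
  rw [mul_pow, Real.sq_sqrt (by positivity), ← Real.rpow_natCast, ← Real.rpow_mul hd.le,
    div_le_iff₀ hw]
  push_cast
  have e1 : (2 * l) ^ (1 - 2 * s) ≤ 2 * l ^ (1 - 2 * s) := by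
    rw [Real.mul_rpow (by norm_num) hl.le]
    gcongr
    exact (Real.rpow_le_rpow_of_exponent_le (by norm_num) (by linarith)).trans_eq (Real.rpow_one 2)
  have e2 : dist u v ^ (1 - 2 * s) ≤ 2 * l ^ (1 - 2 * s) :=
    (Real.rpow_le_rpow hd.le hd2 (by linarith)).trans e1
  have e3 : dist u v = dist u v ^ (s * 2) * dist u v ^ (1 - 2 * s) := by
    rw [← Real.rpow_add hd]; ring_nf; rw [Real.rpow_one]
  have e4 : l ^ (1 - 2 * s) * l = l ^ (2 - 2 * s) := by
    rw [← Real.rpow_add_one hl.ne']; ring_nf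
  calc dist u v * l = dist u v ^ (s * 2) * dist u v ^ (1 - 2 * s) * l := by rw [← e3]
    _ ≤ dist u v ^ (s * 2) * (2 * l ^ (1 - 2 * s)) * l := by gcongr
    _ = 2 * dist u v ^ (s * 2) * (l ^ (1 - 2 * s) * l) := by ring
    _ ≤ 2 * dist u v ^ (s * 2) * (C₀ * w) := by rw [e4]; gcongr
    _ = 2 * C₀ * dist u v ^ (s * 2) * w := by ring

/-! ### Distances to the midpoints of the segments -/

theorem spike_subset_closure_spikeInterior {α : ℝ} (hσ : σ.1 ≠ σ.2) (h0 : 0 < α)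
    (h1 : α < 1 / 2) : spike α σ ⊆ closure (spikeInterior α σ) := by
  have hne : (spikeInterior α σ).Nonempty := by
    have hη := spikeHeight_pos h1
    have hn : 0 < ‖σ.2 - σ.1‖ := norm_pos_iff.2 (sub_ne_zero.2 hσ.symm)
    exact ⟨_, (ball_subset_spikeInterior hσ h0 h1).1 (Metric.mem_ball_self (by positivity))⟩
  rw [spike_eq]
  refine union_subset subset_closure ?_
  rw [spikeInterior, (convex_convexHull ℝ _).closure_interior_eq_closure_of_nonempty_interior hne]
  refine subset_closure.trans' ((openSegment_subset_segment ℝ _ _).trans ?_)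
  exact segment_subset_convexHull (by simp) (by simp)

/-- The midpoint of a segment. -/
def segMid (σ : ℂ × ℂ) : ℂ := segPoint σ (1 / 2) 0

theorem segMid_mem_spikeBase {α : ℝ} (hσ : σ.1 ≠ σ.2) (h0 : 0 < α) :
    segMid σ ∈ spikeBase α σ := by
  rw [mem_spikeBase_iff hσ h0, segMid, segX_segPoint hσ, segY_segPoint hσ]
  exact ⟨rfl, by linarith, by linarith⟩

theorem segMid_mem_spike {α : ℝ} (hσ : σ.1 ≠ σ.2) (h0 : 0 < α) : segMid σ ∈ spike α σ :=
  Or.inr (segMid_mem_spikeBase hσ h0)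

variable (hp : KochParameters s α₁)
include hp

theorem IsKochSegment.ne (hσ : IsKochSegment s α₁ k σ) : σ.1 ≠ σ.2 :=
  (hσ.norm_eq hp.s_lt hp.pos hp.lt).1

theorem IsKochSegment.norm (hσ : IsKochSegment s α₁ k σ) : ‖σ.2 - σ.1‖ = kochLength s α₁ k :=
  (hσ.norm_eq hp.s_lt hp.pos hp.lt).2

theorem KochParameters.ratio_pos (k : ℕ) : 0 < kochRatio s α₁ (k + 1) :=
  kochRatio_pos hp.pos hp.lt k

theorem KochParameters.ratio_lt (k : ℕ) : kochRatio s α₁ (k + 1) < 1 / 2 :=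
  kochRatio_lt_half hp.s_lt hp.pos hp.lt k

theorem KochParameters.length_pos (k : ℕ) : 0 < kochLength s α₁ k :=
  kochLength_pos s (by linarith [hp.lt]) k

omit hp in
theorem IsKochSegment.spike_subset (hσ : IsKochSegment s α₁ k σ) :
    spike (kochRatio s α₁ (k + 1)) σ ⊆ snowflake s α₁ :=
  fun _ h => (KochBranch.spike h).mem_snowflake hσ

theorem IsKochSegment.segMid_mem (hσ : IsKochSegment s α₁ k σ) : segMid σ ∈ snowflake s α₁ :=
  hσ.spike_subset (segMid_mem_spike (hσ.ne hp) (hp.ratio_pos k))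

theorem KochBranch.mem_closedTent (hσ : IsKochSegment s α₁ k σ) (h : KochBranch s α₁ k σ z) :
    z ∈ closedTent σ :=
  tent_subset_closedTent (h.mem_tent hp.s_lt hp.pos hp.lt (hσ.ne hp))

theorem KochBranch.dist_le (hσ : IsKochSegment s α₁ k σ) {u v : ℂ}
    (hu : KochBranch s α₁ k σ u) (hv : KochBranch s α₁ k σ v) :
    dist u v ≤ 2 * kochLength s α₁ k := by
  rw [← hσ.norm hp]
  exact dist_le_of_mem_closedTent (hσ.ne hp) (hu.mem_closedTent hp hσ) (hv.mem_closedTent hp hσ)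

/-- A set along the left of `σ` lies along the left of the first and the last child of `σ`. -/
theorem leftOf_kochChild_outer (hσ : IsKochSegment s α₁ k σ) {H : Set ℂ} (hH : LeftOf H σ)
    {c : Fin 4} (hc : c = 0 ∨ c = 3) : LeftOf H (kochChild (kochRatio s α₁ (k + 1)) σ c) := by
  have h0 := hp.ratio_pos k
  have h1 := hp.ratio_lt k
  have hne := hσ.ne hp
  rcases hc with rfl | rfl
  · exact hH.mono hne (kochChild_ne hne h1 _) (isSubsegment_zero hne h0 h1)
  · exact hH.mono hne (kochChild_ne hne h1 _) (isSubsegment_three hne h1 h0)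

theorem leftOf_kochChild_inner (hσ : IsKochSegment s α₁ k σ) {c : Fin 4} (hc : c = 1 ∨ c = 2) :
    LeftOf (spikeInterior (kochRatio s α₁ (k + 1)) σ)
      (kochChild (kochRatio s α₁ (k + 1)) σ c) := by
  rcases hc with rfl | rfl
  · exact leftOf_one (hσ.ne hp) (hp.ratio_pos k) (hp.ratio_lt k)
  · exact leftOf_two (hσ.ne hp) (hp.ratio_pos k) (hp.ratio_lt k)

/-- Both midpoints lie in the closure of one room: the room along the left of `σ` for an outer
child, the spike over `σ` for one of its sides. -/
theorem IsRoomGauge.segMid_child_le {F : ℂ → ℂ → ℝ≥0∞} {C e : ℝ} (hF : IsRoomGauge s α₁ F C e)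
    (hσ : IsKochSegment s α₁ k σ) (c : Fin 4) :
    F (segMid (kochChild (kochRatio s α₁ (k + 1)) σ c)) (segMid σ) ≤
      ENNReal.ofReal (C * (2 * kochLength s α₁ k) ^ e) := by
  have h0 := hp.ratio_pos k
  have h1 := hp.ratio_lt k
  have hne := hσ.ne hp
  have hhalf : (1 / 2 : ℝ) ∈ Ioo (0 : ℝ) 1 := by norm_num
  have hσc := hσ.child c
  have hd : dist (segMid (kochChild (kochRatio s α₁ (k + 1)) σ c)) (segMid σ) ≤
      2 * kochLength s α₁ k :=
    KochBranch.dist_le hp hσ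
      (.child c (.spike (segMid_mem_spike (hσc.ne hp) (hp.ratio_pos (k + 1)))))
      (.spike (segMid_mem_spike hne h0))
  have main : ∀ H, IsKochRoom s α₁ H → segMid σ ∈ closure H →
      LeftOf H (kochChild (kochRatio s α₁ (k + 1)) σ c) →
      F (segMid (kochChild (kochRatio s α₁ (k + 1)) σ c)) (segMid σ) ≤
        ENNReal.ofReal (C * (2 * kochLength s α₁ k) ^ e) := fun H hH h2 h3 =>
    (hF.le_room H hH _ (h3.mem_closure (hσc.ne hp) hhalf) (hσc.segMid_mem hp) _ h2
      (hσ.segMid_mem hp)).trans (ENNReal.ofReal_le_ofReal (mul_le_mul_of_nonneg_left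
        (Real.rpow_le_rpow dist_nonneg hd hF.exp_pos.le) hF.const_pos.le))
  by_cases hc : c = 0 ∨ c = 3
  · obtain ⟨H, hH, hL⟩ := hσ.exists_room hp.s_lt hp.pos hp.lt
    exact main H hH (hL.mem_closure hne hhalf) (leftOf_kochChild_outer hp hσ hL hc)
  · have hc' : c = 1 ∨ c = 2 := by fin_cases c <;> simp_all
    exact main _ (Or.inr ⟨k, σ, hσ, rfl⟩)
      (spike_subset_closure_spikeInterior hne h0 h1 (segMid_mem_spike hne h0))
      (leftOf_kochChild_inner hp hσ hc')

/-- Every point of the branch over a segment is close to the midpoint of the segment. -/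
theorem IsRoomGauge.exists_segMid_le {F : ℂ → ℂ → ℝ≥0∞} {C e : ℝ} (hF : IsRoomGauge s α₁ F C e) :
    ∃ C', 0 < C' ∧ ∀ k σ z, IsKochSegment s α₁ k σ → KochBranch s α₁ k σ z →
      F z (segMid σ) ≤ ENNReal.ofReal (C' * kochLength s α₁ k ^ e) := by
  have hC := hF.const_pos
  have he := hF.exp_pos
  set q : ℝ := (1 / 2 : ℝ) ^ e with hq
  have hq0 : 0 < q := by positivity
  have hq1 : q < 1 := Real.rpow_lt_one (by norm_num) (by norm_num) he
  have h1q : 0 < 1 - q := by linarith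
  -- The constant `C'` solves `q C' + C 2 ^ e = C'`; it sums the geometric series of the steps from
  -- child to parent.
  refine ⟨C * 2 ^ e / (1 - q), by positivity, fun k σ z hσ h => ?_⟩
  have hle : ∀ k, C * (2 * kochLength s α₁ k) ^ e ≤
      C * 2 ^ e / (1 - q) * kochLength s α₁ k ^ e := fun k => by
    have := hp.length_pos k
    rw [Real.mul_rpow (by norm_num) this.le, ← mul_assoc]
    gcongr
    rw [le_div_iff₀ h1q]
    nlinarith [show 0 < C * 2 ^ e by positivity]
  induction h with
  | @spike k σ z h =>
    have hne := hσ.ne hp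
    have h0 := hp.ratio_pos k
    have hcl := spike_subset_closure_spikeInterior hne h0 (hp.ratio_lt k)
    refine (hF.le_room _ (Or.inr ⟨k, σ, hσ, rfl⟩) z (hcl h) (hσ.spike_subset h) _
      (hcl (segMid_mem_spike hne h0)) (hσ.segMid_mem hp)).trans (ENNReal.ofReal_le_ofReal ?_)
    refine le_trans ?_ (hle k)
    have := KochBranch.dist_le hp hσ (.spike h) (.spike (segMid_mem_spike hne h0))
    gcongr
  | @child k σ z c h ih =>
    have hl := hp.length_pos k
    have hl' := hp.length_pos (k + 1)
    refine (hF.triangle _ (segMid (kochChild (kochRatio s α₁ (k + 1)) σ c)) _).trans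
      ((add_le_add (ih (hσ.child c)) (hF.segMid_child_le hp hσ c)).trans ?_)
    rw [← ENNReal.ofReal_add (by positivity) (by positivity)]
    refine ENNReal.ofReal_le_ofReal ?_
    have h2 : kochLength s α₁ (k + 1) ^ e ≤ q * kochLength s α₁ k ^ e := by
      rw [hq, ← Real.mul_rpow (by norm_num) hl.le]
      have := kochLength_succ_le_half (s := s) hp.pos hp.lt k
      exact Real.rpow_le_rpow hl'.le (by linarith) he.le
    rw [Real.mul_rpow (by norm_num) hl.le]
    have h3 : C * 2 ^ e / (1 - q) * kochLength s α₁ (k + 1) ^ e ≤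
        C * 2 ^ e / (1 - q) * (q * kochLength s α₁ k ^ e) := by gcongr
    refine (add_le_add_left h3 _).trans (le_of_eq ?_)
    field_simp
    ring

/-- The domain has finite diameter with respect to every gauge. -/
theorem IsRoomGauge.exists_center_le {F : ℂ → ℂ → ℝ≥0∞} {C e : ℝ}
    (hF : IsRoomGauge s α₁ F C e) : ∃ D, 0 < D ∧ ∀ z ∈ snowflake s α₁,
      F z (1 / 2 + (1 / 4 : ℝ) * Complex.I) ≤ ENNReal.ofReal D := by
  obtain ⟨C', hC', h⟩ := hF.exists_segMid_le hp
  have hC := hF.const_pos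
  have hle : ∀ z ∈ closure kochTriangle, z ∈ snowflake s α₁ →
      F z (1 / 2 + (1 / 4 : ℝ) * Complex.I) ≤ ENNReal.ofReal (C * 2 ^ e) := fun z hz hzΩ => by
    refine (hF.le_room _ (Or.inl rfl) z hz hzΩ _ (subset_closure kochCenter_mem)
      (kochTriangle_subset kochCenter_mem)).trans (ENNReal.ofReal_le_ofReal ?_)
    have : dist z (1 / 2 + (1 / 4 : ℝ) * Complex.I) ≤ 2 :=
      closure_minimal ball_subset_kochTriangle.2 Metric.isClosed_closedBall hz
    have := hF.exp_pos
    gcongr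
  refine ⟨C' + C * 2 ^ e, by positivity, fun z hz => ?_⟩
  rcases mem_snowflake_iff.1 hz with hz' | ⟨j, hj⟩
  · exact (hle z (subset_closure hz') hz).trans (ENNReal.ofReal_le_ofReal (by linarith))
  · refine (hF.triangle _ (segMid (triangleSide j)) _).trans ?_
    rw [ENNReal.ofReal_add hC'.le (by positivity)]
    refine add_le_add ((h 0 _ z (.side j) hj).trans_eq (by simp [kochLength])) (hle _ ?_ ?_)
    · exact (leftOf_kochTriangle j).mem_closure (triangleSide_ne j) (by norm_num)
    · exact (IsKochSegment.side j).segMid_mem hp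

/-- A finite internal distance to the centre already means that a joining curve exists. -/
theorem KochParameters.isConnected : IsConnected (snowflake s α₁) := by
  refine ⟨⟨_, kochTriangle_subset kochCenter_mem⟩, ?_⟩
  obtain ⟨D, hD, h⟩ := (isRoomGauge_internal hp).exists_center_le hp
  refine isPreconnected_of_forall (1 / 2 + (1 / 4 : ℝ) * Complex.I) fun z hz => ?_
  obtain ⟨γ, L, hγ, -⟩ := exists_curve_of_rhoEDist_one_lt (r := D + 1)
    ((h z hz).trans_lt ((ENNReal.ofReal_lt_ofReal_iff (by linarith)).2 (by linarith)))
  refine ⟨γ '' Icc 0 L, image_subset_iff.2 hγ.mem, ?_, ?_, ?_⟩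
  · exact ⟨L, ⟨hγ.nonneg, le_rfl⟩, hγ.finish⟩
  · exact ⟨0, ⟨le_rfl, hγ.nonneg⟩, hγ.start⟩
  · exact isPreconnected_Icc.image _ hγ.continuousOn

end Rooms

/-! ### Hölder continuity of the gauges with respect to the internal distance -/

section Paths

/-- The points `x` and `y` can be joined by a path in `Ω` of diameter at most `D`. -/
def JoinedWithin (Ω : Set ℂ) (D : ℝ) (x y : ℂ) : Prop :=
  ∃ (γ : ℝ → ℂ) (p q : ℝ), p ≤ q ∧ ContinuousOn γ (Icc p q) ∧ (∀ t ∈ Icc p q, γ t ∈ Ω) ∧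
    γ p = x ∧ γ q = y ∧ ∀ t ∈ Icc p q, ∀ t' ∈ Icc p q, dist (γ t) (γ t') ≤ D

variable {Ω : Set ℂ} {D : ℝ} {x y : ℂ}

theorem JoinedWithin.dist_le (h : JoinedWithin Ω D x y) : dist x y ≤ D := by
  obtain ⟨γ, p, q, hpq, -, -, rfl, rfl, h⟩ := h
  exact h _ ⟨le_rfl, hpq⟩ _ ⟨hpq, le_rfl⟩

theorem JoinedWithin.nonneg (h : JoinedWithin Ω D x y) : 0 ≤ D := dist_nonneg.trans h.dist_le

theorem JoinedWithin.left_mem (h : JoinedWithin Ω D x y) : x ∈ Ω := by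
  obtain ⟨γ, p, q, hpq, -, h, rfl, -⟩ := h
  exact h _ ⟨le_rfl, hpq⟩

theorem JoinedWithin.symm (h : JoinedWithin Ω D x y) : JoinedWithin Ω D y x := by
  obtain ⟨γ, p, q, hpq, hγ, hΩ, rfl, rfl, h⟩ := h
  have hm : ∀ t ∈ Icc p q, p + q - t ∈ Icc p q := fun t ht =>
    ⟨by linarith [ht.2], by linarith [ht.1]⟩
  exact ⟨fun t => γ (p + q - t), p, q, hpq, hγ.comp (by fun_prop) hm, fun t ht => hΩ _ (hm t ht),
    by simp, by simp, fun t ht t' ht' => h _ (hm t ht) _ (hm t' ht')⟩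

theorem JoinedWithin.right_mem (h : JoinedWithin Ω D x y) : y ∈ Ω := h.symm.left_mem

/-- A path that leaves `P` passes through the gate `B` of `P`. -/
theorem JoinedWithin.exists_gate (h : JoinedWithin Ω D x y) {P B : Set ℂ}
    (hcl : ∃ K, IsClosed K ∧ P = Ω ∩ K) (hop : ∃ V, IsOpen V ∧ P \ B = Ω ∩ V) (hx : x ∈ P)
    (hy : y ∉ P) : ∃ b ∈ B, JoinedWithin Ω D x b ∧ JoinedWithin Ω D b y := by
  obtain ⟨γ, p, q, hpq, hγ, hΩ, rfl, rfl, h⟩ := h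
  obtain ⟨t, ht, htB, -⟩ := exists_crossing hpq hγ hΩ hcl hop hx hy
  have h1 : Icc p t ⊆ Icc p q := Icc_subset_Icc_right ht.2
  have h2 : Icc t q ⊆ Icc p q := Icc_subset_Icc_left ht.1
  exact ⟨γ t, htB,
    ⟨γ, p, t, ht.1, hγ.mono h1, fun u hu => hΩ u (h1 hu), rfl, rfl,
      fun u hu v hv => h u (h1 hu) v (h1 hv)⟩,
    ⟨γ, t, q, ht.2, hγ.mono h2, fun u hu => hΩ u (h2 hu), rfl, rfl,
      fun u hu v hv => h u (h2 hu) v (h2 hv)⟩⟩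

theorem IsCurveIn.joinedWithin {γ : ℝ → ℂ} {L : ℝ} (h : IsCurveIn Ω γ L x y) :
    JoinedWithin Ω L x y :=
  ⟨γ, 0, L, h.nonneg, h.continuousOn, h.mem, h.start, h.finish, fun t ht t' ht' =>
    (h.dist_le ht ht').trans (abs_le.2 ⟨by linarith [ht.1, ht'.2], by linarith [ht.2, ht'.1]⟩)⟩

end Paths

section Hoelder

variable {s α₁ : ℝ} {k : ℕ} {σ : ℂ × ℂ} {x y z : ℂ} (hp : KochParameters s α₁)
include hp

/-- Follow outer children, which stay on `σ`, until the point is in the spike or in a branch over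
one of its sides. So each point of a branch lies in a piece whose gate is on `σ` itself. -/
theorem KochBranch.exists_piece (h : KochBranch s α₁ k σ x) (hσ : IsKochSegment s α₁ k σ) :
    ∃ k' τ, IsKochSegment s α₁ k' τ ∧ IsSubsegment τ σ ∧ KochPiece s α₁ k' τ x := by
  induction h with
  | spike h => exact ⟨_, _, hσ, .refl _, Or.inl h⟩
  | @child k σ z c h ih =>
    have hne := hσ.ne hp
    have h0 := hp.ratio_pos k
    have h1 := hp.ratio_lt k
    obtain ⟨k', τ, hτ, hsub, hz⟩ := ih (hσ.child c)
    fin_cases c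
    · exact ⟨k', τ, hτ, hsub.trans (isSubsegment_zero hne h0 h1), hz⟩
    · exact ⟨k, σ, hσ, .refl _, Or.inr (Or.inl h)⟩
    · exact ⟨k, σ, hσ, .refl _, Or.inr (Or.inr h)⟩
    · exact ⟨k', τ, hτ, hsub.trans (isSubsegment_three hne h1 h0), hz⟩

/-- As the ratio is below `1/2`, `X + Y ≥ 1/4` and `X - Y ≤ 3/4` on the piece; combine with `Y ≤ X`
and `X + Y ≤ 1`. -/
theorem KochPiece.segX_mem (hσ : IsKochSegment s α₁ k σ) (h : KochPiece s α₁ k σ x) :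
    0 ≤ segY σ x ∧ 1 / 8 ≤ segX σ x ∧ segX σ x ≤ 7 / 8 := by
  obtain ⟨-, ⟨h1, h2, h3⟩, h4, h5⟩ := (hσ.kochPiece_iff hp.s_lt hp.pos hp.lt).1 h
  have := hp.ratio_lt k
  exact ⟨h1, by linarith, by linarith⟩

/-- The pieces over the two sides of a spike stay away from the base of the spike. -/
theorem exists_height_bound : ∃ c₀, 0 < c₀ ∧ ∀ k σ c k' τ x z, IsKochSegment s α₁ k σ →
    c = 1 ∨ c = 2 → IsKochSegment s α₁ k' τ →
    IsSubsegment τ (kochChild (kochRatio s α₁ (k + 1)) σ c) → KochPiece s α₁ k' τ x →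
    z ∈ spikeBase (kochRatio s α₁ (k + 1)) σ → c₀ * kochLength s α₁ k' ≤ dist x z := by
  have hM : max α₁ (1 / 3) < 1 / 2 := max_lt hp.lt (by norm_num)
  have hh := spikeHeight_pos hM
  refine ⟨spikeHeight (max α₁ (1 / 3)) / 8, by positivity, ?_⟩
  intro k σ c k' τ x z hσ hc hτ hsub hx hz
  have hne := hσ.ne hp
  have h0 := hp.ratio_pos k
  have h1 := hp.ratio_lt k
  obtain ⟨hY, hX, hX'⟩ := hx.segX_mem hp hτ
  obtain ⟨p, l, hp0, hl, hpl, hnorm, hco⟩ := hsub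
  rw [hτ.norm hp, (hσ.child c).norm hp] at hnorm
  have hz0 := ((mem_spikeBase_iff hne h0).1 hz).1
  have hd := abs_segY_sub_mul_le hne x z
  rw [hz0, sub_zero, hσ.norm hp] at hd
  obtain ⟨e1, e2⟩ := hco x
  set η := spikeHeight (kochRatio s α₁ (k + 1)) with hη
  have hη0 : 0 < η := spikeHeight_pos h1
  have hMη : spikeHeight (max α₁ (1 / 3)) ≤ η := by
    have := kochRatio_le_max hp.s_lt hp.pos hp.lt k
    unfold η spikeHeight
    gcongr
  have hlX : l * (1 / 8) ≤ l * segX τ x := by gcongr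
  have hlX' : l * segX τ x ≤ l * (7 / 8) := by gcongr
  have hlY : 0 ≤ l * segY τ x := by positivity
  -- Along a side of the spike the height over `σ` grows with slope `η`, and `x` is over a point at
  -- least `l / 8` away from the lower end of the side.
  have key : l * η / 8 ≤ segY σ x := by
    rcases hc with rfl | rfl
    · rw [((kochChild_one_coords hne h1).2.2 x).2, e1, e2, ← hη]
      nlinarith [mul_nonneg hlY h0.le, mul_le_mul_of_nonneg_right
        (show l * (1 / 8) ≤ p + l * segX τ x by linarith) hη0.le]
    · rw [((kochChild_two_coords hne h1).2.2 x).2, e1, e2, ← hη]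
      nlinarith [mul_nonneg hlY h0.le, mul_le_mul_of_nonneg_right
        (show l * (1 / 8) ≤ 1 - (p + l * segX τ x) by linarith) hη0.le]
  have hk := hp.length_pos k
  have hk' := hp.length_pos (k + 1)
  have hk1 := kochLength_antitone (s := s) hp.pos hp.lt (Nat.le_succ k)
  calc spikeHeight (max α₁ (1 / 3)) / 8 * kochLength s α₁ k'
      = spikeHeight (max α₁ (1 / 3)) / 8 * (l * kochLength s α₁ (k + 1)) := by rw [hnorm]
    _ ≤ η / 8 * (l * kochLength s α₁ k) := by gcongr
    _ = l * η / 8 * kochLength s α₁ k := by ring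
    _ ≤ |segY σ x| * kochLength s α₁ k := by gcongr; exact key.trans (le_abs_self _)
    _ ≤ dist x z := hd

theorem LeftOf.spikeBase_subset {H : Set ℂ} (hσ : IsKochSegment s α₁ k σ) (hH : LeftOf H σ) :
    spikeBase (kochRatio s α₁ (k + 1)) σ ⊆ closure H := by
  intro z hz
  have hne := hσ.ne hp
  have h0 := hp.ratio_pos k
  have h1 := hp.ratio_lt k
  obtain ⟨h2, h3, h4⟩ := (mem_spikeBase_iff hne h0).1 hz
  rw [← segPoint_segX_segY hne z, h2]
  exact hH.mem_closure hne ⟨by linarith, by linarith⟩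

variable {F : ℂ → ℂ → ℝ≥0∞} {C e : ℝ} (hF : IsRoomGauge s α₁ F C e)
include hF

/-- The distance of a point of a piece to a point of its gate. -/
theorem IsRoomGauge.exists_gate_bound : ∃ C', C ≤ C' ∧ ∀ k σ x z, IsKochSegment s α₁ k σ →
    KochPiece s α₁ k σ x → z ∈ spikeBase (kochRatio s α₁ (k + 1)) σ →
    F x z ≤ ENNReal.ofReal (C' * dist x z ^ e) := by
  obtain ⟨c₀, hc₀, hheight⟩ := exists_height_bound hp
  obtain ⟨C₁, hC₁, hmid⟩ := hF.exists_segMid_le hp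
  have hC := hF.const_pos
  have he := hF.exp_pos
  have h1le : 1 ≤ (2 / c₀ + 1) ^ e :=
    Real.one_le_rpow (by have : 0 < 2 / c₀ := by positivity
                         linarith) he.le
  have hCC : C ≤ C₁ / c₀ ^ e + C * (2 / c₀ + 1) ^ e := by
    have : 0 < C₁ / c₀ ^ e := by positivity
    nlinarith
  refine ⟨C₁ / c₀ ^ e + C * (2 / c₀ + 1) ^ e, hCC, ?_⟩
  intro k σ x z hσ hx hz
  have hne := hσ.ne hp
  have h0 := hp.ratio_pos k
  have h1 := hp.ratio_lt k
  have hcl := spike_subset_closure_spikeInterior hne h0 h1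
  have hroom : IsKochRoom s α₁ (spikeInterior (kochRatio s α₁ (k + 1)) σ) :=
    Or.inr ⟨k, σ, hσ, rfl⟩
  have hz' : z ∈ spike (kochRatio s α₁ (k + 1)) σ := Or.inr hz
  have hzΩ := hσ.spike_subset hz'
  -- A point behind a side of the spike lies in a piece over some `τ` on this side, and `kochLength
  -- s α₁ k'` is at most `dist x z / c₀` by the height bound. So the way from `x` to the midpoint of
  -- `τ`, and from there to `z` inside the spike, is controlled by `dist x z`.
  have main : ∀ c, c = 1 ∨ c = 2 →
      KochBranch s α₁ (k + 1) (kochChild (kochRatio s α₁ (k + 1)) σ c) x →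
      F x z ≤ ENNReal.ofReal ((C₁ / c₀ ^ e + C * (2 / c₀ + 1) ^ e) * dist x z ^ e) := by
    intro c hc hb
    obtain ⟨k', τ, hτ, hsub, hxτ⟩ := hb.exists_piece hp (hσ.child c)
    have hh := hheight k σ c k' τ x z hσ hc hτ hsub hxτ hz
    have hl := hp.length_pos k'
    have hleft := (leftOf_kochChild_inner hp hσ hc).mono ((hσ.child c).ne hp) (hτ.ne hp) hsub
    have hmidτ : segMid τ ∈ closure (spikeInterior (kochRatio s α₁ (k + 1)) σ) :=
      hleft.mem_closure (hτ.ne hp) (by norm_num)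
    have hl2 : kochLength s α₁ k' ≤ dist x z / c₀ := by
      rw [le_div_iff₀ hc₀]; linarith
    have hd : dist (segMid τ) z ≤ (2 / c₀ + 1) * dist x z := by
      have h2 := KochBranch.dist_le hp hτ
        (.spike (segMid_mem_spike (hτ.ne hp) (hp.ratio_pos k'))) hxτ.branch
      have h3 : 2 * kochLength s α₁ k' ≤ 2 / c₀ * dist x z := by
        rw [div_mul_eq_mul_div, mul_div_assoc]; linarith
      linarith [dist_triangle (segMid τ) x z]
    refine (hF.triangle _ (segMid τ) _).trans ((add_le_add (hmid k' τ x hτ hxτ.branch)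
      (hF.le_room _ hroom _ hmidτ (hτ.segMid_mem hp) _ (hcl hz') hzΩ)).trans ?_)
    rw [← ENNReal.ofReal_add (by positivity) (by positivity)]
    refine ENNReal.ofReal_le_ofReal ?_
    rw [add_mul]
    refine add_le_add ?_ ?_
    · rw [div_mul_eq_mul_div, mul_div_assoc, ← Real.div_rpow dist_nonneg hc₀.le]
      gcongr
    · rw [mul_assoc, ← Real.mul_rpow (by positivity) dist_nonneg]
      gcongr
  rcases hx with hx | hx | hx
  · refine (hF.le_room _ hroom _ (hcl hx) (hσ.spike_subset hx) _ (hcl hz') hzΩ).trans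
      (ENNReal.ofReal_le_ofReal ?_)
    gcongr
  · exact main 1 (Or.inl rfl) hx
  · exact main 2 (Or.inr rfl) hx

omit hp hF in
/-- The point `y` lies in the closure of `H`, or in a piece whose gate lies in it. -/
def LiesOver (s α₁ : ℝ) (H : Set ℂ) (y : ℂ) : Prop :=
  y ∈ closure H ∨ ∃ k τ, IsKochSegment s α₁ k τ ∧ LeftOf H τ ∧ KochPiece s α₁ k τ y

omit hF in
theorem KochBranch.liesOver {H : Set ℂ} (hσ : IsKochSegment s α₁ k σ) (hH : LeftOf H σ)
    (h : KochBranch s α₁ k σ y) : LiesOver s α₁ H y := by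
  obtain ⟨k', τ, hτ, hsub, hy⟩ := h.exists_piece hp hσ
  exact Or.inr ⟨k', τ, hτ, hH.mono (hσ.ne hp) (hτ.ne hp) hsub, hy⟩

omit hF in
theorem KochPiece.liesOver (hσ : IsKochSegment s α₁ k σ) (h : KochPiece s α₁ k σ y) :
    LiesOver s α₁ (spikeInterior (kochRatio s α₁ (k + 1)) σ) y := by
  rcases h with h | h | h
  · exact Or.inl
      (spike_subset_closure_spikeInterior (hσ.ne hp) (hp.ratio_pos k) (hp.ratio_lt k) h)
  · exact h.liesOver hp (hσ.child 1) (leftOf_kochChild_inner hp hσ (Or.inl rfl))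
  · exact h.liesOver hp (hσ.child 2) (leftOf_kochChild_inner hp hσ (Or.inr rfl))

/-- Descend the tree until `x` and `y` are no longer behind the same gate. The path then passes at
most two gates that border one common room, and `F` is estimated up to the first gate, across the
room and beyond the second gate. The parts have diameter at most `D`, so three terms suffice at any
depth; this is why diameters of paths are used and not lengths. -/
theorem IsRoomGauge.exists_joinedWithin_bound : ∃ K, 0 < K ∧ ∀ x y D,
    JoinedWithin (snowflake s α₁) D x y → F x y ≤ ENNReal.ofReal (K * D ^ e) := by
  obtain ⟨C', hCC', hgate⟩ := hF.exists_gate_bound hp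
  have hC := hF.const_pos
  have he := hF.exp_pos
  have hC' : 0 < C' := hC.trans_le hCC'
  have hgate' : ∀ k σ x z D, IsKochSegment s α₁ k σ → KochPiece s α₁ k σ x →
      z ∈ spikeBase (kochRatio s α₁ (k + 1)) σ → dist x z ≤ D →
      F x z ≤ ENNReal.ofReal (C' * D ^ e) := fun k σ x z D hσ hx hz hD =>
    (hgate k σ x z hσ hx hz).trans (ENNReal.ofReal_le_ofReal (by gcongr))
  have hroom : ∀ H, IsKochRoom s α₁ H → ∀ u v D, u ∈ closure H → v ∈ closure H →
      JoinedWithin (snowflake s α₁) D u v → F u v ≤ ENNReal.ofReal (C' * D ^ e) :=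
    fun H hH u v D hu hv h => (hF.le_room H hH u hu h.left_mem v hv h.right_mem).trans
      (ENNReal.ofReal_le_ofReal (by have := h.dist_le; have := h.nonneg; gcongr))
  have simple : ∀ H, IsKochRoom s α₁ H → ∀ u y D, u ∈ closure H → LiesOver s α₁ H y →
      JoinedWithin (snowflake s α₁) D u y → F u y ≤ ENNReal.ofReal (2 * C' * D ^ e) := by
    intro H hH u y D hu hy h
    have hD := h.nonneg
    rcases hy with hy | ⟨k, τ, hτ, hL, hy⟩
    · refine (hroom H hH u y D hu hy h).trans (ENNReal.ofReal_le_ofReal ?_)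
      gcongr
      linarith
    · by_cases huτ : KochPiece s α₁ k τ u
      · have hub : u ∈ spikeBase (kochRatio s α₁ (k + 1)) τ := by
          refine (huτ.mem_spikeBase_or_pos hp.s_lt hp.pos hp.lt (hτ.ne hp)).resolve_right ?_
          rintro ⟨hpos, -⟩
          have : closure H ⊆ {z | segY τ z ≤ 0} :=
            closure_minimal (fun z hz => (hL.1 z hz).le)
              (isClosed_le continuous_segY continuous_const)
          exact absurd hpos (not_lt.2 (this hu))
        rw [hF.symm]
        refine (hgate' k τ y u D hτ hy hub h.symm.dist_le).trans (ENNReal.ofReal_le_ofReal ?_)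
        gcongr
        linarith
      · obtain ⟨b, hb, h1, h2⟩ := h.symm.exists_gate (hτ.kochPiece_closed hp.s_lt hp.pos hp.lt)
          (hτ.kochPiece_open hp.s_lt hp.pos hp.lt) hy huτ
        rw [hF.symm]
        refine (hF.triangle _ b _).trans ((add_le_add (hgate' k τ y b D hτ hy hb h1.dist_le)
          (hroom H hH b u D (hL.spikeBase_subset hp hτ hb) hu h2)).trans ?_)
        rw [← ENNReal.ofReal_add (by positivity) (by positivity)]
        exact ENNReal.ofReal_le_ofReal (by linarith)
  have hpiece : ∀ k σ H, IsKochSegment s α₁ k σ → IsKochRoom s α₁ H → LeftOf H σ →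
      ∀ x y D, KochPiece s α₁ k σ x → ¬ KochPiece s α₁ k σ y → LiesOver s α₁ H y →
      JoinedWithin (snowflake s α₁) D x y → F x y ≤ ENNReal.ofReal (3 * C' * D ^ e) := by
    intro k σ H hσ hH hL x y D hx hyn hy h
    have hD := h.nonneg
    obtain ⟨b, hb, h1, h2⟩ := h.exists_gate (hσ.kochPiece_closed hp.s_lt hp.pos hp.lt)
      (hσ.kochPiece_open hp.s_lt hp.pos hp.lt) hx hyn
    refine (hF.triangle _ b _).trans ((add_le_add (hgate' k σ x b D hσ hx hb h1.dist_le)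
      (simple H hH b y D (hL.spikeBase_subset hp hσ hb) hy h2)).trans ?_)
    rw [← ENNReal.ofReal_add (by positivity) (by positivity)]
    exact ENNReal.ofReal_le_ofReal (by linarith)
  -- Induction on the position of `x`. If `y` is in the piece of `x`, the spike becomes the new
  -- common room; otherwise the path leaves through the gate.
  have main : ∀ k σ x, KochBranch s α₁ k σ x → IsKochSegment s α₁ k σ → ∀ H,
      IsKochRoom s α₁ H → LeftOf H σ → ∀ y D, LiesOver s α₁ H y →
      JoinedWithin (snowflake s α₁) D x y → F x y ≤ ENNReal.ofReal (3 * C' * D ^ e) := by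
    intro k σ x hx
    induction hx with
    | @spike k σ x hx =>
      intro hσ H hH hL y D hy h
      by_cases hyσ : KochPiece s α₁ k σ y
      · refine (simple _ (Or.inr ⟨k, σ, hσ, rfl⟩) x y D (spike_subset_closure_spikeInterior
          (hσ.ne hp) (hp.ratio_pos k) (hp.ratio_lt k) hx) (hyσ.liesOver hp hσ) h).trans
          (ENNReal.ofReal_le_ofReal ?_)
        have := h.nonneg
        gcongr
        norm_num
      · exact hpiece k σ H hσ hH hL x y D (Or.inl hx) hyσ hy h
    | @child k σ x c hx ih =>
      intro hσ H hH hL y D hy h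
      by_cases hc : c = 0 ∨ c = 3
      · exact ih (hσ.child c) H hH (leftOf_kochChild_outer hp hσ hL hc) y D hy h
      · have hc' : c = 1 ∨ c = 2 := by fin_cases c <;> simp_all
        by_cases hyσ : KochPiece s α₁ k σ y
        · exact ih (hσ.child c) _ (Or.inr ⟨k, σ, hσ, rfl⟩) (leftOf_kochChild_inner hp hσ hc') y D
            (hyσ.liesOver hp hσ) h
        · refine hpiece k σ H hσ hH hL x y D ?_ hyσ hy h
          rcases hc' with rfl | rfl
          · exact Or.inr (Or.inl hx)
          · exact Or.inr (Or.inr hx)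
  refine ⟨3 * C', by positivity, fun x y D h => ?_⟩
  have hroom0 : IsKochRoom s α₁ kochTriangle := Or.inl rfl
  have hy : LiesOver s α₁ kochTriangle y := by
    rcases mem_snowflake_iff.1 h.right_mem with hy | ⟨j, hy⟩
    · exact Or.inl (subset_closure hy)
    · exact hy.liesOver hp (.side j) (leftOf_kochTriangle j)
  rcases mem_snowflake_iff.1 h.left_mem with hx | ⟨j, hx⟩
  · refine (simple _ hroom0 x y D (subset_closure hx) hy h).trans (ENNReal.ofReal_le_ofReal ?_)
    have := h.nonneg
    gcongr
    norm_num
  · exact main 0 _ x hx (.side j) _ hroom0 (leftOf_kochTriangle j) y D hy h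

/-- The gauges are Hölder continuous with respect to the internal distance. -/
theorem IsRoomGauge.exists_hoelder : ∃ K, 0 < K ∧ ∀ x y,
    rhoEDist (snowflake s α₁) (fun _ => 1) x y ≠ ∞ →
    F x y ≤ ENNReal.ofReal (K * (rhoEDist (snowflake s α₁) (fun _ => 1) x y).toReal ^ e) := by
  obtain ⟨K, hK, h⟩ := hF.exists_joinedWithin_bound hp
  refine ⟨K, hK, fun x y hfin => ?_⟩
  set d := (rhoEDist (snowflake s α₁) (fun _ => 1) x y).toReal with hd
  have ht : Tendsto (fun r : ℝ => ENNReal.ofReal (K * r ^ e)) (𝓝[>] d)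
      (𝓝 (ENNReal.ofReal (K * d ^ e))) :=
    ((ENNReal.continuous_ofReal.comp (continuous_const.mul
      (Real.continuous_rpow_const hF.exp_pos.le))).tendsto d).mono_left nhdsWithin_le_nhds
  -- The infimum of lengths need not be attained, so the bound is taken for every `r > d` and passed
  -- to the limit.
  refine ge_of_tendsto ht ?_
  filter_upwards [self_mem_nhdsWithin] with r hr
  have hr' : rhoEDist (snowflake s α₁) (fun _ => 1) x y < ENNReal.ofReal r :=
    (ENNReal.lt_ofReal_iff_toReal_lt hfin).2 hr
  obtain ⟨γ, L, hγ, hL⟩ := exists_curve_of_rhoEDist_one_lt hr'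
  refine (h x y L hγ.joinedWithin).trans (ENNReal.ofReal_le_ofReal ?_)
  have := hγ.nonneg
  have := hF.exp_pos
  gcongr

end Hoelder

/-! ### The width of the branches -/

section Width

variable {s α₁ : ℝ} {k : ℕ} {σ : ℂ × ℂ} {z : ℂ} (hp : KochParameters s α₁)
include hp

/-- A point of the segment that belongs to the domain lies on the base of a spike over a subsegment,
and the left end of this base is outside of the domain. -/
theorem IsKochSegment.exists_notMem_of_segY_eq_zero (hσ : IsKochSegment s α₁ k σ)
    (h0 : segY σ z = 0) (h1 : 0 ≤ segX σ z) (h2 : segX σ z ≤ 1) :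
    ∃ e ∉ snowflake s α₁, dist z e ≤ kochLength s α₁ k ^ (2 - 2 * s) / 2 := by
  by_cases hz : z ∈ snowflake s α₁
  · have hb := hσ.branch_of_mem_closedTent hp.s_lt hp.pos hp.lt hz
      ⟨h0.ge, by linarith, by linarith⟩
    obtain ⟨k', τ, hτ, ⟨p, l, hp0, hl, hpl, hnorm, hco⟩, hx⟩ := hb.exists_piece hp hσ
    have hY : segY τ z = 0 := by
      have := (hco z).2
      rw [h0] at this
      exact (mul_eq_zero.1 this.symm).resolve_left hl.ne'
    have hne := hτ.ne hp
    have hbase := (hx.mem_spikeBase_or_pos hp.s_lt hp.pos hp.lt hne).resolve_right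
      (fun h => h.1.ne' hY)
    obtain ⟨-, h3, h4⟩ := (mem_spikeBase_iff hne (hp.ratio_pos k')).1 hbase
    refine ⟨_, (hτ.child 1).fst_notMem hp.s_lt hp.pos hp.lt, ?_⟩
    have e : (kochChild (kochRatio s α₁ (k' + 1)) τ 1).1 =
        segPoint τ (1 / 2 - kochRatio s α₁ (k' + 1) / 2) 0 := by
      rw [← baseLeft_eq]; rfl
    rw [e]
    refine (dist_le_of_coords hne _ _).trans ?_
    rw [segX_segPoint hne, segY_segPoint hne, hY, sub_zero, abs_zero, add_zero, hτ.norm hp,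
      abs_of_nonneg (by linarith)]
    have hk' := hp.length_pos k'
    have hle : kochLength s α₁ k' ≤ kochLength s α₁ k := by
      rw [hτ.norm hp, hσ.norm hp] at hnorm
      have := hp.length_pos k
      nlinarith
    have := hp.s_lt
    calc (segX τ z - (1 / 2 - kochRatio s α₁ (k' + 1) / 2)) * kochLength s α₁ k'
        ≤ kochRatio s α₁ (k' + 1) * kochLength s α₁ k' := by gcongr; linarith
      _ ≤ kochLength s α₁ k' ^ (2 - 2 * s) / 2 := kochRatio_mul_kochLength_le hp.lt k'
      _ ≤ _ := by
        have : 0 ≤ 2 - 2 * s := by linarith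
        gcongr
  · exact ⟨z, hz, by
      have := hp.length_pos k
      rw [dist_self]; positivity⟩

/-- The branch over a segment of length `l` is contained in the `l^(2 - 2 s)`-neighbourhood of the
boundary. -/
theorem KochBranch.bdryDist_le (hσ : IsKochSegment s α₁ k σ) (h : KochBranch s α₁ k σ z) :
    bdryDist (snowflake s α₁) z ≤ kochLength s α₁ k ^ (2 - 2 * s) := by
  have hs := hp.s_lt
  have hmono : ∀ k, kochLength s α₁ (k + 1) ^ (2 - 2 * s) ≤ kochLength s α₁ k ^ (2 - 2 * s) :=
    fun k => Real.rpow_le_rpow (hp.length_pos _).le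
      (kochLength_antitone hp.pos hp.lt (Nat.le_succ k)) (by linarith)
  induction h with
  | @spike k σ z h =>
    have hne := hσ.ne hp
    have h0 := hp.ratio_pos k
    have h1 := hp.ratio_lt k
    have hη := spikeHeight_pos h1
    set η := spikeHeight (kochRatio s α₁ (k + 1))
    set α := kochRatio s α₁ (k + 1)
    obtain ⟨h2, h3, h4⟩ := (mem_spike_iff hne h0 h1).1 h
    have hYη : segY σ z < η := by nlinarith
    set t := segY σ z / η with ht
    have ht0 : 0 ≤ t := by positivity
    have ht1 : t ≤ 1 := (div_le_one hη).2 hYη.le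
    have hY : segY σ z = t * η := by rw [ht]; field_simp
    rw [hY] at h3 h4
    have h3' : segX σ z - 1 / 2 < α / 2 * (1 - t) := by
      by_contra hcon
      nlinarith [mul_le_mul_of_nonneg_left (not_lt.1 hcon) hη.le]
    have h4' : 1 / 2 - segX σ z < α / 2 * (1 - t) := by
      by_contra hcon
      nlinarith [mul_le_mul_of_nonneg_left (not_lt.1 hcon) hη.le]
    have hne1 := (hσ.child 1).ne hp
    -- The point of the left side of the spike at the height of `z`. It is within `α l` of `z`, and
    -- a point outside of the domain is close to `p`; each distance is at most half of the claimed
    -- bound.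
    set p := segPoint (kochChild α σ 1) t 0 with hpdef
    have hpX := segX_segPoint hne1 t 0
    have hpY := segY_segPoint hne1 t 0
    obtain ⟨e1, e2⟩ := (kochChild_one_coords hne h1).2.2 p
    rw [hpX, hpY] at e1 e2
    obtain ⟨e, he, hpe⟩ := (hσ.child 1).exists_notMem_of_segY_eq_zero hp hpY
      (hpX.symm ▸ ht0) (hpX.symm ▸ ht1)
    have hzp : dist z p ≤ kochLength s α₁ k ^ (2 - 2 * s) / 2 := by
      refine (dist_le_of_coords hne _ _).trans ?_
      rw [e1, e2, hY, hσ.norm hp]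
      refine le_trans ?_ (kochRatio_mul_kochLength_le hp.lt k)
      refine mul_le_mul_of_nonneg_right ?_ (hp.length_pos k).le
      have : t * η - (t * spikeHeight α + 0 * (α / 2)) = 0 := by ring
      rw [this, abs_zero, add_zero, abs_le]
      have : 0 ≤ α * t := by positivity
      constructor <;> nlinarith
    have hzΩ := hσ.spike_subset h
    have := bdryDist_le_dist hzΩ he
    have := dist_triangle z p e
    have := hmono k
    linarith
  | child c h ih => exact (ih (hσ.child c)).trans (hmono _)

theorem KochBranch.le_density (hσ : IsKochSegment s α₁ k σ) (h : KochBranch s α₁ k σ z) :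
    kochLength s α₁ k ^ (s - 1) ≤ snowflakeDensity s α₁ z := by
  have hd := bdryDist_pos hp.isOpen hp.frontier_nonempty (h.mem_snowflake hσ)
  have e : kochLength s α₁ k ^ (s - 1) = (kochLength s α₁ k ^ (2 - 2 * s)) ^ (-1 / 2 : ℝ) := by
    rw [← Real.rpow_mul (hp.length_pos k).le]; ring_nf
  rw [e]
  exact Real.rpow_le_rpow_of_nonpos hd (h.bdryDist_le hp hσ) (by norm_num)

theorem KochParameters.exists_bdryDist_le : ∃ R, 0 < R ∧ ∀ z ∈ snowflake s α₁,
    bdryDist (snowflake s α₁) z ≤ R := by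
  have h0 := (IsKochSegment.side (s := s) (α₁ := α₁) 0).fst_notMem hp.s_lt hp.pos hp.lt
  refine ⟨3 + dist (1 / 2 + (1 / 4 : ℝ) * Complex.I) (triangleSide 0).1, by positivity,
    fun z hz => ?_⟩
  have hd : 0 ≤ dist (1 / 2 + (1 / 4 : ℝ) * Complex.I) (triangleSide 0).1 := dist_nonneg
  rcases mem_snowflake_iff.1 hz with hz' | ⟨j, hj⟩
  · have h1 := bdryDist_le_dist hz h0
    have h2 := ball_subset_kochTriangle.2 hz'
    rw [Metric.mem_closedBall] at h2
    have := dist_triangle z (1 / 2 + (1 / 4 : ℝ) * Complex.I) (triangleSide 0).1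
    linarith
  · have := hj.bdryDist_le hp (.side j)
    simp only [kochLength, Real.one_rpow] at this
    linarith

theorem KochParameters.exists_le_density : ∃ m, 0 < m ∧ ∀ z ∈ snowflake s α₁,
    m ≤ snowflakeDensity s α₁ z := by
  obtain ⟨R, hR, h⟩ := hp.exists_bdryDist_le
  exact ⟨R ^ (-1 / 2 : ℝ), by positivity, fun z hz =>
    Real.rpow_le_rpow_of_nonpos (bdryDist_pos hp.isOpen hp.frontier_nonempty hz) (h z hz)
      (by norm_num)⟩

theorem KochParameters.continuousOn_density :
    ContinuousOn (snowflakeDensity s α₁) (snowflake s α₁) :=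
  continuousOn_bdryDist_rpow hp.isOpen hp.frontier_nonempty _

/-- The gates of the pieces are too narrow for a John domain. -/
theorem KochParameters.not_isJohn : ¬ IsJohn (snowflake s α₁) := by
  rintro ⟨α, hα, -, x₀, hx₀, hJ⟩
  obtain ⟨c₀, hc₀, hheight⟩ := exists_height_bound hp
  have hd := bdryDist_pos hp.isOpen hp.frontier_nonempty hx₀
  have hs := hp.s_lt
  have ht : ∀ e : ℝ, 0 < e → Tendsto (fun k => kochLength s α₁ k ^ e) atTop (𝓝 0) := fun e he => by
    have := (tendsto_kochLength (s := s) hp.pos hp.lt).rpow_const (p := e) (Or.inr he.le)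
    rwa [Real.zero_rpow he.ne'] at this
  -- The first condition keeps `x₀` out of the piece. The second makes the gate too narrow: a curve
  -- from behind it arrives at a time `t ≥ c₀ l_k / 4`, where the distance to the boundary is at
  -- most `l_k ^ (2 - 2s) < α t`.
  obtain ⟨k, hk1, hk2⟩ := (((ht (2 - 2 * s) (by linarith)).eventually_lt_const hd).and
    ((ht (1 - 2 * s) (by linarith)).eventually_lt_const
      (show 0 < α * c₀ / 4 by positivity))).exists
  set σ := kochSegment s α₁ 0 (fun _ => 1) k with hσdef
  have hσ : IsKochSegment s α₁ k σ := isKochSegment_kochSegment 0 _ k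
  have hτ := hσ.child 1
  set τ := kochChild (kochRatio s α₁ (k + 1)) σ 1
  have hmid := segMid_mem_spike (hτ.ne hp) (hp.ratio_pos (k + 1))
  have hPτ : KochPiece s α₁ (k + 1) τ (segMid τ) := Or.inl hmid
  have hP : KochPiece s α₁ k σ (segMid τ) := Or.inr (Or.inl (.spike hmid))
  have hx₀P : ¬ KochPiece s α₁ k σ x₀ := fun h =>
    absurd (h.branch.bdryDist_le hp hσ) (not_le.2 hk1)
  obtain ⟨γ, L, hγ, hcone⟩ := hJ _ (hτ.segMid_mem hp)
  obtain ⟨t, ht, htB, -⟩ := exists_crossing hγ.nonneg hγ.continuousOn hγ.mem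
    (hσ.kochPiece_closed hp.s_lt hp.pos hp.lt) (hσ.kochPiece_open hp.s_lt hp.pos hp.lt)
    (show KochPiece s α₁ k σ (γ 0) by rw [hγ.start]; exact hP)
    (show ¬ KochPiece s α₁ k σ (γ L) by rw [hγ.finish]; exact hx₀P)
  have h1 := hheight k σ 1 (k + 1) τ _ _ hσ (Or.inl rfl) hτ (.refl _) hPτ htB
  have h2 : dist (segMid τ) (γ t) ≤ t := by
    have := hγ.dist_le ⟨le_rfl, hγ.nonneg⟩ ht
    rwa [hγ.start, zero_sub, abs_neg, abs_of_nonneg ht.1] at this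
  have h3 := hcone t ht
  have h4 := (KochBranch.spike (s := s) (α₁ := α₁) (Or.inr htB)).bdryDist_le hp hσ
  have h5 := quarter_le_kochLength_succ hp.s_lt hp.pos hp.lt k
  have hl := hp.length_pos k
  have h6 : kochLength s α₁ k ^ (2 - 2 * s) =
      kochLength s α₁ k ^ (1 - 2 * s) * kochLength s α₁ k := by
    rw [← Real.rpow_add_one hl.ne']; ring_nf
  have h7 : c₀ * (kochLength s α₁ k / 4) ≤ t :=
    (mul_le_mul_of_nonneg_left h5 hc₀.le).trans (h1.trans h2)
  have h8 := mul_le_mul_of_nonneg_left h7 hα.le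
  have h9 := mul_lt_mul_of_pos_right hk2 hl
  rw [h6] at h4
  linarith

/-! ### The two completions of the domain -/

/-- The identity is Lipschitz from `d_ρ` to `d` because `ρ` is bounded below, and Hölder with
exponent `s` from `d` to `d_ρ`; both directions extend. -/
theorem KochParameters.exists_completion_maps :
    ∃ (φ : RhoClosure (snowflake s α₁) (snowflakeDensity s α₁) → InternalClosure (snowflake s α₁))
      (ψ : InternalClosure (snowflake s α₁) →
        RhoClosure (snowflake s α₁) (snowflakeDensity s α₁)), Continuous φ ∧ Continuous ψ ∧
      (∀ x, φ (toRhoClosure _ _ x) = toRhoClosure _ _ x) ∧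
      (∀ x, ψ (toRhoClosure _ _ x) = toRhoClosure _ _ x) := by
  have hc := hp.isConnected.isPreconnected
  obtain ⟨m, hm, hρ⟩ := hp.exists_le_density
  obtain ⟨C, hC⟩ := exists_isRoomGauge_density hp
  obtain ⟨K, hK, hhold⟩ := hC.exists_hoelder hp
  obtain ⟨φ, hφ, hφΩ⟩ := exists_extension_rhoClosure (Ω := snowflake s α₁)
    (ρ := snowflakeDensity s α₁) (toRhoClosure (snowflake s α₁) fun _ => 1) (C := 1 / m) one_pos
    (fun x y => by
      have hfin := rhoEDist_ne_top hp.isOpen hc hp.continuousOn_density x.2 y.2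
      rw [Real.rpow_one]
      refine dist_toRhoClosure_le hp.isOpen hc continuousOn_const (by positivity)
        ((rhoEDist_one_le_mul hm hρ _ _).trans_eq ?_)
      rw [dist_toRhoClosure hp.isOpen hc hp.continuousOn_density, ENNReal.ofReal_mul (by positivity),
        ENNReal.ofReal_toReal hfin])
  obtain ⟨ψ, hψ, hψΩ⟩ := exists_extension_rhoClosure (Ω := snowflake s α₁)
    (ρ := fun _ => 1) (toRhoClosure (snowflake s α₁) (snowflakeDensity s α₁)) (C := K) hp.s_pos
    (fun x y => by
      have hfin := rhoEDist_ne_top hp.isOpen hc (continuousOn_const (c := (1 : ℝ))) x.2 y.2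
      refine dist_toRhoClosure_le hp.isOpen hc hp.continuousOn_density (by positivity) ?_
      rw [dist_toRhoClosure hp.isOpen hc continuousOn_const]
      exact hhold _ _ hfin)
  exact ⟨φ, ψ, hφ, hψ, hφΩ, hψΩ⟩

end Width

/-! ### Points with a given address -/

section Addresses

variable {s α₁ : ℝ} {k : ℕ} {σ : ℂ × ℂ} {z : ℂ}

theorem segMid_eq_midpoint (σ : ℂ × ℂ) : segMid σ = midpoint ℝ σ.1 σ.2 := by
  rw [midpoint_eq_smul_add, segMid, segPoint, Complex.real_smul]
  push_cast
  rw [invOf_eq_inv]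
  push_cast
  ring

theorem KochBranch.kochSegment_of_le {j : Fin 3} {a : ℕ → Fin 4} {n : ℕ} (hkn : k ≤ n)
    (h : KochBranch s α₁ n (kochSegment s α₁ j a n) z) :
    KochBranch s α₁ k (kochSegment s α₁ j a k) z := by
  induction n, hkn using Nat.le_induction with
  | base => exact h
  | succ n _ ih => exact ih (.child (a n) h)

variable (hp : KochParameters s α₁)

/-- The midpoints of the nested segments with a given address. -/
def addressMid (j : Fin 3) (a : ℕ → Fin 4) (n : ℕ) : snowflake s α₁ :=
  ⟨segMid (kochSegment s α₁ j a n), (isKochSegment_kochSegment j a n).segMid_mem hp⟩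

include hp

theorem branch_addressMid {j : Fin 3} {a : ℕ → Fin 4} {n : ℕ} (hkn : k ≤ n) :
    KochBranch s α₁ k (kochSegment s α₁ j a k) (addressMid hp j a n) :=
  KochBranch.kochSegment_of_le hkn (.spike (segMid_mem_spike
    ((isKochSegment_kochSegment j a n).ne hp) (hp.ratio_pos n)))

/-- The points with given addresses, in the completion with respect to a gauge. -/
theorem exists_addressPoint {ρ : ℂ → ℝ} (hρ : ContinuousOn ρ (snowflake s α₁)) {C e : ℝ}
    (hF : IsRoomGauge s α₁ (rhoEDist (snowflake s α₁) ρ) C e) (j : Fin 3) :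
    ∃ P : (ℕ → Fin 4) → RhoClosure (snowflake s α₁) ρ,
      (∀ a, Tendsto (fun n => toRhoClosure _ ρ (addressMid hp j a n)) atTop (𝓝 (P a))) ∧
      ∃ C', 0 < C' ∧ ∀ a b k, (∀ i < k, a i = b i) →
        dist (P a) (P b) ≤ C' * ((1 / 2 : ℝ) ^ e) ^ k := by
  have hc := hp.isConnected.isPreconnected
  obtain ⟨C₁, hC₁, hmid⟩ := hF.exists_segMid_le hp
  have hl : ∀ k, kochLength s α₁ k ^ e ≤ ((1 / 2 : ℝ) ^ e) ^ k := fun k => by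
    rw [← Real.rpow_natCast, ← Real.rpow_mul (by norm_num), mul_comm, Real.rpow_mul (by norm_num),
      Real.rpow_natCast]
    exact Real.rpow_le_rpow (hp.length_pos k).le (kochLength_le_pow hp.pos hp.lt k) hF.exp_pos.le
  have key : ∀ a b k n n', (∀ i < k, a i = b i) → k ≤ n → k ≤ n' →
      dist (toRhoClosure _ ρ (addressMid hp j a n)) (toRhoClosure _ ρ (addressMid hp j b n')) ≤
        2 * C₁ * ((1 / 2 : ℝ) ^ e) ^ k := by
    intro a b k n n' hab hn hn'
    refine dist_toRhoClosure_le hp.isOpen hc hρ (by positivity) ?_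
    have h1 := hmid k _ _ (isKochSegment_kochSegment j a k) (branch_addressMid hp (a := a) hn)
    have h2 := hmid k _ _ (isKochSegment_kochSegment j b k) (branch_addressMid hp (a := b) hn')
    rw [← kochSegment_congr hab, hF.symm] at h2
    refine (hF.triangle _ _ _).trans ((add_le_add h1 h2).trans ?_)
    have := hp.length_pos k
    rw [← ENNReal.ofReal_add (by positivity) (by positivity)]
    refine ENNReal.ofReal_le_ofReal ?_
    have := mul_le_mul_of_nonneg_left (hl k) hC₁.le
    linarith
  have hlim : ∀ a, ∃ p, Tendsto (fun n => toRhoClosure _ ρ (addressMid hp j a n)) atTop (𝓝 p) := by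
    intro a
    refine cauchySeq_tendsto_of_complete (cauchySeq_of_le_tendsto_0
      (fun k => 2 * C₁ * ((1 / 2 : ℝ) ^ e) ^ k)
      (fun n m N hn hm => key a a N n m (fun _ _ => rfl) hn hm) ?_)
    have := (tendsto_pow_atTop_nhds_zero_of_lt_one (r := (1 / 2 : ℝ) ^ e) (by positivity)
      (Real.rpow_lt_one (by norm_num) (by norm_num) hF.exp_pos)).const_mul (2 * C₁)
    rwa [mul_zero] at this
  choose P hP using hlim
  refine ⟨P, hP, 2 * C₁, by positivity, fun a b k hab => ?_⟩
  refine le_of_tendsto ((hP a).dist (hP b)) ?_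
  filter_upwards [eventually_ge_atTop k] with n hn
  exact key a b k n n hab hn hn

/-- Points whose addresses have digits `1`, `2` and differ are far from each other. -/
theorem exists_address_separation : ∃ c, 0 < c ∧ ∀ (ρ : ℂ → ℝ) (e m : ℝ), 0 ≤ e → 0 < m →
    (∀ k σ z, IsKochSegment s α₁ k σ → KochBranch s α₁ k σ z →
      m * kochLength s α₁ k ^ (e - 1) ≤ ρ z) →
    ∀ (j : Fin 3) (a b : ℕ → Fin 4) (k n : ℕ), (∀ i, a i = 1 ∨ a i = 2) →
      (∀ i < k, a i = b i) → a k ≠ b k → k + 3 ≤ n →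
      ENNReal.ofReal (m * c ^ (e + 1) * ((1 / 2 : ℝ) ^ e) ^ k) ≤
        rhoEDist (snowflake s α₁) ρ (addressMid hp j a n) (addressMid hp j b n) := by
  obtain ⟨c₀, hc₀, hheight⟩ := exists_height_bound hp
  obtain ⟨c₁, hc₁, hlow⟩ := exists_le_kochLength hp.s_lt hp.pos hp.lt
  set c := min (c₀ / 4) (c₁ / 2) with hcdef
  have hc : 0 < c := lt_min (by positivity) (by positivity)
  refine ⟨c, hc, fun ρ e m he hm hρ j a b k n ha hab hk hn => ?_⟩
  set σ₀ := kochSegment s α₁ j a k with hσ₀def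
  have hσ₀ : IsKochSegment s α₁ k σ₀ := isKochSegment_kochSegment j a k
  set σ := kochSegment s α₁ j a (k + 1) with hσdef
  have hσ : IsKochSegment s α₁ (k + 1) σ := isKochSegment_kochSegment j a (k + 1)
  have hτ := isKochSegment_kochSegment (s := s) (α₁ := α₁) j a (k + 2)
  have piece : ∀ i, i + 1 ≤ n → KochPiece s α₁ i (kochSegment s α₁ j a i) (addressMid hp j a n) := by
    intro i hi
    have := branch_addressMid hp (j := j) (a := a) hi
    rcases ha i with h | h <;> simp only [kochSegment, h] at this
    · exact Or.inr (Or.inl this)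
    · exact Or.inr (Or.inr this)
  -- The addresses part at `σ₀`, so the point with address `b` is in the tent over another child of
  -- `σ₀`.
  have hbn : ¬ KochPiece s α₁ (k + 1) σ (addressMid hp j b n) := by
    intro h
    have h1 := h.branch.mem_closedTent hp hσ
    have h2 := (branch_addressMid hp (j := j) (a := b) (show k + 1 ≤ n by omega)).mem_tent
      hp.s_lt hp.pos hp.lt ((isKochSegment_kochSegment j b (k + 1)).ne hp)
    simp only [kochSegment] at h2
    rw [← kochSegment_congr hab] at h2
    exact disjoint_left.1 (disjoint_closedTent_tent (hσ₀.ne hp) (hp.ratio_pos k) (hp.ratio_lt k) hk)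
      h1 h2
  have hl := hp.length_pos (k + 1)
  -- Leaving the piece over `σ` takes length at least `c₀ l_{k+2}` with weight at least `m l_{k+1} ^
  -- (e - 1)`, of order `l_{k+1} ^ e` in total. One further generation, and so `k + 3 ≤ n`, keeps
  -- the starting point away from the gate.
  refine le_trans (ENNReal.ofReal_le_ofReal ?_) (le_rhoEDist_of_crossing
    (P := {z | KochPiece s α₁ (k + 1) σ z}) (B := spikeBase (kochRatio s α₁ (k + 1 + 1)) σ)
    (m := m * kochLength s α₁ (k + 1) ^ (e - 1)) (δ := c₀ * kochLength s α₁ (k + 2))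
    (hσ.kochPiece_closed hp.s_lt hp.pos hp.lt)
    (hσ.kochPiece_open hp.s_lt hp.pos hp.lt) (piece (k + 1) (by omega)) hbn (by positivity)
    (fun z hz => hρ _ _ z hσ (KochPiece.branch hz))
    (fun z hz => hheight (k + 1) σ (a (k + 1)) (k + 2) _ _ z hσ (ha _) hτ (.refl _)
      (piece (k + 2) (by omega)) hz))
  have h4 := quarter_le_kochLength_succ hp.s_lt hp.pos hp.lt (k + 1)
  have h5 : c * (1 / 2) ^ k ≤ kochLength s α₁ (k + 1) := by
    refine le_trans ?_ (hlow (k + 1))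
    rw [pow_succ]
    have : c ≤ c₁ / 2 := min_le_right _ _
    have h2 : (0 : ℝ) < (1 / 2) ^ k := by positivity
    nlinarith
  have h6 : c ^ e * ((1 / 2 : ℝ) ^ e) ^ k ≤ kochLength s α₁ (k + 1) ^ e := by
    have : ((1 / 2 : ℝ) ^ e) ^ k = ((1 / 2 : ℝ) ^ k) ^ e := by
      rw [← Real.rpow_natCast, ← Real.rpow_mul (by norm_num), mul_comm,
        Real.rpow_mul (by norm_num), Real.rpow_natCast]
    rw [this, ← Real.mul_rpow hc.le (by positivity)]
    exact Real.rpow_le_rpow (by positivity) h5 he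
  have h7 : c ≤ c₀ / 4 := min_le_left _ _
  have h8 : kochLength s α₁ (k + 1) ^ (e - 1) * kochLength s α₁ (k + 1) =
      kochLength s α₁ (k + 1) ^ e := by
    rw [← Real.rpow_add_one hl.ne']; ring_nf
  calc m * c ^ (e + 1) * ((1 / 2 : ℝ) ^ e) ^ k
      = m * (c ^ e * ((1 / 2 : ℝ) ^ e) ^ k) * c := by rw [Real.rpow_add_one hc.ne']; ring
    _ ≤ m * kochLength s α₁ (k + 1) ^ e * (c₀ / 4) := by gcongr
    _ = m * kochLength s α₁ (k + 1) ^ (e - 1) * (c₀ * (kochLength s α₁ (k + 1) / 4)) := by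
      rw [← h8]; ring
    _ ≤ _ := by gcongr

/-- Limits of midpoints of nested segments do not belong to the domain. -/
theorem notMem_range_of_tendsto_addressMid {ρ : ℂ → ℝ} {φ : RhoClosure (snowflake s α₁) ρ →
    InternalClosure (snowflake s α₁)} (hφ : Continuous φ)
    (hφΩ : ∀ x, φ (toRhoClosure _ _ x) = toRhoClosure _ _ x) {j : Fin 3} {a : ℕ → Fin 4}
    {p : RhoClosure (snowflake s α₁) ρ}
    (h : Tendsto (fun n => toRhoClosure _ ρ (addressMid hp j a n)) atTop (𝓝 p)) :
    p ∈ rhoBoundary (snowflake s α₁) ρ := by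
  rintro ⟨z, rfl⟩
  obtain ⟨f, hf, hfΩ⟩ := exists_internalClosure_map hp.isOpen hp.isConnected.isPreconnected
  have h1 := ((hf.continuous.comp hφ).tendsto _).comp h
  simp only [Function.comp_def, hφΩ, hfΩ] at h1
  have hd := bdryDist_pos hp.isOpen hp.frontier_nonempty z.2
  have hs := hp.s_lt
  have ht := (tendsto_kochLength (s := s) hp.pos hp.lt).rpow_const (p := 2 - 2 * s)
    (Or.inr (by linarith))
  rw [Real.zero_rpow (by linarith)] at ht
  obtain ⟨k, hk⟩ := (ht.eventually_lt_const hd).exists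
  have hσ := isKochSegment_kochSegment (s := s) (α₁ := α₁) j a k
  -- A limit inside the domain would lie in the branch over a very short segment, where the distance
  -- to the boundary is smaller than it is at `z`.
  have hz : (z : ℂ) ∈ closedTent (kochSegment s α₁ j a k) := by
    refine isClosed_closedTent.mem_of_tendsto h1 ?_
    filter_upwards [eventually_ge_atTop k] with n hn
    exact (branch_addressMid hp hn).mem_closedTent hp hσ
  exact absurd ((hσ.branch_of_mem_closedTent hp.s_lt hp.pos hp.lt z.2 hz).bdryDist_le hp hσ)
    (not_le.2 hk)

end Addresses

/-! ### The dimension of the Cantor set -/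

section CantorDimension

variable {s α₁ : ℝ} (hp : KochParameters s α₁)
include hp

omit hp in
/-- The two digits of the sides of the new spikes. -/
def spikeDigit : Fin 2 → Fin 4 := ![1, 2]

omit hp in
theorem spikeDigit_eq (i : Fin 2) : spikeDigit i = 1 ∨ spikeDigit i = 2 := by
  fin_cases i <;> simp [spikeDigit]

omit hp in
theorem spikeDigit_injective : Function.Injective spikeDigit := by decide

/-- Upper and lower estimates both have the ratio `θ = 2 ^ (-e)`, and `θ ^ (1 / e) = 1/2`. It is
applied with `e = s` for the density and `e = 1` for the internal metric. -/
theorem exists_cantor_dimension {ρ : ℂ → ℝ} (hρ : ContinuousOn ρ (snowflake s α₁)) {C e m : ℝ}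
    (hF : IsRoomGauge s α₁ (rhoEDist (snowflake s α₁) ρ) C e) (hm : 0 < m)
    (hlow : ∀ k σ z, IsKochSegment s α₁ k σ → KochBranch s α₁ k σ z →
      m * kochLength s α₁ k ^ (e - 1) ≤ ρ z) (j : Fin 3) :
    ∃ P : (ℕ → Fin 4) → RhoClosure (snowflake s α₁) ρ,
      (∀ a, Tendsto (fun n => toRhoClosure _ ρ (addressMid hp j a n)) atTop (𝓝 (P a))) ∧
      dimH (range fun b : ℕ → Fin 2 => P fun i => spikeDigit (b i)) = ENNReal.ofReal (1 / e) ∧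
      packingDim (range fun b : ℕ → Fin 2 => P fun i => spikeDigit (b i)) =
        ENNReal.ofReal (1 / e) := by
  have he := hF.exp_pos
  have hc := hp.isConnected.isPreconnected
  obtain ⟨P, hP, C', hC', hup⟩ := exists_addressPoint hp hρ hF j
  obtain ⟨c, hc0, hsep⟩ := exists_address_separation hp
  have hθ : 0 < (1 / 2 : ℝ) ^ e := by positivity
  have hθ' : (1 / 2 : ℝ) ^ e < 1 := Real.rpow_lt_one (by norm_num) (by norm_num) he
  have hθD : ((1 / 2 : ℝ) ^ e) ^ (1 / e) = 1 / 2 := by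
    rw [← Real.rpow_mul (by norm_num), mul_one_div_cancel he.ne', Real.rpow_one]
  have h1 : ENNReal.ofReal (1 / e) ≤
      dimH (range fun b : ℕ → Fin 2 => P fun i => spikeDigit (b i)) := by
    refine dimH_range_ge_of_binary (c := m * c ^ (e + 1)) (by positivity) hθ (by positivity) hθD
      fun a b k hab hk => ?_
    refine ge_of_tendsto ((hP _).dist (hP _)) ?_
    filter_upwards [eventually_ge_atTop (k + 3)] with n hn
    refine le_dist_toRhoClosure hp.isOpen hc hρ (hsep ρ e m he.le hm hlow j _ _ k n
      (fun i => spikeDigit_eq _) (fun i hi => by rw [hab i hi]) (fun h => hk ?_) hn)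
    exact spikeDigit_injective h
  have h2 : packingDim (range fun b : ℕ → Fin 2 => P fun i => spikeDigit (b i)) ≤
      ENNReal.ofReal (1 / e) :=
    packingDim_range_le_of_binary hC' hθ hθ' hθD fun a b k hab =>
      hup _ _ k fun i hi => by rw [hab i hi]
  have h3 := dimH_le_packingDim (range fun b : ℕ → Fin 2 => P fun i => spikeDigit (b i))
  exact ⟨P, hP, le_antisymm (h3.trans h2) h1, le_antisymm h2 (h1.trans h3)⟩

end CantorDimension

/-! ### The internal boundary has packing dimension at most two -/

section BoxCounting

theorem Coverable.of_index {X ι : Type*} [PseudoMetricSpace X] [DecidableEq ι] {A : Set X}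
    {δ : ℝ} (f : X → ι) (T : Finset ι) (hf : ∀ x ∈ A, f x ∈ T)
    (h : ∀ x ∈ A, ∀ y ∈ A, f x = f y → dist x y ≤ δ) : Coverable A T.card δ := by
  classical
  refine ⟨T.image fun i => {x ∈ A | f x = i}, by exact_mod_cast Finset.card_image_le,
    fun x hx => ?_, ?_⟩
  · exact ⟨{y ∈ A | f y = f x}, by
      simpa using ⟨f x, hf x hx, rfl⟩, hx, rfl⟩
  · intro S hS x hx y hy
    obtain ⟨i, -, rfl⟩ := Finset.mem_image.1 hS
    exact h x hx.1 y hy.1 (hx.2.trans hy.2.symm)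

/-- A bounded set in the plane on which the metric is dominated by the Euclidean one is covered
by the cells of a grid. -/
theorem coverable_of_dist_le {X : Type*} [PseudoMetricSpace X] {A : Set X} (g : X → ℂ)
    (hg : ∀ x ∈ A, ∀ y ∈ A, dist x y ≤ dist (g x) (g y)) {c : ℂ} {η : ℝ} (hη : 0 < η) (j : ℕ)
    (hc : ∀ x ∈ A, dist (g x) c ≤ η * 2 ^ j) : Coverable A (9 * 4 ^ j) (2 * η) := by
  set N : ℤ := 2 ^ j with hN
  have hN1 : 1 ≤ N := one_le_pow₀ (by norm_num)
  set f : X → ℤ × ℤ := fun x => (⌊(g x - c).re / η⌋, ⌊(g x - c).im / η⌋) with hf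
  have hfl : ∀ t : ℝ, |t| ≤ η * 2 ^ j → ⌊t / η⌋ ∈ Finset.Icc (-N) N := fun t ht => by
    obtain ⟨h1, h2⟩ := abs_le.1 ht
    rw [Finset.mem_Icc]
    constructor
    · rw [Int.le_floor, le_div_iff₀ hη]
      push_cast [hN]
      linarith
    · refine Int.cast_le (R := ℝ).1 ((Int.floor_le _).trans ?_)
      rw [div_le_iff₀ hη]
      push_cast [hN]
      linarith
  refine (Coverable.of_index (δ := 2 * η) f (Finset.Icc (-N) N ×ˢ Finset.Icc (-N) N)
    (fun x hx => ?_) fun x hx y hy hxy => ?_).mono Subset.rfl ?_ le_rfl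
  · have h := hc x hx
    rw [Complex.dist_eq] at h
    exact Finset.mem_product.2 ⟨hfl _ ((Complex.abs_re_le_norm _).trans h),
      hfl _ ((Complex.abs_im_le_norm _).trans h)⟩
  · refine (hg x hx y hy).trans ?_
    obtain ⟨h1, h2⟩ := Prod.ext_iff.1 hxy
    have e1 := Int.abs_sub_lt_one_of_floor_eq_floor h1
    have e2 := Int.abs_sub_lt_one_of_floor_eq_floor h2
    rw [← sub_div, abs_div, abs_of_pos hη, div_lt_one hη] at e1 e2
    rw [Complex.dist_eq]
    refine (Complex.norm_le_abs_re_add_abs_im _).trans ?_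
    simp only [Complex.sub_re, Complex.sub_im, sub_sub_sub_cancel_right] at e1 e2 ⊢
    linarith
  · rw [Finset.card_product, Int.card_Icc]
    have e : ((N + 1 - -N).toNat : ℝ) = 2 * 2 ^ j + 1 := by
      have : ((N + 1 - -N).toNat : ℤ) = 2 * 2 ^ j + 1 := by
        rw [Int.toNat_of_nonneg (by omega), hN]; ring
      exact_mod_cast this
    have h1 : (1 : ℝ) ≤ 2 ^ j := one_le_pow₀ (by norm_num)
    have h4 : (4 : ℝ) ^ j = 2 ^ j * 2 ^ j := by rw [← mul_pow]; norm_num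
    push_cast
    rw [e, h4]
    nlinarith

variable {s α₁ : ℝ} {k : ℕ} {σ : ℂ × ℂ} (hp : KochParameters s α₁)
include hp

theorem KochParameters.internal_dist_le {u v : RhoSpace (snowflake s α₁) fun _ => 1} {r : ℝ}
    (hr : 0 ≤ r) (h : rhoEDist (snowflake s α₁) (fun _ => 1) u.1 v.1 ≤ ENNReal.ofReal r) :
    dist u v ≤ r := by
  rw [← dist_toRhoClosure_eq]
  exact dist_toRhoClosure_le hp.isOpen hp.isConnected.isPreconnected continuousOn_const hr h

/-- Between points of the closure of a room the internal distance is at most the Euclidean one, so a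
planar grid may be used. -/
theorem IsKochRoom.coverable {H : Set ℂ} (hH : IsKochRoom s α₁ H)
    {A : Set (RhoSpace (snowflake s α₁) fun _ => 1)} (hA : ∀ u ∈ A, u.1 ∈ closure H) {c : ℂ}
    {η : ℝ} (hη : 0 < η) (j : ℕ) (hc : ∀ u ∈ A, dist u.1 c ≤ η * 2 ^ j) :
    Coverable A (9 * 4 ^ j) (2 * η) := by
  refine coverable_of_dist_le (fun u => u.1) (fun u hu v hv => ?_) hη j hc
  have := (isRoomGauge_internal hp).le_room H hH _ (hA u hu) u.2 _ (hA v hv) v.2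
  rw [one_mul, Real.rpow_one] at this
  exact hp.internal_dist_le dist_nonneg this

/-- At scale `2 ^ (-(k + j + 1))` the spike needs `9 * 4 ^ (j + 1)` cells and each of the four
branches over the children is covered by induction. The recursion `N_{j+1} = 9 * 4 ^ (j + 1) + 4
N_j` produces the factor `j + 1`. -/
theorem exists_branch_coverable : ∃ B : ℝ, 4 ≤ B ∧ ∀ (j k : ℕ) (σ : ℂ × ℂ), IsKochSegment s α₁ k σ →
    Coverable {u : RhoSpace (snowflake s α₁) fun _ => 1 | KochBranch s α₁ k σ u.1}
      (9 * (j + 1) * 4 ^ j) (B * (1 / 2) ^ (k + j)) := by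
  have hF := isRoomGauge_internal hp
  obtain ⟨C', hC', hmid⟩ := hF.exists_segMid_le hp
  refine ⟨4 + 2 * C', by linarith, fun j => ?_⟩
  induction j with
  | zero =>
    intro k σ hσ
    refine ⟨{{u | KochBranch s α₁ k σ u.1}}, by norm_num, by simp, fun S hS u hu v hv => ?_⟩
    rw [Finset.mem_singleton] at hS
    subst hS
    have h1 := hmid k σ _ hσ hu
    have h2 := hmid k σ _ hσ hv
    have hl := hp.length_pos k
    have hl' := kochLength_le_pow (s := s) hp.pos hp.lt k
    rw [Real.rpow_one] at h1 h2
    rw [hF.symm] at h2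
    have h3 : dist u v ≤ 2 * (C' * kochLength s α₁ k) := by
      refine hp.internal_dist_le (by positivity) ((hF.triangle _ _ _).trans
        ((add_le_add h1 h2).trans_eq ?_))
      rw [← ENNReal.ofReal_add (by positivity) (by positivity)]
      ring_nf
    have h4 : (0 : ℝ) < (1 / 2) ^ k := by positivity
    rw [add_zero]
    nlinarith
  | succ j ih =>
    intro k σ hσ
    have hne := hσ.ne hp
    have h0 := hp.ratio_pos k
    have h1 := hp.ratio_lt k
    have hpow : (0 : ℝ) < (1 / 2) ^ (k + (j + 1)) := by positivity
    have hspike : Coverable {u : RhoSpace (snowflake s α₁) fun _ => 1 |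
        u.1 ∈ spike (kochRatio s α₁ (k + 1)) σ} (9 * 4 ^ (j + 1))
        (2 * (2 * (1 / 2) ^ (k + (j + 1)))) := by
      refine IsKochRoom.coverable hp (H := spikeInterior (kochRatio s α₁ (k + 1)) σ)
        (Or.inr ⟨k, σ, hσ, rfl⟩)
        (fun u hu => spike_subset_closure_spikeInterior hne h0 h1 hu) (c := segMid σ)
        (by positivity) (j + 1) fun u hu => ?_
      have h2 := KochBranch.dist_le hp hσ (.spike hu) (.spike (segMid_mem_spike hne h0))
      have h3 := kochLength_le_pow (s := s) hp.pos hp.lt k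
      have h4 : (2 : ℝ) * (1 / 2) ^ (k + (j + 1)) * 2 ^ (j + 1) = 2 * (1 / 2) ^ k := by
        rw [pow_add, mul_assoc, mul_assoc, ← mul_pow]; norm_num
      rw [h4]
      linarith
    have hch := Coverable.iUnion fun c : Fin 4 => ih (k + 1) _ (hσ.child c)
    refine ((hspike.mono Subset.rfl le_rfl ?_).union (hch.mono Subset.rfl le_rfl ?_)).mono
      (fun u hu => ?_) ?_ le_rfl
    · nlinarith
    · rw [show k + 1 + j = k + (j + 1) by ring]
    · cases hu with
      | spike h => exact Or.inl h
      | child c h => exact Or.inr (mem_iUnion.2 ⟨c, h⟩)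
    · rw [Fintype.card_fin]
      push_cast
      rw [pow_succ]
      have : (0 : ℝ) < 4 ^ j := by positivity
      nlinarith

theorem packingDim_internalBoundary_le :
    packingDim (internalBoundary (snowflake s α₁)) ≤ ENNReal.ofReal 2 := by
  obtain ⟨B, hB, hcov⟩ := exists_branch_coverable hp
  refine packingDim_le_of_coverable (C := 36 + B) (K := 4) (θ := 1 / 2) (by linarith)
    (by norm_num) (by norm_num) (by norm_num) (by norm_num) fun n => ?_
  have htri : Coverable {u : RhoSpace (snowflake s α₁) fun _ => 1 | u.1 ∈ kochTriangle}
      (9 * 4 ^ n) (2 * (2 * (1 / 2) ^ n)) := by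
    refine IsKochRoom.coverable hp (Or.inl rfl) (fun u hu => subset_closure hu)
      (c := 1 / 2 + (1 / 4 : ℝ) * Complex.I) (by positivity) n fun u hu => ?_
    have h4 : (2 : ℝ) * (1 / 2) ^ n * 2 ^ n = 2 := by
      rw [mul_assoc, ← mul_pow]; norm_num
    rw [h4]
    exact ball_subset_kochTriangle.2 hu
  have hch := Coverable.iUnion fun j : Fin 3 => hcov n 0 (triangleSide j) (.side j)
  have hpow : (0 : ℝ) < (1 / 2) ^ n := by positivity
  have hall : Coverable (univ : Set (RhoSpace (snowflake s α₁) fun _ => 1))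
      ((36 + B) * (n + 1) * 4 ^ n) ((36 + B) * (1 / 2) ^ n) := by
    refine ((htri.mono (δ' := (36 + B) * (1 / 2) ^ n) Subset.rfl le_rfl ?_).union
      (hch.mono Subset.rfl le_rfl ?_)).mono (fun u _ => ?_) ?_ le_rfl
    · nlinarith
    · rw [zero_add]
      nlinarith
    · rcases mem_snowflake_iff.1 u.2 with h | ⟨j, h⟩
      · exact Or.inl h
      · exact Or.inr (mem_iUnion.2 ⟨j, h⟩)
    · rw [Fintype.card_fin]
      have h4 : (0 : ℝ) < 4 ^ n := by positivity
      have h5 : (0 : ℝ) ≤ n * 4 ^ n := by positivity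
      push_cast
      nlinarith
  exact (Coverable.of_denseRange UniformSpace.Completion.coe_isometry
    UniformSpace.Completion.denseRange_coe hall).mono (subset_univ _) le_rfl le_rfl

end BoxCounting

/-! ### The internal boundary has Hausdorff dimension at least two -/

section Area

variable {s α₁ : ℝ} {k : ℕ} {σ : ℂ × ℂ} {w : ℂ}

theorem measurableSet_tent : MeasurableSet (tent σ) := by
  have hX : Measurable (segX σ) := continuous_segX.measurable
  have hY : Measurable (segY σ) := continuous_segY.measurable
  exact (measurableSet_le measurable_const hY).inter ((measurableSet_lt hY hX).inter
    (measurableSet_lt (hX.add hY) measurable_const))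

theorem ball_subset_tent (hσ : σ.1 ≠ σ.2) :
    Metric.ball (segPoint σ (1 / 2) (1 / 4)) (‖σ.2 - σ.1‖ / 8) ⊆ tent σ := by
  intro z hz
  have hn : 0 < ‖σ.2 - σ.1‖ := norm_pos_iff.2 (sub_ne_zero.2 hσ.symm)
  have e1 := (abs_segX_sub_mul_le hσ z _).trans_lt hz
  have e2 := (abs_segY_sub_mul_le hσ z _).trans_lt hz
  rw [segX_segPoint hσ, show ‖σ.2 - σ.1‖ / 8 = 1 / 8 * ‖σ.2 - σ.1‖ by ring] at e1
  rw [segY_segPoint hσ, show ‖σ.2 - σ.1‖ / 8 = 1 / 8 * ‖σ.2 - σ.1‖ by ring] at e2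
  have e1' := abs_lt.1 (lt_of_mul_lt_mul_right e1 hn.le)
  have e2' := abs_lt.1 (lt_of_mul_lt_mul_right e2 hn.le)
  exact ⟨by linarith, by linarith, by linarith⟩

/-- The union of the tents over the descendants of step `k + n` of the segment `σ` of step `k`. -/
def tentLevel (s α₁ : ℝ) : ℕ → ℕ → ℂ × ℂ → Set ℂ
  | 0, _, σ => tent σ
  | n + 1, k, σ => ⋃ c : Fin 4, tentLevel s α₁ n (k + 1) (kochChild (kochRatio s α₁ (k + 1)) σ c)

theorem measurableSet_tentLevel : ∀ n k σ, MeasurableSet (tentLevel s α₁ n k σ)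
  | 0, _, _ => measurableSet_tent
  | n + 1, k, _ => MeasurableSet.iUnion fun _ => measurableSet_tentLevel n (k + 1) _

variable (hp : KochParameters s α₁)
include hp

theorem tentLevel_succ_subset : ∀ n k σ, IsKochSegment s α₁ k σ →
    tentLevel s α₁ (n + 1) k σ ⊆ tentLevel s α₁ n k σ
  | 0, k, _, hσ => iUnion_subset fun c =>
    tent_kochChild_subset (hσ.ne hp) (hp.ratio_pos k) (hp.ratio_lt k) c
  | n + 1, k, _, hσ => iUnion_mono fun c => tentLevel_succ_subset n (k + 1) _ (hσ.child c)

theorem tentLevel_antitone (hσ : IsKochSegment s α₁ k σ) :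
    Antitone fun n => tentLevel s α₁ n k σ :=
  antitone_nat_of_succ_le fun n => tentLevel_succ_subset hp n k σ hσ

theorem tentLevel_disjoint (hσ : IsKochSegment s α₁ k σ) {c c' : Fin 4} (hc : c ≠ c') (n n' : ℕ) :
    Disjoint (tentLevel s α₁ n (k + 1) (kochChild (kochRatio s α₁ (k + 1)) σ c))
      (tentLevel s α₁ n' (k + 1) (kochChild (kochRatio s α₁ (k + 1)) σ c')) :=
  (disjoint_closedTent_tent (hσ.ne hp) (hp.ratio_pos k) (hp.ratio_lt k) hc).mono
    ((tentLevel_antitone hp (hσ.child c) (Nat.zero_le n)).trans tent_subset_closedTent)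
    (tentLevel_antitone hp (hσ.child c') (Nat.zero_le n'))

/-- The `4 ^ n` tents of that level are disjoint, and each contains a disc with radius an eighth of
the length of its base. -/
theorem le_volume_tentLevel : ∀ n k σ, IsKochSegment s α₁ k σ →
    4 ^ n * volume (Metric.ball (0 : ℂ) (kochLength s α₁ (k + n) / 8)) ≤
      volume (tentLevel s α₁ n k σ)
  | 0, k, σ, hσ => by
    rw [pow_zero, one_mul, add_zero, Complex.volume_ball, ← hσ.norm hp]
    refine le_trans (le_of_eq ?_) (measure_mono (ball_subset_tent (hσ.ne hp)))
    rw [Complex.volume_ball]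
  | n + 1, k, σ, hσ => by
    rw [tentLevel, measure_iUnion (fun c c' hc => tentLevel_disjoint hp hσ hc n n)
      (fun c => measurableSet_tentLevel n (k + 1) _), tsum_fintype]
    refine le_trans (le_of_eq ?_)
      (Finset.sum_le_sum fun c _ => le_volume_tentLevel n (k + 1) _ (hσ.child c))
    rw [Finset.sum_const, Finset.card_univ, Fintype.card_fin, nsmul_eq_mul,
      show k + 1 + n = k + (n + 1) by ring, pow_succ]
    push_cast
    ring

/-- As `l_n ≥ c 2 ^ (-n)`, the total area of the `4 ^ n` discs is at least that of a disc of radius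
`c / 8`, for every `n`; the measure is continuous along the decreasing levels. -/
theorem volume_iInter_tentLevel_ne_zero (j : Fin 3) :
    volume (⋂ n, tentLevel s α₁ n 0 (triangleSide j)) ≠ 0 := by
  have hσ : IsKochSegment s α₁ 0 (triangleSide j) := .side j
  obtain ⟨c, hc, hlow⟩ := exists_le_kochLength hp.s_lt hp.pos hp.lt
  have hfin : volume (tentLevel s α₁ 0 0 (triangleSide j)) ≠ ∞ := by
    have : tentLevel s α₁ 0 0 (triangleSide j) ⊆
        Metric.closedBall (segPoint (triangleSide j) 0 0) (2 * ‖(triangleSide j).2 - (triangleSide j).1‖) :=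
      fun z hz => dist_le_of_mem_closedTent (hσ.ne hp) (tent_subset_closedTent hz)
        ⟨by rw [segY_segPoint (hσ.ne hp)], by
          rw [segY_segPoint (hσ.ne hp), segX_segPoint (hσ.ne hp)], by
          rw [segY_segPoint (hσ.ne hp), segX_segPoint (hσ.ne hp)]; norm_num⟩
    exact ((measure_mono this).trans_lt measure_closedBall_lt_top).ne
  have ht := tendsto_measure_iInter_atTop (μ := volume)
    (fun n => (measurableSet_tentLevel (s := s) (α₁ := α₁) n 0 (triangleSide j)).nullMeasurableSet)
    (tentLevel_antitone hp hσ) ⟨0, hfin⟩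
  have hpos : 0 < volume (Metric.ball (0 : ℂ) (c / 8)) :=
    Metric.measure_ball_pos volume 0 (by positivity)
  refine (hpos.trans_le (ge_of_tendsto' ht fun n => ?_)).ne'
  refine le_trans ?_ (le_volume_tentLevel hp n 0 _ hσ)
  have h1 := hlow n
  have h4 : (4 : ℝ≥0∞) ^ n * ENNReal.ofReal ((1 / 2) ^ n) ^ 2 = 1 := by
    have : (4 : ℝ≥0∞) = ENNReal.ofReal 4 := by norm_num
    rw [this, ← ENNReal.ofReal_pow (by norm_num), ← ENNReal.ofReal_pow (by positivity),
      ← ENNReal.ofReal_mul (by positivity), ← pow_mul, mul_comm n 2, pow_mul, ← mul_pow]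
    norm_num
  rw [zero_add, Complex.volume_ball, Complex.volume_ball]
  calc ENNReal.ofReal (c / 8) ^ 2 * NNReal.pi
      = 4 ^ n * (ENNReal.ofReal ((1 / 2) ^ n) ^ 2 * ENNReal.ofReal (c / 8) ^ 2) * NNReal.pi := by
        rw [← mul_assoc (4 ^ n), h4, one_mul]
    _ = 4 ^ n * (ENNReal.ofReal ((1 / 2) ^ n * (c / 8)) ^ 2 * NNReal.pi) := by
        rw [ENNReal.ofReal_mul (by positivity), mul_pow]; ring
    _ ≤ 4 ^ n * (ENNReal.ofReal (kochLength s α₁ n / 8) ^ 2 * NNReal.pi) := by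
        gcongr
        linarith

/-- A point in tents of all generations lies in the tents along a certain address. -/
theorem exists_address_of_mem_tentLevel {j : Fin 3}
    (hw : ∀ n, w ∈ tentLevel s α₁ n 0 (triangleSide j)) :
    ∃ a, ∀ n, w ∈ tent (kochSegment s α₁ j a n) := by
  -- Since the tents of siblings are disjoint, the child found at level `0` serves for all `n`. The
  -- hypotheses stand after the existential quantifier so that the choice is a function of `k` and
  -- `σ` alone.
  have step : ∀ k σ, ∃ c : Fin 4, IsKochSegment s α₁ k σ → (∀ n, w ∈ tentLevel s α₁ n k σ) →
      ∀ n, w ∈ tentLevel s α₁ n (k + 1) (kochChild (kochRatio s α₁ (k + 1)) σ c) := by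
    intro k σ
    by_cases h : IsKochSegment s α₁ k σ ∧ ∀ n, w ∈ tentLevel s α₁ n k σ
    · have h' : ∀ n, ∃ c : Fin 4,
          w ∈ tentLevel s α₁ n (k + 1) (kochChild (kochRatio s α₁ (k + 1)) σ c) :=
        fun n => mem_iUnion.1 (h.2 (n + 1))
      obtain ⟨c, hc⟩ := h' 0
      refine ⟨c, fun _ _ n => ?_⟩
      obtain ⟨c', hc'⟩ := h' n
      by_cases hcc : c = c'
      · exact hcc ▸ hc'
      · exact absurd hc' (disjoint_left.1 (tentLevel_disjoint hp h.1 hcc 0 n) hc)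
    · exact ⟨0, fun h1 h2 => absurd ⟨h1, h2⟩ h⟩
  choose c hc using step
  let S : ℕ → ℂ × ℂ := fun n => Nat.rec (triangleSide j)
    (fun k σ => kochChild (kochRatio s α₁ (k + 1)) σ (c k σ)) n
  have hS : ∀ k, kochSegment s α₁ j (fun k => c k (S k)) k = S k := fun k => by
    induction k with
    | zero => rfl
    | succ k ih => simp only [kochSegment, ih]; rfl
  have hall : ∀ k n, w ∈ tentLevel s α₁ n k (kochSegment s α₁ j (fun k => c k (S k)) k) := fun k => by
    induction k with
    | zero => exact hw
    | succ k ih =>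
      have := hc k _ (isKochSegment_kochSegment j _ k) ih
      rw [hS k] at this
      simp only [kochSegment, hS k]
      exact this
  exact ⟨fun k => c k (S k), fun n => hall n 0⟩

/-- A point in the tents along an address is the plane image of the boundary point with this
address, because the tents shrink. So the `1`-Lipschitz map to the plane sends the internal boundary
onto a set containing one of positive area. -/
theorem two_le_dimH_internalBoundary : 2 ≤ dimH (internalBoundary (snowflake s α₁)) := by
  have hc := hp.isConnected.isPreconnected
  obtain ⟨f, hf, hfΩ⟩ := exists_internalClosure_map hp.isOpen hc
  refine two_le_dimH_of_volume_image_ne_zero hf fun h0 =>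
    volume_iInter_tentLevel_ne_zero hp 0 (measure_mono_null (fun w hw => ?_) h0)
  obtain ⟨a, ha⟩ := exists_address_of_mem_tentLevel hp (mem_iInter.1 hw)
  obtain ⟨P, hP, -⟩ := exists_addressPoint hp (continuousOn_const (c := (1 : ℝ)))
    (isRoomGauge_internal hp) 0
  refine ⟨P a, notMem_range_of_tendsto_addressMid hp continuous_id (fun _ => rfl) (hP a), ?_⟩
  have h1 := (hf.continuous.tendsto _).comp (hP a)
  simp only [Function.comp_def, hfΩ] at h1
  refine tendsto_nhds_unique h1 (tendsto_iff_dist_tendsto_zero.2 (squeeze_zero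
    (fun _ => dist_nonneg) (fun n => ?_)
    (by simpa using (tendsto_kochLength (s := s) hp.pos hp.lt).const_mul 2)))
  have hσ := isKochSegment_kochSegment (s := s) (α₁ := α₁) 0 a n
  rw [← hσ.norm hp]
  exact dist_le_of_mem_closedTent (hσ.ne hp)
    ((branch_addressMid hp le_rfl).mem_closedTent hp hσ) (tent_subset_closedTent (ha n))

end Area

/-! ### The main theorem -/

section Main

variable {s α₁ : ℝ} (hp : KochParameters s α₁)

theorem hasAddress_iff {j : Fin 3} {a : ℕ → Fin 4}
    {p : RhoClosure (snowflake s α₁) (snowflakeDensity s α₁)} :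
    HasAddress s α₁ j a p ↔ Tendsto (fun n => toRhoClosure (snowflake s α₁)
      (snowflakeDensity s α₁) (addressMid hp j a n)) atTop (𝓝 p) := by
  constructor
  · rintro ⟨x, hx, h⟩
    have : x = addressMid hp j a := funext fun k => Subtype.ext
      ((hx k).trans (segMid_eq_midpoint _).symm)
    rwa [this] at h
  · exact fun h => ⟨addressMid hp j a, fun k => segMid_eq_midpoint _, h⟩

theorem snowflakeCantor_eq_range
    {P : (ℕ → Fin 4) → RhoClosure (snowflake s α₁) (snowflakeDensity s α₁)}
    (hP : ∀ a, Tendsto (fun n => toRhoClosure (snowflake s α₁)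
      (snowflakeDensity s α₁) (addressMid hp 0 a n)) atTop (𝓝 (P a))) :
    snowflakeCantor s α₁ = range fun b : ℕ → Fin 2 => P fun i => spikeDigit (b i) := by
  ext p
  constructor
  · rintro ⟨a, ha, h⟩
    have hb : ∀ i, ∃ b : Fin 2, spikeDigit b = a i := fun i => by
      rcases ha i with h | h
      · exact ⟨0, by simp [spikeDigit, h]⟩
      · exact ⟨1, by simp [spikeDigit, h]⟩
    choose b hb using hb
    refine ⟨b, ?_⟩
    simp only [hb]
    exact tendsto_nhds_unique (hP a) ((hasAddress_iff hp).1 h)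
  · rintro ⟨b, rfl⟩
    exact ⟨_, fun i => spikeDigit_eq _, (hasAddress_iff hp).2 (hP _)⟩

end Main

end

theorem mainTheorem8 (s α₁ : ℝ) (hs₀ : 0 < s) (hs₁ : s < 1 / 2) (hα₀ : 0 < α₁)
    (hα₁ : α₁ < 1 / 2) :
    IsOpen (snowflake s α₁) ∧ IsConnected (snowflake s α₁) ∧ ¬ IsJohn (snowflake s α₁) ∧
    IsDensity (snowflake s α₁) (snowflakeDensity s α₁) ∧
    (∀ q ∈ internalBoundary (snowflake s α₁),
      lowerExponent (snowflake s α₁) (snowflakeDensity s α₁) q = ((-1 / 2 : ℝ) : EReal) ∧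
      upperExponent (snowflake s α₁) (snowflakeDensity s α₁) q = ((-1 / 2 : ℝ) : EReal)) ∧
    snowflakeCantor s α₁ ⊆ rhoBoundary (snowflake s α₁) (snowflakeDensity s α₁) ∧
    dimH (internalImage (snowflakeCantor s α₁)) = 1 ∧
    packingDim (internalImage (snowflakeCantor s α₁)) = 1 ∧
    dimH (internalBoundary (snowflake s α₁)) = 2 ∧
    packingDim (internalBoundary (snowflake s α₁)) = 2 ∧
    dimH (snowflakeCantor s α₁) = ENNReal.ofReal (1 / s) ∧
    packingDim (snowflakeCantor s α₁) = ENNReal.ofReal (1 / s) ∧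
    2 * dimH (internalImage (snowflakeCantor s α₁)) < dimH (snowflakeCantor s α₁) ∧
    2 * packingDim (internalImage (snowflakeCantor s α₁)) < packingDim (snowflakeCantor s α₁) ∧
    ¬ HausdorffUpperBound (snowflake s α₁) (snowflakeDensity s α₁) (-1 / 2) ∧
    ¬ PackingUpperBound (snowflake s α₁) (snowflakeDensity s α₁) (-1 / 2) := by
  have hp : KochParameters s α₁ := ⟨hs₀, hs₁, hα₀, hα₁⟩
  have hc := hp.isConnected.isPreconnected
  obtain ⟨φ, ψ, hφ, hψ, hφΩ, hψΩ⟩ := hp.exists_completion_maps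
  obtain ⟨C, hC⟩ := exists_isRoomGauge_density hp
  obtain ⟨P, hP, hP1, hP2⟩ := exists_cantor_dimension hp hp.continuousOn_density hC one_pos
    (fun k σ z hσ hz => by rw [one_mul]; exact hz.le_density hp hσ) 0
  obtain ⟨Q, hQ, hQ1, hQ2⟩ := exists_cantor_dimension hp (continuousOn_const (c := (1 : ℝ)))
    (isRoomGauge_internal hp) one_pos
    (fun k σ z hσ hz => by rw [one_mul, sub_self, Real.rpow_zero]) 0
  have hA := snowflakeCantor_eq_range hp hP
  have hPQ : ∀ a, φ (P a) = Q a := fun a => by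
    have h := (hφ.tendsto _).comp (hP a)
    simp only [Function.comp_def, hφΩ] at h
    exact tendsto_nhds_unique h (hQ a)
  have hI : internalImage (snowflakeCantor s α₁) =
      range fun b : ℕ → Fin 2 => Q fun i => spikeDigit (b i) := by
    rw [internalImage_eq hφ hφΩ, hA, ← range_comp]
    simp only [Function.comp_def, hPQ]
  have hbd : ∀ a, P a ∈ rhoBoundary (snowflake s α₁) (snowflakeDensity s α₁) := fun a =>
    notMem_range_of_tendsto_addressMid hp hφ hφΩ (hP a)
  have hAbd : snowflakeCantor s α₁ ⊆ rhoBoundary (snowflake s α₁) (snowflakeDensity s α₁) := by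
    rw [hA]
    rintro _ ⟨b, rfl⟩
    exact hbd _
  have hexp : ∀ q ∈ internalBoundary (snowflake s α₁),
      lowerExponent (snowflake s α₁) (snowflakeDensity s α₁) q = ((-1 / 2 : ℝ) : EReal) ∧
      upperExponent (snowflake s α₁) (snowflakeDensity s α₁) q = ((-1 / 2 : ℝ) : EReal) :=
    fun q hq => exponents_of_rpow_bdryDist hp.isOpen hc hp.frontier_nonempty _ hq
  rw [← hA] at hP1 hP2
  rw [← hI, div_one, ENNReal.ofReal_one] at hQ1 hQ2
  have h2 : packingDim (internalBoundary (snowflake s α₁)) ≤ 2 :=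
    (packingDim_internalBoundary_le hp).trans_eq (by norm_num)
  have h2' := two_le_dimH_internalBoundary hp
  have h2'' := dimH_le_packingDim (internalBoundary (snowflake s α₁))
  -- The strict inequality `s < 1/2` makes both upper bounds fail: they would read `1 / (2s) ≤ 1`
  -- for the Cantor set.
  have h12 : 1 < 1 / 2 * (1 / s) := by
    rw [one_div_mul_one_div, lt_div_iff₀ (by positivity)]
    linarith
  have hlt : (2 : ℝ≥0∞) < ENNReal.ofReal (1 / s) := by
    have : (2 : ℝ≥0∞) = ENNReal.ofReal 2 := by norm_num
    rw [this]
    exact (ENNReal.ofReal_lt_ofReal_iff (by positivity)).2 (by linarith)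
  have hhalf : (1 : ℝ≥0∞) < ENNReal.ofReal (1 + -1 / 2) * ENNReal.ofReal (1 / s) := by
    rw [← ENNReal.ofReal_mul (by norm_num), ← ENNReal.ofReal_one]
    exact (ENNReal.ofReal_lt_ofReal_iff (by norm_num; positivity)).2 (by norm_num at h12 ⊢; exact h12)
  have hB : snowflakeCantor s α₁ ⊆ {p ∈ rhoBoundary (snowflake s α₁) (snowflakeDensity s α₁) |
      ∃ q, IsSamePoint (snowflake s α₁) (snowflakeDensity s α₁) p q ∧
        ((-1 / 2 : ℝ) : EReal) ≤ lowerExponent (snowflake s α₁) (snowflakeDensity s α₁) q} := by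
    intro p hpA
    refine ⟨hAbd hpA, φ p, (isSamePoint_iff hφ hφΩ).2 rfl, (hexp (φ p) ?_).1.ge⟩
    rw [hA] at hpA
    obtain ⟨b, rfl⟩ := hpA
    beta_reduce
    rw [hPQ]
    exact notMem_range_of_tendsto_addressMid hp continuous_id (fun _ => rfl) (hQ _)
  refine ⟨hp.isOpen, hp.isConnected, hp.not_isJohn,
    isDensity_of_hoelder hp.continuousOn_density (fun x hx => Real.rpow_pos_of_pos
      (bdryDist_pos hp.isOpen hp.frontier_nonempty hx) _) hφ hφΩ hψ hψΩ ⟨_, hbd fun _ => 0⟩,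
    hexp, hAbd, hQ1, hQ2, le_antisymm (h2''.trans h2) h2', le_antisymm h2 (h2'.trans h2''),
    hP1, hP2, ?_, ?_, ?_, ?_⟩
  · rw [hQ1, hP1, mul_one]
    exact hlt
  · rw [hQ2, hP2, mul_one]
    exact hlt
  · intro h
    have := h _ hB
    rw [hP1, hQ1] at this
    exact absurd this (not_le.2 hhalf)
  · intro h
    have := h _ hB
    rw [hP2, hQ2] at this
    exact absurd this (not_le.2 hhalf)
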